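/- Fix integers $L, n_0, n_{L+1}\ge 1$, a compact set $T\subset\mathbb R^{n_0}$, and constants $C_W>0$, $C_b\ge 0$. Let $\sigma:\mathbb R\to\mathbb R$ be absolutely continuous on every compact interval, with almost-everywhere defined derivative satisfying $\left\|\sigma'(x)/(1+|x|^k)\right\|_{L^\infty(\mathbb R)}<\infty$ for some $k>0$. Let $\mu$ be a probability distribution on $\mathbb R$ with mean $0$, variance $1$, and all moments finite. For hidden widths $n_1,\dots,n_L\ge 1$ consider the random fully connected network which to an input $x\in\mathbb R^{n_0}$ assigns the vectors $z^{(\ell)}(x)\in\mathbb R^{n_\ell}$, $1\le \ell\le L+1$, given by \[ z^{(1)}_i(x)=b^{(1)}_i+\sum_{j=1}^{n_0}W^{(1)}_{ij}x_j,\qquad z^{(\ell)}_i(x)=b^{(\ell)}_i+\sum_{j=1}^{n_{\ell-1}}W^{(\ell)}_{ij}\,\sigma\big(z^{(\ell-1)}_j(x)\big)\quad (2\le \ell\le L+1), \] where $W^{(\ell)}_{ij}=(C_W/n_{\ell-1})^{1/2}\,\widehat W^{(\ell)}_{ij}$, the $\widehat W^{(\ell)}_{ij}$ have law $\mu$, the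 $b^{(\ell)}_i$ have law $\mathcal N(0,C_b)$, and all the variables $\widehat W^{(\ell)}_{ij}$, $b^{(\ell)}_i$ are independent. Then, as $n_1,\dots,n_L\to\infty$ jointly (that is, as $\min_{1\le \ell\le L} n_\ell\to\infty$), the random field $x\mapsto z^{(L+1)}(x)$ converges weakly in $C^0(T,\mathbb R^{n_{L+1}})$ to a centered Gaussian process with values in $\mathbb R^{n_{L+1}}$ whose coordinates are independent and identically distributed. At all finite widths every $z^{(\ell)}_i(x)$ is square integrable, and for $2\le \ell\le L+1$ and all $x,y\in\mathbb R^{n_0}$ the limit \[ K^{(\ell)}(x,y)=\lim_{n_1,\dots,n_L\to\infty}\operatorname{Cov}\big(z^{(\ell)}_i(x),z^{(\ell)}_i(y)\big) \] exists and does not depend on $i$ (which may even vary with the widths). The covariance function of each coordinate of the limiting process is the restriction of $K^{(L+1)}$ to $T\times T$. The functions $K^{(\ell)}$ satisfy the initial condition \[ K^{(2)}(x,y)=C_b+C_W\,\mathbb E\big[\sigma(z^{(1)}_1(x))\,\sigma(z^{(1)}_1(y))\big], \] in which the law of $(z^{(1)}_1(x),z^{(1)}_1(y))$ is the one determined by the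 weights and biases of the first layer (so that it depends on $\mu$), and the recursion \[ K^{(\ell+1)}(x,y)=C_b+C_W\,\mathbb E\big[\sigma(z_x)\,\sigma(z_y)\big],\qquad \begin{pmatrix}z_x\\ z_y\end{pmatrix}\sim\mathcal N\!\left(0,\begin{pmatrix}K^{(\ell)}(x,x)&K^{(\ell)}(x,y)\\ K^{(\ell)}(x,y)&K^{(\ell)}(y,y)\end{pmatrix}\right), \] for $2\le \ell\le L$ (and this recursion defines $K^{(\ell)}$ for $\ell>L+1$); here the expectations are finite and the covariance matrices are positive semidefinite. -/

import Mathlib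

open Filter Topology MeasureTheory ProbabilityTheory
open scoped NNReal

/-- Absolute continuity of a function on the whole real line: absolute continuity on every
compact interval. -/
def LocallyAbsolutelyContinuous (σ : ℝ → ℝ) : Prop :=
  ∀ a b : ℝ, AbsolutelyContinuousOnInterval σ a b

theorem LocallyAbsolutelyContinuous.continuous {σ : ℝ → ℝ}
    (hσ : LocallyAbsolutelyContinuous σ) : Continuous σ := by
  rw [continuous_iff_continuousAt]
  intro x
  refine (hσ (x - 1) (x + 1)).continuousOn.continuousAt ?_
  rw [Set.uIcc_of_le (by linarith)]
  exact Icc_mem_nhds (by linarith) (by linarith)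

/-- The almost everywhere defined derivative of `σ` is polynomially bounded: for some `k > 0`
the function `σ' / (1 + |x| ^ k)` belongs to `L^∞(ℝ)`. -/
def PolynomiallyBoundedDeriv (σ : ℝ → ℝ) : Prop :=
  ∃ k : ℝ, 0 < k ∧ ∃ C : ℝ, ∀ᵐ x : ℝ, |deriv σ x| ≤ C * (1 + |x| ^ k)

/-- The widths of the layers `0, 1, …, L + 1` of a fully connected network with input dimension
`n₀`, hidden widths `n 0, …, n (L - 1)` (layers `1, …, L`) and output dimension `nOut`.
(Values at layers beyond `L + 1` are never used.) -/
abbrev layerWidth {L : ℕ} (n₀ nOut : ℕ) (n : Fin L → ℕ+) : ℕ → ℕ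
  | 0 => n₀
  | ℓ + 1 => if h : ℓ < L then (n ⟨ℓ, h⟩ : ℕ) else nOut

theorem layerWidth_output {L : ℕ} (n₀ nOut : ℕ) (n : Fin L → ℕ+) :
    layerWidth n₀ nOut n (L + 1) = nOut := by
  simp [layerWidth]

/-- The vector of pre-activations at layer `ℓ` of the fully connected network with layer widths
`N 0, N 1, …`, non-linearity `σ`, and input `x`. Here `W ℓ` and `b ℓ` are the weight matrix and
the bias vector which lead from layer `ℓ` to layer `ℓ + 1`; layer `0` is the input itself, and
`σ` is not applied to the input. -/
def preactivation {N : ℕ → ℕ} (σ : ℝ → ℝ) (W : ∀ ℓ, Matrix (Fin (N (ℓ + 1))) (Fin (N ℓ)) ℝ)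
    (b : ∀ ℓ, Fin (N (ℓ + 1)) → ℝ) (x : EuclideanSpace ℝ (Fin (N 0))) : ∀ ℓ, Fin (N ℓ) → ℝ
  | 0 => fun i => x i
  | 1 => fun i => b 0 i + ∑ j, W 0 i j * x j
  | ℓ + 2 => fun i => b (ℓ + 1) i + ∑ j, W (ℓ + 1) i j * σ (preactivation σ W b x (ℓ + 1) j)

theorem continuous_preactivation {N : ℕ → ℕ} {σ : ℝ → ℝ} (hσ : Continuous σ)
    (W : ∀ ℓ, Matrix (Fin (N (ℓ + 1))) (Fin (N ℓ)) ℝ) (b : ∀ ℓ, Fin (N (ℓ + 1)) → ℝ) :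
    ∀ (ℓ : ℕ) (i : Fin (N ℓ)), Continuous fun x => preactivation σ W b x ℓ i
  | 0, i => by
    simp only [preactivation]
    fun_prop
  | 1, i => by
    simp only [preactivation]
    fun_prop
  | ℓ + 2, i => by
    have ih := continuous_preactivation hσ W b (ℓ + 1)
    simp only [preactivation]
    fun_prop

/-- The weight matrices `W = (C_W / N ℓ) ^ (1/2) • Ŵ` obtained from unscaled weights `Ŵ`. -/
noncomputable def scaledWeights {N : ℕ → ℕ} (CW : ℝ)
    (What : ∀ ℓ, Matrix (Fin (N (ℓ + 1))) (Fin (N ℓ)) ℝ) (ℓ : ℕ) :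
    Matrix (Fin (N (ℓ + 1))) (Fin (N ℓ)) ℝ :=
  Real.sqrt (CW / (N ℓ : ℝ)) • What ℓ

/-- The `i`-th pre-activation at layer `ℓ` and input `x` of the network with random unscaled
weights `What` and random biases `b`, as a random variable. -/
noncomputable def randomPreactivation {Ω : Type*} {N : ℕ → ℕ} (σ : ℝ → ℝ) (CW : ℝ)
    (What : Ω → ∀ ℓ, Matrix (Fin (N (ℓ + 1))) (Fin (N ℓ)) ℝ)
    (b : Ω → ∀ ℓ, Fin (N (ℓ + 1)) → ℝ) (x : EuclideanSpace ℝ (Fin (N 0))) (ℓ : ℕ)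
    (i : Fin (N ℓ)) (ω : Ω) : ℝ :=
  preactivation σ (scaledWeights CW (What ω)) (b ω) x ℓ i

/-- The unscaled weights `What` and the biases `b` of the layers `1, …, L + 1` of a network with
layer widths `N` are independent under `P`, the unscaled weights all have law `μ`, and the biases
all have law `𝒩(0, Cb)`. -/
structure IsRandomInit {Ω : Type*} [MeasurableSpace Ω] (P : Measure Ω) (L : ℕ) (N : ℕ → ℕ)
    (μ : Measure ℝ) (Cb : ℝ≥0)
    (What : Ω → ∀ ℓ, Matrix (Fin (N (ℓ + 1))) (Fin (N ℓ)) ℝ)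
    (b : Ω → ∀ ℓ, Fin (N (ℓ + 1)) → ℝ) : Prop where
  weight_law : ∀ ℓ ≤ L, ∀ i j, HasLaw (fun ω => What ω ℓ i j) μ P
  bias_law : ∀ ℓ ≤ L, ∀ i, HasLaw (fun ω => b ω ℓ i) (gaussianReal 0 Cb) P
  indep : iIndepFun
    (Sum.elim
      (fun (k : Σ ℓ : Fin (L + 1), Fin (N (ℓ + 1)) × Fin (N ℓ)) (ω : Ω) =>
        What ω k.1 k.2.1 k.2.2)
      (fun (k : Σ ℓ : Fin (L + 1), Fin (N (ℓ + 1))) (ω : Ω) => b ω k.1 k.2)) P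

/-- The output `x ↦ z^(L+1)(x)` of the network, as a continuous function on `T`. -/
def outputField {L n₀ nOut : ℕ} {n : Fin L → ℕ+} {σ : ℝ → ℝ} (hσ : Continuous σ)
    (T : Set (EuclideanSpace ℝ (Fin n₀)))
    (W : ∀ ℓ, Matrix (Fin (layerWidth n₀ nOut n (ℓ + 1))) (Fin (layerWidth n₀ nOut n ℓ)) ℝ)
    (b : ∀ ℓ, Fin (layerWidth n₀ nOut n (ℓ + 1)) → ℝ) :
    C(T, EuclideanSpace ℝ (Fin nOut)) where
  toFun x := WithLp.toLp 2 fun i =>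
    preactivation σ W b (x : EuclideanSpace ℝ (Fin n₀)) (L + 1)
      (Fin.cast (layerWidth_output n₀ nOut n).symm i)
  continuous_toFun := by
    refine (PiLp.continuous_toLp 2 _).comp (continuous_pi fun i => ?_)
    exact (continuous_preactivation (N := layerWidth n₀ nOut n) hσ W b (L + 1) _).comp
      continuous_subtype_val

/-!
The proof propagates two facts through the layers `ℓ = 1, …, L + 1`.

*Moment bounds* (`HasMomentBounds`). All moments of `z^(ℓ)_i(x)`, and all moments of the increments
`z^(ℓ)_i(x) - z^(ℓ)_i(y)` divided by `‖x - y‖`, are bounded for `x`, `y` in a bounded set, uniformly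
in the widths and the neuron. Given the previous layers, `z^(ℓ+1)_i` is a sum of independent centered
variables with coefficients of size `N_ℓ ^ (-1/2)`, so a Marcinkiewicz–Zygmund inequality
(`eLpNorm_sum_mul_sq_le`) passes from the activations of one layer to the pre-activations of the
next. From pre-activations to activations one uses that `σ` is Lipschitz with constants of polynomial growth (`exists_polynomial_lipschitz`).

*Convergence of characteristic functions* (`HasLimitCharFun`). The values of finitely many neurons
of layer `ℓ` at finitely many inputs converge in law, uniformly over the choice of distinct neurons,
and distinct neurons become independent. For `ℓ = 1` this holds exactly, without a limit. In the
induction step, asymptotic independence and the moment bounds imply a law of large numbers for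
`N_ℓ⁻¹ ∑ j, σ (z^(ℓ)_j(x)) σ (z^(ℓ)_j(y))`, with a deterministic limit `M x y`
(`HasLimitCharFun.hasLimitSecondMoment`). This average is, up to `CW` and the variance `Cb` of the
bias, the conditional covariance of layer `ℓ + 1` given the previous layers. A third order Taylor
expansion of the characteristic function of the weights, in other words a quantitative central
limit theorem conditional on layer `ℓ` (`IsMeasurableInit.norm_integral_exp_sub_le`), then shows
that the neurons of layer `ℓ + 1` converge to independent centered Gaussian processes with
covariance `Cb + CW * M x y` (`HasLimitSecondMoment.hasLimitCharFun_succ`). The first `M`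
is an expectation under the law of the first layer, the later ones are expectations under Gaussian
laws; this is the recursion for the kernels (`kernelSeq`).

The moment bounds upgrade convergence in law to convergence of covariances
(`HasLimitCharFun.tendsto_covariance`). Being also bounds on increments, they imply by Kolmogorov's
criterion, proved here by dyadic chaining (`isTightMeasureSet_of_increments`), that the laws of the
output fields are tight in `C(T, ℝ^nOut)`. By Prokhorov's theorem, and since a law on this space is
determined by its finite-dimensional characteristic functions, the output fields converge in
distribution (`exists_tendstoInDistribution_of_isTight`). The characteristic functions of the limit
are those of a centered Gaussian process with independent coordinates, from which the remaining
properties of the limit are read off (`IsIsotropicGaussian`).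
-/

/-! ### The non-linearity -/

theorem rpow_le_one_add_pow_ceil {x k : ℝ} (hx : 0 ≤ x) (hk : 0 ≤ k) :
    x ^ k ≤ 1 + x ^ ⌈k⌉₊ := by
  rcases le_total x 1 with h | h
  · linarith [Real.rpow_le_one hx h hk, pow_nonneg hx ⌈k⌉₊]
  · have := Real.rpow_le_rpow_of_exponent_le h (Nat.le_ceil k)
    rw [Real.rpow_natCast] at this
    linarith

/-- `σ` is Lipschitz with a local constant of polynomial growth, by the fundamental theorem of
calculus for absolutely continuous functions. -/
theorem exists_polynomial_lipschitz {σ : ℝ → ℝ} (hσ : LocallyAbsolutelyContinuous σ)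
    (hσ' : PolynomiallyBoundedDeriv σ) :
    ∃ C : ℝ≥0, ∃ k : ℕ, ∀ u v, |σ u - σ v| ≤ C * (1 + |u| ^ k + |v| ^ k) * |u - v| := by
  obtain ⟨k, hk, C, hC⟩ := hσ'
  refine ⟨2 * ‖C‖₊, ⌈k⌉₊, fun u v => ?_⟩
  rw [← (hσ v u).integral_deriv_eq_sub]
  suffices ‖∫ x in v..u, deriv σ x‖
      ≤ (2 * ‖C‖₊ : ℝ≥0) * (1 + |u| ^ ⌈k⌉₊ + |v| ^ ⌈k⌉₊) * |u - v| by simpa using this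
  refine intervalIntegral.norm_integral_le_of_norm_le_const_ae (hC.mono fun x hx hxm => ?_)
  have hmax : |x| ≤ max |u| |v| := by
    rcases Set.mem_uIoc.1 hxm with h | h
    · exact max_comm |u| |v| ▸ abs_le_max_abs_abs h.1.le h.2
    · exact abs_le_max_abs_abs h.1.le h.2
  have h1 : |x| ^ ⌈k⌉₊ ≤ |u| ^ ⌈k⌉₊ + |v| ^ ⌈k⌉₊ := by
    rcases le_max_iff.1 hmax with h | h
    · linarith [pow_le_pow_left₀ (abs_nonneg x) h ⌈k⌉₊, pow_nonneg (abs_nonneg v) ⌈k⌉₊]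
    · linarith [pow_le_pow_left₀ (abs_nonneg x) h ⌈k⌉₊, pow_nonneg (abs_nonneg u) ⌈k⌉₊]
  have h2 := rpow_le_one_add_pow_ceil (abs_nonneg x) hk.le
  have h3 : 0 ≤ |x| ^ k := by positivity
  have h4 : 0 ≤ |u| ^ ⌈k⌉₊ := by positivity
  have h5 : 0 ≤ |v| ^ ⌈k⌉₊ := by positivity
  rw [Real.norm_eq_abs]
  push_cast
  rw [Real.norm_eq_abs]
  calc |deriv σ x| ≤ C * (1 + |x| ^ k) := hx
    _ ≤ |C| * (1 + |x| ^ k) := by gcongr; exact le_abs_self C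
    _ ≤ |C| * (2 * (1 + |u| ^ ⌈k⌉₊ + |v| ^ ⌈k⌉₊)) := by gcongr; linarith
    _ = _ := by ring

/-- A non-linearity as in `exists_polynomial_lipschitz` has polynomial growth. -/
theorem exists_polynomial_growth {σ : ℝ → ℝ} {C : ℝ≥0} {k : ℕ}
    (hσ : ∀ u v, |σ u - σ v| ≤ C * (1 + |u| ^ k + |v| ^ k) * |u - v|) :
    ∃ C' : ℝ≥0, ∃ k' : ℕ, ∀ u, |σ u| ≤ C' * (1 + |u| ^ k') := by
  refine ⟨3 * C + ‖σ 0‖₊, k + 1, fun u => ?_⟩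
  have h := hσ u 0
  have h0 : |(0 : ℝ)| ^ k ≤ 1 := by
    rw [abs_zero]; exact pow_le_one₀ le_rfl zero_le_one
  rw [sub_zero] at h
  have h1 : |σ u| ≤ |σ 0| + |σ u - σ 0| := by
    have := abs_add_le (σ 0) (σ u - σ 0)
    simpa using this
  have hpos := abs_nonneg u
  have h2 : |u| ≤ 1 + |u| ^ (k + 1) := by
    rcases le_total |u| 1 with h | h
    · linarith [pow_nonneg hpos (k + 1)]
    · linarith [le_self_pow₀ h (by omega : k + 1 ≠ 0)]
  have hC : (0 : ℝ) ≤ C := C.2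
  have h3 : (C : ℝ) * (1 + |u| ^ k + |(0 : ℝ)| ^ k) * |u| ≤ C * (3 * (1 + |u| ^ (k + 1))) := by
    rw [mul_assoc]
    refine mul_le_mul_of_nonneg_left ?_ hC
    calc (1 + |u| ^ k + |(0 : ℝ)| ^ k) * |u| ≤ (1 + |u| ^ k + 1) * |u| := by gcongr
      _ = 2 * |u| + |u| ^ (k + 1) := by ring
      _ ≤ _ := by linarith [pow_nonneg hpos (k + 1)]
  push_cast
  rw [Real.norm_eq_abs]
  have h4 : |σ 0| ≤ |σ 0| * (1 + |u| ^ (k + 1)) :=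
    le_mul_of_one_le_right (abs_nonneg _) (by linarith [pow_nonneg hpos (k + 1)])
  linarith

/-! ### Characteristic functions of centred laws with unit variance -/

/-- The third order Taylor bound for `θ ↦ exp (iθ)`, with a crude constant. -/
theorem norm_exp_mul_I_sub_taylor_le (θ : ℝ) :
    ‖Complex.exp (θ * Complex.I) - (1 + θ * Complex.I - (θ : ℂ) ^ 2 / 2)‖ ≤ 4 * |θ| ^ 3 := by
  have hθ : ‖(θ : ℂ) * Complex.I‖ = |θ| := by simp
  rcases le_total |θ| 1 with h | h
  · have := Complex.exp_bound (x := θ * Complex.I) (by rwa [hθ]) (n := 3) (by norm_num)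
    rw [hθ] at this
    have e : ∑ m ∈ Finset.range 3, ((θ : ℂ) * Complex.I) ^ m / (m.factorial : ℂ)
        = 1 + θ * Complex.I - (θ : ℂ) ^ 2 / 2 := by
      simp [Finset.sum_range_succ, mul_pow, Nat.factorial]
      ring
    rw [e] at this
    refine this.trans ?_
    rw [mul_comm]
    gcongr
    norm_num [Nat.factorial]
  · have h1 : |θ| ≤ |θ| ^ 3 := le_self_pow₀ h (by norm_num)
    have h2 : |θ| ^ 2 ≤ |θ| ^ 3 := pow_le_pow_right₀ h (by norm_num)
    calc _ ≤ ‖Complex.exp (θ * Complex.I)‖ + (‖(1 : ℂ)‖ + ‖(θ : ℂ) * Complex.I‖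
          + ‖(θ : ℂ) ^ 2 / 2‖) := by
          refine (norm_sub_le _ _).trans ?_
          gcongr
          exact (norm_sub_le _ _).trans (by gcongr; exact norm_add_le _ _)
      _ = 1 + (1 + |θ| + |θ| ^ 2 / 2) := by
          rw [hθ, Complex.norm_exp_ofReal_mul_I]; simp
      _ ≤ 4 * |θ| ^ 3 := by linarith

theorem abs_exp_neg_half_sq_sub_le (u : ℝ) :
    |Real.exp (-(u ^ 2 / 2)) - (1 - u ^ 2 / 2)| ≤ |u| ^ 3 := by
  have hv : 0 ≤ u ^ 2 / 2 := by positivity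
  have h1 : 0 ≤ Real.exp (-(u ^ 2 / 2)) - (1 - u ^ 2 / 2) := by
    linarith [Real.add_one_le_exp (-(u ^ 2 / 2))]
  rw [abs_of_nonneg h1]
  rw [← sq_abs u] at *
  rcases le_total |u| 1 with h | h
  · have h2 := Real.abs_exp_sub_one_sub_id_le (x := -(|u| ^ 2 / 2)) (by
      rw [abs_neg, abs_of_nonneg hv]
      nlinarith [abs_nonneg u])
    have h3 := (abs_le.1 h2).2
    have h4 : |u| ^ 4 ≤ |u| ^ 3 := pow_le_pow_of_le_one (abs_nonneg u) h (by norm_num)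
    nlinarith [pow_nonneg (abs_nonneg u) 4]
  · have h2 : Real.exp (-(|u| ^ 2 / 2)) ≤ 1 := Real.exp_le_one_iff.2 (by linarith)
    have h3 : |u| ^ 2 ≤ |u| ^ 3 := pow_le_pow_right₀ h (by norm_num)
    nlinarith [sq_nonneg u]

/-- For a law with mean `0`, variance `1` and a finite third moment, the characteristic function
is within a multiple of `|u| ^ 3` of that of the standard Gaussian. -/
theorem exists_charFun_sub_exp_le {μ : Measure ℝ} [IsProbabilityMeasure μ]
    (hμ : ∀ p : ℕ, Integrable (fun w => |w| ^ p) μ) (hm : ∫ w, w ∂μ = 0) (hv : ∫ w, w ^ 2 ∂μ = 1) :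
    ∃ C : ℝ, 0 ≤ C ∧ ∀ u : ℝ,
      ‖charFun μ u - Real.exp (-(u ^ 2 / 2))‖ ≤ C * |u| ^ 3 := by
  refine ⟨4 * ∫ w, |w| ^ 3 ∂μ + 1, by positivity, fun u => ?_⟩
  have i1 : Integrable (fun w : ℝ => w) μ :=
    (integrable_norm_iff measurable_id.aestronglyMeasurable).1 (by simpa using hμ 1)
  have i2 : Integrable (fun w : ℝ => w ^ 2) μ := by simpa using hμ 2
  have key : ‖charFun μ u - ((1 - u ^ 2 / 2 : ℝ) : ℂ)‖ ≤ 4 * (∫ w, |w| ^ 3 ∂μ) * |u| ^ 3 := by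
    have e : charFun μ u - ((1 - u ^ 2 / 2 : ℝ) : ℂ) = ∫ w, (Complex.exp ((u * w : ℝ) * Complex.I)
        - (1 + (u * w : ℝ) * Complex.I - ((u * w : ℝ) : ℂ) ^ 2 / 2)) ∂μ := by
      have j1 : Integrable (fun w : ℝ => ((u * w : ℝ) : ℂ) * Complex.I) μ :=
        (i1.const_mul u).ofReal.mul_const _
      have j2 : Integrable (fun w : ℝ => ((u * w : ℝ) : ℂ) ^ 2 / 2) μ := by
        have := ((i2.const_mul (u ^ 2)).ofReal (𝕜 := ℂ)).div_const 2
        refine this.congr (ae_of_all _ fun w => ?_)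
        simp; ring
      have j0 : Integrable (fun w : ℝ => Complex.exp ((u * w : ℝ) * Complex.I)) μ := by
        refine (integrable_const (1 : ℝ)).mono' (by fun_prop) (ae_of_all _ fun w => ?_)
        rw [Complex.norm_exp_ofReal_mul_I]
      have jj : Integrable (fun w : ℝ => (1 : ℂ) + ((u * w : ℝ) : ℂ) * Complex.I) μ :=
        (integrable_const _).add j1
      have v1 : ∫ w, ((u * w : ℝ) : ℂ) * Complex.I ∂μ = 0 := by
        rw [integral_mul_const, integral_complex_ofReal, integral_const_mul, hm]; simp
      have v2 : ∫ w, ((u * w : ℝ) : ℂ) ^ 2 / 2 ∂μ = (u : ℂ) ^ 2 / 2 := by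
        have : ∀ w : ℝ, ((u * w : ℝ) : ℂ) ^ 2 / 2 = (u ^ 2 / 2 : ℂ) * ((w ^ 2 : ℝ) : ℂ) := by
          intro w; push_cast; ring
        simp_rw [this]
        rw [integral_const_mul, integral_complex_ofReal, hv]; simp
      rw [integral_sub j0 (show Integrable (fun w : ℝ => _ - _) μ from jj.sub j2),
        integral_sub jj j2, integral_add (integrable_const _) j1, v1, v2, charFun_apply_real]
      simp
    rw [e]
    refine (norm_integral_le_of_norm_le (((hμ 3).const_mul (4 * |u| ^ 3)))
      (ae_of_all _ fun w => ?_)).trans ?_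
    · refine (norm_exp_mul_I_sub_taylor_le (u * w)).trans ?_
      rw [abs_mul, mul_pow, mul_assoc]
    · rw [integral_const_mul]
      apply le_of_eq; ring
  calc _ ≤ ‖charFun μ u - ((1 - u ^ 2 / 2 : ℝ) : ℂ)‖
        + ‖((1 - u ^ 2 / 2 : ℝ) : ℂ) - Real.exp (-(u ^ 2 / 2))‖ :=
          norm_sub_le_norm_sub_add_norm_sub _ _ _
    _ ≤ 4 * (∫ w, |w| ^ 3 ∂μ) * |u| ^ 3 + |u| ^ 3 := by
        gcongr
        rw [← Complex.ofReal_sub, Complex.norm_real, Real.norm_eq_abs, abs_sub_comm]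
        exact abs_exp_neg_half_sq_sub_le u
    _ = _ := by ring

/-- The telescoping estimate for the difference of two products in the unit disc. -/
theorem norm_prod_sub_prod_le {κ : Type*} (s : Finset κ) (a b : κ → ℂ)
    (ha : ∀ k ∈ s, ‖a k‖ ≤ 1) (hb : ∀ k ∈ s, ‖b k‖ ≤ 1) :
    ‖∏ k ∈ s, a k - ∏ k ∈ s, b k‖ ≤ ∑ k ∈ s, ‖a k - b k‖ := by
  classical
  induction s using Finset.induction_on with
  | empty => simp
  | insert k s hk ih =>
    rw [Finset.prod_insert hk, Finset.prod_insert hk, Finset.sum_insert hk]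
    have hb' : ‖∏ k ∈ s, b k‖ ≤ 1 := by
      rw [norm_prod]
      exact Finset.prod_le_one (fun _ _ => norm_nonneg _)
        fun i hi => hb i (Finset.mem_insert_of_mem hi)
    have e : a k * ∏ k ∈ s, a k - b k * ∏ k ∈ s, b k
        = (a k - b k) * ∏ k ∈ s, b k + a k * (∏ k ∈ s, a k - ∏ k ∈ s, b k) := by ring
    rw [e]
    refine (norm_add_le _ _).trans ?_
    rw [norm_mul, norm_mul]
    gcongr
    · exact mul_le_of_le_one_right (norm_nonneg _) hb'
    · refine (mul_le_of_le_one_left (norm_nonneg _) (ha k (Finset.mem_insert_self _ _))).trans ?_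
      exact ih (fun i hi => ha i (Finset.mem_insert_of_mem hi))
        fun i hi => hb i (Finset.mem_insert_of_mem hi)

/-! ### Moments of weighted sums of independent centred variables -/

section Moments

variable {Ω : Type*} [MeasurableSpace Ω] {P : Measure Ω} [IsProbabilityMeasure P]

theorem integrable_pow_of_memLp {X : Ω → ℝ} (hX : ∀ q : ℕ, MemLp X q P) (q : ℕ) :
    Integrable (fun ω => X ω ^ q) P := by
  refine (integrable_norm_iff ?_).1 ?_
  · exact (hX 0).1.pow q
  · simpa [norm_pow] using (hX q).integrable_norm_pow'

theorem integrable_abs_pow_of_memLp {X : Ω → ℝ} (hX : ∀ q : ℕ, MemLp X q P) (q : ℕ) :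
    Integrable (fun ω => |X ω| ^ q) P := by
  simpa using (hX q).integrable_norm_pow'

/-- Lyapunov's inequality for the absolute moments of a random variable. -/
theorem integral_abs_pow_le_pow {X : Ω → ℝ} (hX : ∀ q : ℕ, MemLp X q P) {r : ℝ} (hr : 0 ≤ r)
    {m n : ℕ} (hmn : m ≤ n) (hn : n ≠ 0) (h : ∫ ω, |X ω| ^ n ∂P ≤ r ^ n) :
    ∫ ω, |X ω| ^ m ∂P ≤ r ^ m := by
  rcases Nat.eq_zero_or_pos m with rfl | hm
  · simp
  rcases hr.eq_or_lt with rfl | hr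
  · rw [zero_pow hn] at h
    have h0 : ∫ ω, |X ω| ^ n ∂P = 0 := le_antisymm h (integral_nonneg fun ω => by positivity)
    rw [integral_eq_zero_iff_of_nonneg (fun ω => by positivity)
      (integrable_abs_pow_of_memLp hX n)] at h0
    rw [zero_pow hm.ne']
    refine (integral_eq_zero_of_ae ?_).le
    filter_upwards [h0] with ω hω
    have : |X ω| = 0 := by simpa [hn] using hω
    simp [this, hm.ne']
  · -- integrate the weighted AM-GM inequality for `(|X| / r) ^ n` and `1`
    have hn' : (0 : ℝ) < n := by positivity
    set θ : ℝ := m / n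
    have hθ0 : 0 ≤ θ := by positivity
    have hθ1 : θ ≤ 1 := by
      rw [div_le_one hn']; exact_mod_cast hmn
    have key : ∀ t : ℝ, 0 ≤ t → t ^ m ≤ θ * t ^ n + (1 - θ) := by
      intro t ht
      have := Real.geom_mean_le_arith_mean2_weighted hθ0 (by linarith : 0 ≤ 1 - θ)
        (pow_nonneg ht n) zero_le_one (by ring)
      rw [Real.one_rpow, mul_one, mul_one, ← Real.rpow_natCast t n, ← Real.rpow_mul ht,
        mul_div_cancel₀ _ hn'.ne'] at this
      simpa using this
    have h1 : ∫ ω, |X ω| ^ m ∂P ≤ ∫ ω, r ^ m * (θ * (|X ω| ^ n / r ^ n) + (1 - θ)) ∂P := by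
      refine integral_mono (integrable_abs_pow_of_memLp hX m) ?_ fun ω => ?_
      · exact ((((integrable_abs_pow_of_memLp hX n).div_const _).const_mul _).add
          (integrable_const _)).const_mul _
      · have := key (|X ω| / r) (by positivity)
        rw [div_pow, div_pow, div_le_iff₀ (by positivity)] at this
        simpa [mul_comm] using this
    refine h1.trans ?_
    rw [integral_const_mul, integral_add (((integrable_abs_pow_of_memLp hX n).div_const _).const_mul _)
      (integrable_const _), integral_const_mul, integral_div, integral_const]
    refine mul_le_of_le_one_right (by positivity) ?_
    have : (∫ ω, |X ω| ^ n ∂P) / r ^ n ≤ 1 := (div_le_one (by positivity)).2 h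
    simp only [probReal_univ, smul_eq_mul, one_mul]
    nlinarith

/-- Adding one independent centred summand `c • V` to `S`. In the binomial expansion the linear
term vanishes, and all other terms which involve `V` contain a factor `c ^ 2`. Hence a bound for
the `L^(2p+2)` norm of `S` by `√D * a` turns into one with `a ^ 2 + c ^ 2` in place of `a ^ 2`, with
the same constant `D`. -/
theorem integral_add_pow_le {S V : Ω → ℝ} (hS : ∀ q : ℕ, MemLp S q P) (hV : ∀ q : ℕ, MemLp V q P)
    (hind : IndepFun S V P) (hV0 : ∫ ω, V ω ∂P = 0) (p : ℕ) {M : ℝ} (hM1 : 1 ≤ M)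
    (hM : ∀ q ≤ 2 * p + 2, ∫ ω, |V ω| ^ q ∂P ≤ M) {D : ℝ} (hD : 4 ^ (p + 1) * M ≤ D)
    {a : ℝ} (ha : 0 ≤ a) (hSa : ∫ ω, |S ω| ^ (2 * p + 2) ∂P ≤ (√D * a) ^ (2 * p + 2)) (c : ℝ) :
    ∫ ω, |S ω + c * V ω| ^ (2 * p + 2) ∂P ≤ D ^ (p + 1) * (a ^ 2 + c ^ 2) ^ (p + 1) := by
  have hD1 : 1 ≤ D := by
    have : (1 : ℝ) ≤ 4 ^ (p + 1) := one_le_pow₀ (by norm_num)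
    nlinarith
  have hs1 : 1 ≤ √D := Real.one_le_sqrt.2 hD1
  have hs2 : √D ^ 2 = D := Real.sq_sqrt (by linarith)
  set B := √(a ^ 2 + c ^ 2)
  have hB2 : B ^ 2 = a ^ 2 + c ^ 2 := Real.sq_sqrt (by positivity)
  have haB : a ≤ B := Real.le_sqrt_of_sq_le (by nlinarith)
  have hcB : |c| ≤ B := Real.le_sqrt_of_sq_le (by rw [sq_abs]; nlinarith)
  have hB0 : 0 ≤ B := Real.sqrt_nonneg _
  have hindp : ∀ i j : ℕ, IndepFun (fun ω => S ω ^ i) (fun ω => V ω ^ j) P := fun i j =>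
    hind.comp (measurable_id.pow_const i) (measurable_id.pow_const j)
  have hint : ∀ i j : ℕ, Integrable (fun ω => S ω ^ i * V ω ^ j) P := fun i j =>
    (hindp i j).integrable_mul (integrable_pow_of_memLp hS i) (integrable_pow_of_memLp hV j)
  have hval : ∀ i j : ℕ, ∫ ω, S ω ^ i * V ω ^ j ∂P = (∫ ω, S ω ^ i ∂P) * ∫ ω, V ω ^ j ∂P :=
    fun i j => (hindp i j).integral_fun_mul_eq_mul_integral
      (integrable_pow_of_memLp hS i).1 (integrable_pow_of_memLp hV j).1
  have hexp : ∫ ω, |S ω + c * V ω| ^ (2 * p + 2) ∂P = ∑ i ∈ Finset.range (2 * p + 2 + 1),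
      (c ^ (2 * p + 2 - i) * ((2 * p + 2).choose i : ℝ)) *
        ((∫ ω, S ω ^ i ∂P) * ∫ ω, V ω ^ (2 * p + 2 - i) ∂P) := by
    have e : ∀ ω, |S ω + c * V ω| ^ (2 * p + 2) = ∑ i ∈ Finset.range (2 * p + 2 + 1),
        (c ^ (2 * p + 2 - i) * ((2 * p + 2).choose i : ℝ)) *
          (S ω ^ i * V ω ^ (2 * p + 2 - i)) := by
      intro ω
      rw [Even.pow_abs ⟨p + 1, by ring⟩, add_pow]
      refine Finset.sum_congr rfl fun i _ => ?_
      rw [mul_pow]; ring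
    simp_rw [e]
    rw [integral_finsetSum _ fun i _ => (hint i _).const_mul _]
    refine Finset.sum_congr rfl fun i _ => ?_
    rw [integral_const_mul, hval]
  have hSabs : ∀ (X : Ω → ℝ) i, |∫ ω, X ω ^ i ∂P| ≤ ∫ ω, |X ω| ^ i ∂P := by
    intro X i
    refine (abs_integral_le_integral_abs).trans (le_of_eq ?_)
    simp_rw [abs_pow]
  have hterm : ∀ i ∈ Finset.range (2 * p + 1),
      (c ^ (2 * p + 2 - i) * ((2 * p + 2).choose i : ℝ)) *
        ((∫ ω, S ω ^ i ∂P) * ∫ ω, V ω ^ (2 * p + 2 - i) ∂P)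
      ≤ ((2 * p + 2).choose i : ℝ) * (M * (D ^ p * (c ^ 2 * (B ^ 2) ^ p))) := by
    intro i hi
    have hi' : i ≤ 2 * p := by simpa [Nat.lt_succ_iff] using hi
    obtain ⟨j, hj⟩ := Nat.exists_eq_add_of_le hi'
    have e1 : 2 * p + 2 - i = j + 2 := by omega
    rw [e1]
    have h1 : |∫ ω, S ω ^ i ∂P| ≤ √D ^ (2 * p) * B ^ i := by
      refine (hSabs S i).trans ((integral_abs_pow_le_pow hS (by positivity) (by omega)
        (by omega) hSa).trans ?_)
      rw [mul_pow]
      gcongr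
    have h2 : |∫ ω, V ω ^ (j + 2) ∂P| ≤ M := (hSabs V _).trans (hM _ (by omega))
    have h3 : |c ^ (j + 2)| ≤ c ^ 2 * B ^ j := by
      rw [abs_pow, pow_add, mul_comm, sq_abs]
      gcongr
    calc _ ≤ |(c ^ (j + 2) * ((2 * p + 2).choose i : ℝ)) *
        ((∫ ω, S ω ^ i ∂P) * ∫ ω, V ω ^ (j + 2) ∂P)| := le_abs_self _
      _ = |c ^ (j + 2)| * ((2 * p + 2).choose i : ℝ) *
          (|∫ ω, S ω ^ i ∂P| * |∫ ω, V ω ^ (j + 2) ∂P|) := by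
          rw [abs_mul, abs_mul, abs_mul, Nat.abs_cast]
      _ ≤ (c ^ 2 * B ^ j) * ((2 * p + 2).choose i : ℝ) * ((√D ^ (2 * p) * B ^ i) * M) := by
          gcongr
      _ = _ := by
          rw [pow_mul, hs2, ← pow_mul B, hj, pow_add]; ring
  -- split off the terms of degree `0` and `1` in `V`, the second of which is zero
  rw [hexp, Finset.sum_range_succ, Finset.sum_range_succ]
  have t1 : 2 * p + 2 - (2 * p + 1) = 1 := by omega
  rw [t1]
  simp only [pow_one, hV0, mul_zero, add_zero, Nat.sub_self, pow_zero, Nat.choose_self,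
    Nat.cast_one, mul_one, one_mul, integral_const, probReal_univ, smul_eq_mul]
  have hlast : ∫ ω, S ω ^ (2 * p + 2) ∂P ≤ D ^ (p + 1) * (a ^ 2) ^ (p + 1) := by
    refine (le_abs_self _).trans ((hSabs _ _).trans (hSa.trans (le_of_eq ?_)))
    rw [show 2 * p + 2 = 2 * (p + 1) by ring, pow_mul, mul_pow, hs2, mul_pow]
  have hsum : ∑ i ∈ Finset.range (2 * p + 1), ((2 * p + 2).choose i : ℝ) ≤ 4 ^ (p + 1) := by
    have h1 : ∑ i ∈ Finset.range (2 * p + 1), (2 * p + 2).choose i ≤ 2 ^ (2 * p + 2) := by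
      rw [← Nat.sum_range_choose]
      exact Finset.sum_le_sum_of_subset (Finset.range_subset_range.2 (by omega))
    have h2 : (4 : ℝ) ^ (p + 1) = ((2 ^ (2 * p + 2) : ℕ) : ℝ) := by
      push_cast
      rw [show 2 * p + 2 = 2 * (p + 1) by ring, pow_mul]; norm_num
    rw [h2]
    exact_mod_cast h1
  calc _ ≤ ∑ i ∈ Finset.range (2 * p + 1),
        ((2 * p + 2).choose i : ℝ) * (M * (D ^ p * (c ^ 2 * (B ^ 2) ^ p)))
        + D ^ (p + 1) * (a ^ 2) ^ (p + 1) := add_le_add (Finset.sum_le_sum hterm) hlast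
    _ ≤ 4 ^ (p + 1) * (M * (D ^ p * (c ^ 2 * (B ^ 2) ^ p)))
        + D ^ (p + 1) * (a ^ 2) ^ (p + 1) := by
        rw [← Finset.sum_mul]
        gcongr
    _ = (4 ^ (p + 1) * M) * (D ^ p * (c ^ 2 * (B ^ 2) ^ p))
        + D ^ (p + 1) * (a ^ 2) ^ (p + 1) := by ring
    _ ≤ D * (D ^ p * (c ^ 2 * (B ^ 2) ^ p)) + D ^ (p + 1) * (a ^ 2 * (B ^ 2) ^ p) := by
        rw [pow_succ (a ^ 2), mul_comm _ (a ^ 2)]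
        gcongr
    _ = _ := by rw [hB2]; ring

variable {κ : Type*}

/-- The **Marcinkiewicz–Zygmund inequality** for linear combinations of independent centred
variables with uniformly bounded moments. -/
theorem integral_abs_sum_mul_pow_le {V : κ → Ω → ℝ} (hVm : ∀ k, Measurable (V k))
    (hV : ∀ k, ∀ q : ℕ, MemLp (V k) q P) (hind : iIndepFun V P) (hV0 : ∀ k, ∫ ω, V k ω ∂P = 0)
    (p : ℕ) {M : ℝ} (hM1 : 1 ≤ M) (hM : ∀ k, ∀ q ≤ 2 * p + 2, ∫ ω, |V k ω| ^ q ∂P ≤ M)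
    (c : κ → ℝ) (s : Finset κ) :
    ∫ ω, |∑ k ∈ s, c k * V k ω| ^ (2 * p + 2) ∂P
      ≤ (4 ^ (p + 1) * M) ^ (p + 1) * (∑ k ∈ s, c k ^ 2) ^ (p + 1) := by
  classical
  induction s using Finset.induction_on with
  | empty => simp
  | insert k s hk ih =>
    have hD : (0 : ℝ) ≤ 4 ^ (p + 1) * M := by positivity
    have ha : 0 ≤ ∑ k ∈ s, c k ^ 2 := Finset.sum_nonneg fun _ _ => sq_nonneg _
    have hi : IndepFun (fun ω => ∑ k ∈ s, c k * V k ω) (V k) P := by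
      have h1 : iIndepFun (fun j ω => (if j = k then 1 else c j) * V j ω) P :=
        hind.comp (fun j x => (if j = k then 1 else c j) * x) fun j => measurable_const_mul _
      have h2 := h1.indepFun_finsetSum_of_notMem (fun j => (hVm j).const_mul _) hk
      convert! h2 using 1
      · ext ω
        rw [Finset.sum_apply]
        refine Finset.sum_congr rfl fun j hj => ?_
        rw [if_neg (by rintro rfl; exact hk hj)]
      · ext ω; simp
    have := integral_add_pow_le (S := fun ω => ∑ k ∈ s, c k * V k ω) (V := V k)
      (fun q => memLp_finsetSum _ fun j _ => (hV j q).const_mul _) (hV k) hi (hV0 k) p hM1 (hM k)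
      le_rfl (Real.sqrt_nonneg (∑ k ∈ s, c k ^ 2)) (ih.trans (le_of_eq (by
        rw [show 2 * p + 2 = 2 * (p + 1) by ring, pow_mul, mul_pow (√_) (√_), Real.sq_sqrt hD,
          Real.sq_sqrt ha, ← mul_pow]))) (c k)
    rw [Real.sq_sqrt ha] at this
    simp_rw [Finset.sum_insert hk]
    convert this using 3
    · ring_nf
    · ring

end Moments

/-! ### Random coefficients independent of the summands -/

section Lp

variable {Ω : Type*} [MeasurableSpace Ω] {P : Measure Ω}

theorem eLpNorm_natCast_pow {E : Type*} [NormedAddCommGroup E] (f : Ω → E) {q : ℕ} (hq : q ≠ 0) :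
    eLpNorm f q P ^ q = ∫⁻ ω, ‖f ω‖ₑ ^ q ∂P := by
  have := eLpNorm_nnreal_pow_eq_lintegral (μ := P) (f := f) (p := (q : ℝ≥0)) (by exact_mod_cast hq)
  simpa using this

theorem eLpNorm_fun_pow (f : Ω → ℝ) {m q : ℕ} (hm : m ≠ 0) (hq : q ≠ 0) :
    eLpNorm (fun ω => f ω ^ m) q P = eLpNorm f (m * q : ℕ) P ^ m := by
  refine (ENNReal.pow_right_strictMono hq).injective ?_
  rw [eLpNorm_natCast_pow _ hq, ← pow_mul, eLpNorm_natCast_pow _ (Nat.mul_ne_zero hm hq)]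
  simp_rw [enorm_pow, pow_mul]

end Lp

section RandomCoefficients

variable {Ω : Type*} [MeasurableSpace Ω] {P : Measure Ω} [IsProbabilityMeasure P]

/-- Fubini's theorem for a function of two independent variables. -/
theorem lintegral_comp_of_indepFun {β γ : Type*} [MeasurableSpace β] [MeasurableSpace γ]
    {X : Ω → β} {Y : Ω → γ} (hX : Measurable X) (hY : Measurable Y) (h : IndepFun X Y P)
    {F : β → γ → ENNReal} (hF : Measurable (Function.uncurry F)) :
    ∫⁻ ω, F (X ω) (Y ω) ∂P = ∫⁻ ω, ∫⁻ ω', F (X ω) (Y ω') ∂P ∂P := by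
  have h1 : ∫⁻ ω, F (X ω) (Y ω) ∂P
      = ∫⁻ z, Function.uncurry F z ∂(P.map fun ω => (X ω, Y ω)) := by
    rw [lintegral_map hF (hX.prodMk hY)]; rfl
  have := Measure.isProbabilityMeasure_map (μ := P) hX.aemeasurable
  have := Measure.isProbabilityMeasure_map (μ := P) hY.aemeasurable
  rw [h1, (indepFun_iff_map_prod_eq_prod_map_map hX.aemeasurable hY.aemeasurable).1 h,
    lintegral_prod _ hF.aemeasurable, lintegral_map hF.lintegral_prod_right' hX]
  refine lintegral_congr fun ω => ?_
  exact lintegral_map (hF.comp measurable_prodMk_left) hY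

theorem integral_comp_of_indepFun {β γ : Type*} [MeasurableSpace β] [MeasurableSpace γ]
    {X : Ω → β} {Y : Ω → γ} (hX : Measurable X) (hY : Measurable Y) (h : IndepFun X Y P)
    {F : β → γ → ℂ} (hF : Measurable (Function.uncurry F)) {C : ℝ} (hC : ∀ x y, ‖F x y‖ ≤ C) :
    ∫ ω, F (X ω) (Y ω) ∂P = ∫ ω, ∫ ω', F (X ω) (Y ω') ∂P ∂P := by
  have h1 : ∫ ω, F (X ω) (Y ω) ∂P
      = ∫ z, Function.uncurry F z ∂(P.map fun ω => (X ω, Y ω)) := by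
    rw [integral_map (hX.prodMk hY).aemeasurable hF.aestronglyMeasurable]; rfl
  have := Measure.isProbabilityMeasure_map (μ := P) hX.aemeasurable
  have := Measure.isProbabilityMeasure_map (μ := P) hY.aemeasurable
  rw [h1, (indepFun_iff_map_prod_eq_prod_map_map hX.aemeasurable hY.aemeasurable).1 h,
    integral_prod _ ((integrable_const C).mono' hF.aestronglyMeasurable
      (ae_of_all _ fun z => hC z.1 z.2)), integral_map hX.aemeasurable
      hF.stronglyMeasurable.integral_prod_right'.aestronglyMeasurable]
  refine integral_congr_ae (ae_of_all _ fun ω => ?_)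
  exact integral_map hY.aemeasurable (hF.comp measurable_prodMk_left).aestronglyMeasurable

variable {κ : Type*} [Fintype κ]

/-- The characteristic function of a sum of independent variables with random weights that are
independent of the summands. -/
theorem integral_exp_sum_mul_eq {V s : κ → Ω → ℝ} (hVm : ∀ k, Measurable (V k))
    (hsm : ∀ k, Measurable (s k)) (hV : iIndepFun V P)
    (hsV : IndepFun (fun ω k => s k ω) (fun ω k => V k ω) P) :
    ∫ ω, Complex.exp ((∑ k, s k ω * V k ω : ℝ) * Complex.I) ∂P
      = ∫ ω, ∏ k, charFun (P.map (V k)) (s k ω) ∂P := by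
  rw [integral_comp_of_indepFun (X := fun ω k => s k ω) (Y := fun ω k => V k ω)
    (F := fun x y => Complex.exp ((∑ k, x k * y k : ℝ) * Complex.I)) (C := 1)
    (measurable_pi_lambda _ hsm) (measurable_pi_lambda _ hVm) hsV (by
      unfold Function.uncurry; fun_prop) (fun x y => (Complex.norm_exp_ofReal_mul_I _).le)]
  refine integral_congr_ae (ae_of_all _ fun ω => ?_)
  have h1 : ∀ ω', Complex.exp ((∑ k, s k ω * V k ω' : ℝ) * Complex.I)
      = ∏ k, Complex.exp ((s k ω : ℂ) * V k ω' * Complex.I) := by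
    intro ω'
    rw [← Complex.exp_sum]
    push_cast
    rw [Finset.sum_mul]
  simp_rw [h1]
  rw [hV.integral_fun_prod_comp (f := fun k (v : ℝ) => Complex.exp ((s k ω : ℂ) * v * Complex.I))
    (fun k => (hVm k).aemeasurable) fun k => by fun_prop]
  refine Finset.prod_congr rfl fun k _ => ?_
  rw [charFun_apply_real, integral_map (hVm k).aemeasurable (by fun_prop)]

/-- The Marcinkiewicz–Zygmund inequality for random coefficients which are independent of the
summands. -/
theorem eLpNorm_sum_mul_sq_le {V s : κ → Ω → ℝ} (hVm : ∀ k, Measurable (V k))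
    (hV : ∀ k, ∀ q : ℕ, MemLp (V k) q P) (hind : iIndepFun V P) (hV0 : ∀ k, ∫ ω, V k ω ∂P = 0)
    (p : ℕ) {M : ℝ} (hM1 : 1 ≤ M) (hM : ∀ k, ∀ q ≤ 2 * p + 2, ∫ ω, |V k ω| ^ q ∂P ≤ M)
    (hsm : ∀ k, Measurable (s k)) (hsV : IndepFun (fun ω k => s k ω) (fun ω k => V k ω) P) :
    eLpNorm (fun ω => ∑ k, s k ω * V k ω) (2 * (p + 1) : ℕ) P ^ 2
      ≤ ENNReal.ofReal (4 ^ (p + 1) * M) * ∑ k, eLpNorm (s k) (2 * (p + 1) : ℕ) P ^ 2 := by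
  have hD : (0 : ℝ) ≤ 4 ^ (p + 1) * M := by positivity
  have h1 : eLpNorm (fun ω => ∑ k, s k ω * V k ω) (2 * (p + 1) : ℕ) P ^ (2 * (p + 1))
      ≤ (ENNReal.ofReal (4 ^ (p + 1) * M)
        * eLpNorm (fun ω => ∑ k, s k ω ^ 2) (p + 1 : ℕ) P) ^ (p + 1) := by
    rw [eLpNorm_natCast_pow _ (by omega), mul_pow, eLpNorm_natCast_pow _ (by omega),
      lintegral_comp_of_indepFun (X := fun ω k => s k ω) (Y := fun ω k => V k ω)
        (F := fun x y => ‖∑ k, x k * y k‖ₑ ^ (2 * (p + 1))) (measurable_pi_lambda _ hsm)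
        (measurable_pi_lambda _ hVm) hsV (by unfold Function.uncurry; fun_prop),
      ← lintegral_const_mul _ (by fun_prop)]
    refine lintegral_mono fun ω => ?_
    have hi : ∀ q : ℕ, MemLp (fun ω' => ∑ k, s k ω * V k ω') q P := fun q =>
      memLp_finsetSum _ fun k _ => (hV k q).const_mul _
    have h2 := integral_abs_sum_mul_pow_le hVm hV hind hV0 p hM1 hM (fun k => s k ω) Finset.univ
    have e1 : ∀ x : ℝ, ‖x‖ₑ ^ (2 * (p + 1)) = ENNReal.ofReal (|x| ^ (2 * p + 2)) := by
      intro x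
      rw [← ofReal_norm, ENNReal.ofReal_pow (abs_nonneg _)]; rfl
    simp_rw [e1]
    rw [← ofReal_integral_eq_lintegral_ofReal (integrable_abs_pow_of_memLp hi _)
      (ae_of_all _ fun ω => by positivity)]
    refine (ENNReal.ofReal_le_ofReal h2).trans (le_of_eq ?_)
    rw [ENNReal.ofReal_mul (by positivity), ENNReal.ofReal_pow hD,
      ENNReal.ofReal_pow (Finset.sum_nonneg fun _ _ => sq_nonneg _), ← ofReal_norm,
      Real.norm_of_nonneg (Finset.sum_nonneg fun _ _ => sq_nonneg _)]
  rw [pow_mul] at h1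
  refine ((ENNReal.pow_right_strictMono (by omega : p + 1 ≠ 0)).le_iff_le.1 h1).trans ?_
  gcongr
  have h3 := eLpNorm_sum_le (μ := P) (f := fun k ω => s k ω ^ 2) (s := Finset.univ)
    (p := (p + 1 : ℕ)) (fun k _ => ((hsm k).pow_const 2).aestronglyMeasurable)
    (by exact_mod_cast Nat.succ_le_succ (Nat.zero_le p))
  have h4 : (∑ k, fun ω => s k ω ^ 2) = fun ω => ∑ k, s k ω ^ 2 := by
    ext ω; simp
  rw [h4] at h3
  refine h3.trans (le_of_eq (Finset.sum_congr rfl fun k _ => ?_))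
  exact eLpNorm_fun_pow _ two_ne_zero (by omega)

end RandomCoefficients

/-! ### Convergence of integrals of unbounded functions -/

section UniformIntegrability

/-- Truncation of a real number to the interval `[-M, M]`. -/
def truncate (M : ℝ) (x : ℝ) : ℝ := max (-M) (min M x)

theorem continuous_truncate (M : ℝ) : Continuous (truncate M) := by
  unfold truncate; fun_prop

theorem abs_truncate_le {M : ℝ} (hM : 0 ≤ M) (x : ℝ) : |truncate M x| ≤ M := by
  rw [truncate, abs_le]
  exact ⟨le_max_left _ _, max_le (by linarith) (min_le_left _ _)⟩

theorem abs_truncate_le_abs {M : ℝ} (hM : 0 ≤ M) (x : ℝ) : |truncate M x| ≤ |x| := by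
  rw [truncate]
  rcases le_total x 0 with h | h
  · rw [min_eq_right (h.trans hM), abs_of_nonpos (max_le (by linarith) h), abs_of_nonpos h]
    exact neg_le_neg (le_max_right _ _)
  · rw [max_eq_right (by have := le_min hM h; linarith), abs_of_nonneg (le_min hM h),
      abs_of_nonneg h]
    exact min_le_right _ _

theorem abs_sub_truncate_le {M : ℝ} (hM : 0 < M) (x : ℝ) : |x - truncate M x| ≤ x ^ 2 / M := by
  rcases le_total |x| M with h | h
  · rw [truncate, min_eq_right ((le_abs_self x).trans h), max_eq_right (by
      linarith [neg_abs_le x]), sub_self, abs_zero]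
    positivity
  · have h1 : |x - truncate M x| ≤ |x| := by
      rw [truncate]
      rcases le_total x 0 with hx | hx
      · rw [min_eq_right (hx.trans hM.le), max_eq_left (by rw [abs_of_nonpos hx] at h; linarith),
          abs_of_nonpos (by rw [abs_of_nonpos hx] at h; linarith), abs_of_nonpos hx]
        linarith
      · rw [min_eq_left (by rw [abs_of_nonneg hx] at h; linarith), max_eq_right (by linarith),
          abs_of_nonneg (by rw [abs_of_nonneg hx] at h; linarith), abs_of_nonneg hx]
        linarith
    refine h1.trans ?_
    rw [le_div_iff₀ hM, ← sq_abs, sq]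
    gcongr

/-- The error of truncation, in terms of a bound for the second moment. -/
theorem integral_sub_truncate_le {E : Type*} [MeasurableSpace E] {μ : Measure E}
    [IsProbabilityMeasure μ] {g : E → ℝ}
    (hg : MemLp g 2 μ) {C : ℝ} (hC : ∫ x, g x ^ 2 ∂μ ≤ C) {M : ℝ} (hM : 0 < M) :
    |∫ x, g x ∂μ - ∫ x, truncate M (g x) ∂μ| ≤ C / M := by
  have hg1 : Integrable g μ := hg.integrable (by norm_num)
  have ht : Integrable (fun x => truncate M (g x)) μ :=
    hg1.norm.mono' ((continuous_truncate M).comp_aestronglyMeasurable hg.1)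
      (ae_of_all _ fun x => abs_truncate_le_abs hM.le (g x))
  rw [← integral_sub hg1 ht]
  refine abs_integral_le_integral_abs.trans ?_
  calc _ ≤ ∫ x, g x ^ 2 / M ∂μ := integral_mono (hg1.sub ht).abs (hg.integrable_sq.div_const M)
        fun x => abs_sub_truncate_le hM (g x)
    _ = (∫ x, g x ^ 2 ∂μ) / M := integral_div _ _
    _ ≤ C / M := by gcongr

/-- If probability measures converge weakly, the integrals of a continuous function whose second
moments are bounded converge as well. -/
theorem tendsto_integral_of_bounded_sq {E : Type*} [TopologicalSpace E] [MeasurableSpace E]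
    [OpensMeasurableSpace E] {ι : Type*} {l : Filter ι}
    {ν : ι → ProbabilityMeasure E} {ν₀ : ProbabilityMeasure E} (h : Tendsto ν l (𝓝 ν₀))
    {g : E → ℝ} (hg : Continuous g) {C : ℝ} (hi : ∀ i, MemLp g 2 (ν i : Measure E))
    (hC : ∀ i, ∫ x, g x ^ 2 ∂(ν i : Measure E) ≤ C) (hi₀ : MemLp g 2 (ν₀ : Measure E)) :
    Tendsto (fun i => ∫ x, g x ∂(ν i : Measure E)) l (𝓝 (∫ x, g x ∂(ν₀ : Measure E))) := by
  rw [Metric.tendsto_nhds]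
  intro ε hε
  set C' := max (max C (∫ x, g x ^ 2 ∂(ν₀ : Measure E))) 1
  have hC'1 : 0 < C' := lt_of_lt_of_le one_pos (le_max_right _ _)
  -- at this level of truncation, either truncation costs at most `ε / 4`
  set M := 4 * C' / ε
  have hM : 0 < M := by positivity
  have hCM : C' / M = ε / 4 := by
    simp only [M]; field_simp
  let G : BoundedContinuousFunction E ℝ := BoundedContinuousFunction.ofNormedAddCommGroup
    (fun x => truncate M (g x)) ((continuous_truncate M).comp hg) M
    (fun _ => abs_truncate_le hM.le _)
  have hG := ProbabilityMeasure.tendsto_iff_forall_integral_tendsto.1 h G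
  filter_upwards [Metric.tendsto_nhds.1 hG (ε / 4) (by positivity)] with i hiε
  have h1 := integral_sub_truncate_le (hi i) ((hC i).trans ((le_max_left _ _).trans
    (le_max_left _ _)) : _ ≤ C') hM
  have h2 := integral_sub_truncate_le hi₀ ((le_max_right C _).trans (le_max_left _ _) : _ ≤ C') hM
  rw [hCM] at h1 h2
  rw [Real.dist_eq] at hiε ⊢
  change |∫ x, truncate M (g x) ∂(ν i : Measure E) - ∫ x, truncate M (g x) ∂(ν₀ : Measure E)|
    < ε / 4 at hiε
  rw [abs_le] at h1 h2
  rw [abs_lt] at hiε ⊢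
  constructor <;> linarith [h1.1, h1.2, h2.1, h2.2, hiε.1, hiε.2]

end UniformIntegrability

/-! ### Lévy's continuity theorem along a filter -/

/-- Lévy's continuity theorem along a countably generated filter. -/
theorem tendsto_probabilityMeasure_of_charFun {ι : Type*} {l : Filter ι} [l.IsCountablyGenerated]
    {E : Type*} [NormedAddCommGroup E] [InnerProductSpace ℝ E] [FiniteDimensional ℝ E]
    [MeasurableSpace E] [BorelSpace E] {ν : ι → ProbabilityMeasure E} {ν₀ : ProbabilityMeasure E}
    (h : ∀ t, Tendsto (fun i => charFun (ν i : Measure E) t) l (𝓝 (charFun (ν₀ : Measure E) t))) :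
    Tendsto ν l (𝓝 ν₀) :=
  tendsto_of_seq_tendsto fun _ hx =>
    ProbabilityMeasure.tendsto_of_tendsto_charFun fun t => (h t).comp hx

/-! ### Dyadic chaining -/

section Chaining

variable {d : ℕ}

/-- The point with index `m` of the dyadic grid of mesh `2 ^ (-k)`. -/
noncomputable def gridPoint (k : ℕ) (m : Fin d → ℤ) : EuclideanSpace ℝ (Fin d) :=
  WithLp.toLp 2 fun i => (m i : ℝ) / 2 ^ k

/-- The indices of the points of the dyadic grid of mesh `2 ^ (-k)` in the cube `[-R, R] ^ d`. -/
noncomputable def gridBox (d R k : ℕ) : Finset (Fin d → ℤ) :=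
  Fintype.piFinset fun _ => Finset.Icc (-(R * 2 ^ k : ℤ)) (R * 2 ^ k)

/-- The pairs of indices of equal or neighbouring points of the dyadic grid of mesh `2 ^ (-k)` in
the cube `[-R, R] ^ d`. -/
noncomputable def gridPairs (d R k : ℕ) : Finset ((Fin d → ℤ) × (Fin d → ℤ)) :=
  (gridBox d R k ×ˢ gridBox d R k).filter fun m => ∀ i, |m.1 i - m.2 i| ≤ 1

/-- The index of the grid point below and to the left of `x`. -/
noncomputable def gridFloor (k : ℕ) (x : EuclideanSpace ℝ (Fin d)) : Fin d → ℤ :=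
  fun i => ⌊2 ^ k * x i⌋

theorem card_gridPairs_le (d R k : ℕ) :
    ((gridPairs d R k).card : ℝ) ≤ ((2 * R + 1) * 2 ^ k) ^ (2 * d) := by
  have h1 : (gridBox d R k).card = (2 * (R * 2 ^ k) + 1) ^ d := by
    rw [gridBox, Fintype.card_piFinset]
    simp only [Int.card_Icc, Finset.prod_const, Finset.card_univ, Fintype.card_fin]
    congr 1
    have : ((R * 2 ^ k : ℕ) : ℤ) = (R : ℤ) * 2 ^ k := by push_cast; ring
    rw [← this]
    omega
  have h2 : (gridPairs d R k).card ≤ ((2 * (R * 2 ^ k) + 1) ^ d) * ((2 * (R * 2 ^ k) + 1) ^ d) := by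
    rw [← h1, ← Finset.card_product]
    exact Finset.card_filter_le _ _
  have h3 : ((gridPairs d R k).card : ℝ) ≤ (2 * (R * 2 ^ k) + 1) ^ (2 * d) := by
    rw [two_mul d, pow_add]
    exact_mod_cast h2
  refine h3.trans (pow_le_pow_left₀ (by positivity) ?_ _)
  have : (1 : ℝ) ≤ 2 ^ k := one_le_pow₀ one_le_two
  nlinarith

theorem norm_gridPoint_sub_le {k R : ℕ} {m : (Fin d → ℤ) × (Fin d → ℤ)}
    (hm : m ∈ gridPairs d R k) :
    ‖gridPoint k m.1 - gridPoint k m.2‖ ≤ √d * (1 / 2) ^ k := by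
  have h := (Finset.mem_filter.1 hm).2
  rw [EuclideanSpace.norm_eq]
  have h1 : ∀ i, ‖(gridPoint k m.1 - gridPoint k m.2) i‖ ^ 2 ≤ ((1 / 2) ^ k) ^ 2 := by
    intro i
    have h2 : (gridPoint k m.1 - gridPoint k m.2) i = ((m.1 i - m.2 i : ℤ) : ℝ) * (1 / 2) ^ k := by
      simp [gridPoint]; ring
    rw [h2, norm_mul, mul_pow]
    have h3 : ‖((m.1 i - m.2 i : ℤ) : ℝ)‖ ≤ 1 := by
      rw [Real.norm_eq_abs, ← Int.cast_abs]; exact_mod_cast h i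
    have h4 : ‖((1 / 2 : ℝ)) ^ k‖ = (1 / 2) ^ k := Real.norm_of_nonneg (by positivity)
    rw [h4]
    exact mul_le_of_le_one_left (by positivity) (pow_le_one₀ (norm_nonneg _) h3)
  calc √(∑ i, ‖(gridPoint k m.1 - gridPoint k m.2) i‖ ^ 2) ≤ √(∑ i : Fin d, ((1 / 2) ^ k) ^ 2) :=
        Real.sqrt_le_sqrt (Finset.sum_le_sum fun i _ => h1 i)
    _ = _ := by
        rw [Finset.sum_const, Finset.card_univ, Fintype.card_fin, nsmul_eq_mul,
          Real.sqrt_mul (by positivity), Real.sqrt_sq (by positivity)]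

theorem abs_gridPoint_le {k R : ℕ} {m : Fin d → ℤ} (hm : m ∈ gridBox d R k) (i : Fin d) :
    |gridPoint k m i| ≤ R := by
  have h := Finset.mem_Icc.1 (Fintype.mem_piFinset.1 hm i)
  have h2 : (0 : ℝ) < 2 ^ k := by positivity
  simp only [gridPoint]
  rw [abs_div, abs_of_pos h2, div_le_iff₀ h2, abs_le]
  constructor
  · exact_mod_cast h.1
  · exact_mod_cast h.2

theorem gridFloor_mem_gridBox {R : ℕ} {x : EuclideanSpace ℝ (Fin d)} (hx : ∀ i, |x i| ≤ R) (k : ℕ) :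
    gridFloor k x ∈ gridBox d R k := by
  refine Fintype.mem_piFinset.2 fun i => Finset.mem_Icc.2 ?_
  have h2 : (0 : ℝ) < 2 ^ k := by positivity
  have h := abs_le.1 (hx i)
  constructor
  · refine Int.le_floor.2 ?_
    push_cast
    nlinarith [h.1]
  · have h3 := Int.floor_le (2 ^ k * x i)
    have h4 : 2 ^ k * x i ≤ ((R * 2 ^ k : ℤ) : ℝ) := by push_cast; nlinarith [h.2]
    exact Int.cast_le.1 (h3.trans h4)

theorem gridPoint_succ_two_mul (k : ℕ) (m : Fin d → ℤ) :
    gridPoint (k + 1) (fun i => 2 * m i) = gridPoint k m := by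
  ext i
  simp only [gridPoint]
  push_cast
  rw [pow_succ]
  field_simp

theorem tendsto_gridPoint_gridFloor (x : EuclideanSpace ℝ (Fin d)) :
    Tendsto (fun k => gridPoint k (gridFloor k x)) atTop (𝓝 x) := by
  have h : Tendsto (fun k i => ((⌊2 ^ k * x i⌋ : ℤ) : ℝ) / 2 ^ k) atTop (𝓝 fun i => x i) := by
    refine tendsto_pi_nhds.2 fun i => ?_
    have h0 : Tendsto (fun k : ℕ => (1 / 2 : ℝ) ^ k) atTop (𝓝 0) :=
      tendsto_pow_atTop_nhds_zero_of_lt_one (by norm_num) (by norm_num)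
    have hl : Tendsto (fun k : ℕ => x i - (1 / 2 : ℝ) ^ k) atTop (𝓝 (x i)) := by
      simpa using tendsto_const_nhds.sub h0
    refine tendsto_of_tendsto_of_tendsto_of_le_of_le hl tendsto_const_nhds (fun k => ?_)
      fun k => ?_
    · have h2 : (0 : ℝ) < 2 ^ k := by positivity
      simp only
      rw [le_div_iff₀ h2, sub_mul, ← mul_pow]
      norm_num
      linarith [Int.sub_one_lt_floor (2 ^ k * x i)]
    · have h2 : (0 : ℝ) < 2 ^ k := by positivity
      simp only
      rw [div_le_iff₀ h2, mul_comm]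
      exact Int.floor_le _
  exact (PiLp.continuous_toLp 2 _).continuousAt.tendsto.comp h

/-- If the increments of a continuous function between neighbouring grid points decay
geometrically in the level of the grid, this controls its modulus of continuity: `x` and `y` are
joined by a chain of grid points of increasing level on either side, and one step at level `k`. -/
theorem norm_sub_le_of_gridPairs {F : Type*} [NormedAddCommGroup F]
    {f : EuclideanSpace ℝ (Fin d) → F} (hf : Continuous f) {R : ℕ} {M r : ℝ} (hM : 0 ≤ M)
    (hr0 : 0 ≤ r) (hr1 : r < 1)
    (h : ∀ k, ∀ m ∈ gridPairs d R k, ‖f (gridPoint k m.1) - f (gridPoint k m.2)‖ ≤ M * r ^ k)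
    (k : ℕ) {x y : EuclideanSpace ℝ (Fin d)} (hx : ∀ i, |x i| ≤ R) (hy : ∀ i, |y i| ≤ R)
    (hxy : ∀ i, |x i - y i| ≤ (1 / 2) ^ k) :
    ‖f x - f y‖ ≤ 3 * M / (1 - r) * r ^ k := by
  have hchain : ∀ x : EuclideanSpace ℝ (Fin d), (∀ i, |x i| ≤ R) →
      dist (f (gridPoint k (gridFloor k x))) (f x) ≤ M * r ^ k / (1 - r) := by
    intro x hx
    refine dist_le_of_le_geometric_of_tendsto (f := fun k => f (gridPoint k (gridFloor k x)))
      r M hr1 (fun j => ?_) ((hf.tendsto x).comp (tendsto_gridPoint_gridFloor x)) k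
    -- `gridPoint j m = gridPoint (j + 1) (2 * m)`, so that both points are seen at level `j + 1`
    have hmem : ((fun i => 2 * gridFloor j x i), gridFloor (j + 1) x) ∈ gridPairs d R (j + 1) := by
      refine Finset.mem_filter.2 ⟨Finset.mem_product.2 ⟨?_, gridFloor_mem_gridBox hx _⟩, fun i => ?_⟩
      · refine Fintype.mem_piFinset.2 fun i => ?_
        have := Finset.mem_Icc.1 (Fintype.mem_piFinset.1 (gridFloor_mem_gridBox hx j) i)
        rw [Finset.mem_Icc, pow_succ]
        constructor <;> linarith [this.1, this.2]
      · have e : (2 : ℝ) ^ (j + 1) * x i = 2 * (2 ^ j * x i) := by rw [pow_succ]; ring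
        simp only [gridFloor, e]
        set t := (2 : ℝ) ^ j * x i
        have h1 : 2 * ⌊t⌋ ≤ ⌊2 * t⌋ := Int.le_floor.2 (by push_cast; linarith [Int.floor_le t])
        have h2 : ⌊2 * t⌋ < 2 * ⌊t⌋ + 2 :=
          Int.floor_lt.2 (by push_cast; linarith [Int.lt_floor_add_one t])
        rw [abs_le]
        constructor <;> linarith
    have := h (j + 1) _ hmem
    rw [gridPoint_succ_two_mul, ← dist_eq_norm] at this
    exact this.trans (mul_le_mul_of_nonneg_left
      (pow_le_pow_of_le_one hr0 hr1.le (Nat.le_succ j)) hM)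
  have hmem : (gridFloor k x, gridFloor k y) ∈ gridPairs d R k := by
    refine Finset.mem_filter.2 ⟨Finset.mem_product.2 ⟨gridFloor_mem_gridBox hx _,
      gridFloor_mem_gridBox hy _⟩, fun i => ?_⟩
    have h2 : (0 : ℝ) < 2 ^ k := by positivity
    have h3 : |2 ^ k * x i - 2 ^ k * y i| ≤ 1 := by
      rw [← mul_sub, abs_mul, abs_of_pos h2]
      calc 2 ^ k * |x i - y i| ≤ 2 ^ k * (1 / 2) ^ k := by gcongr; exact hxy i
        _ = 1 := by rw [← mul_pow]; norm_num
    rw [abs_le] at h3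
    simp only [gridFloor]
    have a1 := Int.floor_le (2 ^ k * x i)
    have a2 := Int.lt_floor_add_one (2 ^ k * x i)
    have b1 := Int.floor_le (2 ^ k * y i)
    have b2 := Int.lt_floor_add_one (2 ^ k * y i)
    have c1 : ((⌊2 ^ k * x i⌋ - ⌊2 ^ k * y i⌋ : ℤ) : ℝ) < (2 : ℤ) := by
      push_cast; linarith [h3.2]
    have c2 : ((-2 : ℤ) : ℝ) < ((⌊2 ^ k * x i⌋ - ⌊2 ^ k * y i⌋ : ℤ) : ℝ) := by
      push_cast; linarith [h3.1]
    rw [Int.cast_lt] at c1 c2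
    rw [abs_le]
    constructor <;> omega
  have h1 := hchain x hx
  have h2 := hchain y hy
  have h3 := h k _ hmem
  rw [← dist_eq_norm] at h3 ⊢
  have h4 : M * r ^ k ≤ M * r ^ k / (1 - r) := by
    rw [le_div_iff₀ (by linarith)]
    exact mul_le_of_le_one_right (by positivity) (by linarith)
  calc dist (f x) (f y) ≤ dist (f x) (f (gridPoint k (gridFloor k x)))
        + dist (f (gridPoint k (gridFloor k x))) (f (gridPoint k (gridFloor k y)))
        + dist (f (gridPoint k (gridFloor k y))) (f y) := dist_triangle4 _ _ _ _
    _ ≤ M * r ^ k / (1 - r) + M * r ^ k / (1 - r) + M * r ^ k / (1 - r) := by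
        rw [dist_comm (f x)]
        gcongr
        exact h3.trans h4
    _ = _ := by ring

end Chaining

/-! ### Tightness of random continuous functions -/

section Tightness

/-- Markov's inequality for the `q`-th moment of the norm. -/
theorem measure_lt_norm_le {Ω F : Type*} [MeasurableSpace Ω] [NormedAddCommGroup F]
    {P : Measure Ω} {Z : Ω → F} (hZ : AEStronglyMeasurable Z P) {q : ℕ} {A b : ℝ} (hb : 0 < b)
    (hA : ∫⁻ ω, ‖Z ω‖ₑ ^ q ∂P ≤ ENNReal.ofReal A) :
    P {ω | b < ‖Z ω‖} ≤ ENNReal.ofReal (A / b ^ q) := by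
  have h1 := meas_ge_le_lintegral_div (μ := P) (f := fun ω => ‖Z ω‖ₑ ^ q) (by fun_prop)
    (ε := ENNReal.ofReal (b ^ q)) (by simpa using pow_pos hb q) ENNReal.ofReal_ne_top
  rw [ENNReal.ofReal_div_of_pos (by positivity)]
  refine (measure_mono fun ω hω => ?_).trans (h1.trans (by gcongr))
  have hω' : b < ‖Z ω‖ := hω
  simp only [Set.mem_ofPred_eq]
  rw [← ofReal_norm, ← ENNReal.ofReal_pow (norm_nonneg _)]
  exact ENNReal.ofReal_le_ofReal (pow_le_pow_left₀ hb.le hω'.le q)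

/-- Kolmogorov's estimate: moment bounds for the increments of a random field control, uniformly
over a family of fields, all increments between neighbouring grid points at once. Moments of order
`4 * d + 2` suffice: the union bound runs over at most a multiple of `2 ^ (2 * d * k)` pairs at level
`k`, since all pairs of grid points, rather than only the neighbouring ones, are counted. -/
theorem exists_measure_gridPairs_le {d : ℕ} (R : ℕ) (A : ℝ) (hA : 0 ≤ A) {ε : ℝ} (hε : 0 < ε) :
    ∃ M : ℝ, 0 < M ∧ ∀ {Ω F : Type*} [MeasurableSpace Ω] [NormedAddCommGroup F] {P : Measure Ω}
      {X : Ω → EuclideanSpace ℝ (Fin d) → F} (_ : ∀ x, AEStronglyMeasurable (fun ω => X ω x) P)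
      (_ : ∀ x y, (∀ i, |x i| ≤ (R : ℝ)) → (∀ i, |y i| ≤ (R : ℝ)) →
        ∫⁻ ω, ‖X ω x - X ω y‖ₑ ^ (4 * d + 2) ∂P ≤ ENNReal.ofReal (A * ‖x - y‖ ^ (4 * d + 2))),
      P {ω | ∃ k, ∃ m ∈ gridPairs d R k,
        M * (3 / 4) ^ k < ‖X ω (gridPoint k m.1) - X ω (gridPoint k m.2)‖} ≤ ENNReal.ofReal ε := by
  set q := 4 * d + 2 with hq
  set A' : ℝ := (2 * R + 1) ^ (2 * d) * (A * √d ^ q)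
  have hA' : 0 ≤ A' := by positivity
  set M : ℝ := max 1 (2 * A' / ε)
  have hM1 : 1 ≤ M := le_max_left _ _
  have hM0 : 0 < M := by linarith
  have hMA : A' / M ^ q ≤ ε / 2 := by
    have h1 : 2 * A' / ε ≤ M ^ q := (le_max_right _ _).trans (le_self_pow₀ hM1 (by omega))
    rw [div_le_iff₀ hε] at h1
    rw [div_le_iff₀ (by positivity)]
    linarith
  refine ⟨M, hM0, fun {Ω F} _ _ {P X} hX h => ?_⟩
  have hk : ∀ k, P {ω | ∃ m ∈ gridPairs d R k,
      M * (3 / 4) ^ k < ‖X ω (gridPoint k m.1) - X ω (gridPoint k m.2)‖}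
      ≤ ENNReal.ofReal (ε / 2 * (1 / 2) ^ k) := by
    intro k
    have e : {ω | ∃ m ∈ gridPairs d R k,
        M * (3 / 4) ^ k < ‖X ω (gridPoint k m.1) - X ω (gridPoint k m.2)‖}
        = ⋃ m ∈ gridPairs d R k,
          {ω | M * (3 / 4) ^ k < ‖X ω (gridPoint k m.1) - X ω (gridPoint k m.2)‖} := by
      ext ω; simp
    set B : ℝ := A * (√d * (1 / 2) ^ k) ^ q / (M * (3 / 4) ^ k) ^ q
    have hB : 0 ≤ B := by positivity
    have h1 : ∀ m ∈ gridPairs d R k,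
        P {ω | M * (3 / 4) ^ k < ‖X ω (gridPoint k m.1) - X ω (gridPoint k m.2)‖}
        ≤ ENNReal.ofReal B := by
      intro m hm
      have hm' := Finset.mem_product.1 (Finset.mem_filter.1 hm).1
      refine measure_lt_norm_le ((hX _).sub (hX _)) (by positivity)
        ((h _ _ (abs_gridPoint_le hm'.1) (abs_gridPoint_le hm'.2)).trans ?_)
      refine ENNReal.ofReal_le_ofReal ?_
      gcongr
      exact norm_gridPoint_sub_le hm
    rw [e]
    refine (measure_biUnion_finset_le _ _).trans ((Finset.sum_le_sum h1).trans ?_)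
    rw [Finset.sum_const, nsmul_eq_mul, ← ENNReal.ofReal_natCast,
      ← ENNReal.ofReal_mul (Nat.cast_nonneg _)]
    refine ENNReal.ofReal_le_ofReal ?_
    -- the choice of the exponent makes the number of pairs irrelevant: `2 ^ (2d) (2/3) ^ q ≤ 1/2`
    have hnum : (2 : ℝ) ^ (2 * d) * (2 / 3) ^ q ≤ 1 / 2 := by
      rw [hq, pow_add, pow_mul, pow_mul, ← mul_assoc, ← mul_pow]
      calc ((2 : ℝ) ^ 2 * (2 / 3) ^ 4) ^ d * (2 / 3) ^ 2 ≤ 1 * (2 / 3) ^ 2 := by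
            gcongr
            exact pow_le_one₀ (by norm_num) (by norm_num)
        _ ≤ 1 / 2 := by norm_num
    have hB' : B = A * √d ^ q / M ^ q * ((2 / 3) ^ q) ^ k := by
      have h34 : ((3 / 4 : ℝ) ^ k) ^ q ≠ 0 := by positivity
      simp only [B]
      rw [show (1 / 2 : ℝ) = 2 / 3 * (3 / 4) by norm_num, mul_pow (2 / 3 : ℝ), mul_pow, mul_pow,
        mul_pow, ← pow_mul (2 / 3 : ℝ) q k, mul_comm q k, pow_mul (2 / 3 : ℝ) k q]
      field_simp
    calc ((gridPairs d R k).card : ℝ) * B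
        ≤ ((2 * R + 1) * 2 ^ k) ^ (2 * d) * B := by gcongr; exact card_gridPairs_le d R k
      _ = A' / M ^ q * (2 ^ (2 * d) * (2 / 3) ^ q) ^ k := by
          rw [hB']
          simp only [A']
          rw [mul_pow, mul_pow, ← pow_mul, ← pow_mul, mul_comm k]
          ring
      _ ≤ ε / 2 * (1 / 2) ^ k := by gcongr
  have e : {ω | ∃ k, ∃ m ∈ gridPairs d R k,
      M * (3 / 4) ^ k < ‖X ω (gridPoint k m.1) - X ω (gridPoint k m.2)‖}
      = ⋃ k, {ω | ∃ m ∈ gridPairs d R k,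
        M * (3 / 4) ^ k < ‖X ω (gridPoint k m.1) - X ω (gridPoint k m.2)‖} := by
    ext ω; simp
  rw [e]
  refine (measure_iUnion_le _).trans ((ENNReal.tsum_le_tsum hk).trans ?_)
  have hs : HasSum (fun k : ℕ => ε / 2 * (1 / 2 : ℝ) ^ k) ε := by
    have := (hasSum_geometric_of_lt_one (by norm_num : (0 : ℝ) ≤ 1 / 2) (by norm_num)).mul_left
      (ε / 2)
    rwa [show ε / 2 * (1 - 1 / 2)⁻¹ = ε by norm_num] at this
  rw [← ENNReal.ofReal_tsum_of_nonneg (fun k => by positivity) hs.summable, hs.tsum_eq]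

/-- A set of continuous functions which is uniformly bounded and has a uniform modulus of
continuity along the dyadic scales. -/
def modulusSet {d : ℕ} (T : Set (EuclideanSpace ℝ (Fin d))) (F : Type*) [NormedAddCommGroup F]
    (M r : ℝ) : Set C(T, F) :=
  {f | (∀ x, ‖f x‖ ≤ M) ∧ ∀ (k : ℕ) (x y : T), (∀ i, |x.1 i - y.1 i| ≤ (1 / 2) ^ k) →
    ‖f x - f y‖ ≤ M * r ^ k}

/-- The Arzelà–Ascoli theorem for the sets `modulusSet`. -/
theorem isCompact_modulusSet {d : ℕ} (T : Set (EuclideanSpace ℝ (Fin d))) (F : Type*)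
    [NormedAddCommGroup F] [ProperSpace F] (M : ℝ) {r : ℝ} (hr0 : 0 ≤ r)
    (hr1 : r < 1) : IsCompact (modulusSet T F M r) := by
  set S : Set (T → F) := {f | (∀ x, ‖f x‖ ≤ M) ∧ ∀ (k : ℕ) (x y : T),
    (∀ i, |x.1 i - y.1 i| ≤ (1 / 2) ^ k) → ‖f x - f y‖ ≤ M * r ^ k}
  have hequi : S.Equicontinuous := by
    intro x
    rw [Metric.equicontinuousAt_iff]
    intro ε hε
    have ht : Tendsto (fun k : ℕ => M * r ^ k) atTop (𝓝 0) := by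
      simpa using (tendsto_pow_atTop_nhds_zero_of_lt_one hr0 hr1).const_mul M
    obtain ⟨k, hk⟩ := (ht.eventually (gt_mem_nhds hε)).exists
    refine ⟨(1 / 2) ^ k, by positivity, fun y hy f => ?_⟩
    have h1 := f.2.2 k x y fun i => ?_
    · rw [dist_eq_norm]
      exact h1.trans_lt hk
    · rw [dist_comm] at hy
      have := PiLp.norm_apply_le (x.1 - y.1) i
      rw [← dist_eq_norm] at this
      exact this.trans hy.le
  have hS : IsCompact S := by
    have hb : IsCompact (Set.univ.pi fun _ : T => Metric.closedBall (0 : F) M) :=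
      isCompact_univ_pi fun _ => isCompact_closedBall _ _
    refine hb.of_isClosed_subset ?_ fun f hf x _ => by simpa using hf.1 x
    have e : S = (⋂ x, {f | ‖f x‖ ≤ M}) ∩ ⋂ (k : ℕ) (x : T) (y : T)
        (_ : ∀ i, |x.1 i - y.1 i| ≤ (1 / 2) ^ k), {f | ‖f x - f y‖ ≤ M * r ^ k} := by
      ext f
      simp [S]
    rw [e]
    exact (isClosed_iInter fun x => isClosed_le (by fun_prop) continuous_const).inter
      (isClosed_iInter fun k => isClosed_iInter fun x => isClosed_iInter fun y =>
        isClosed_iInter fun _ => isClosed_le (by fun_prop) continuous_const)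
  refine ArzelaAscoli.isCompact_of_equicontinuous _ ?_ ?_
  · convert hS
    ext f
    constructor
    · rintro ⟨g, hg, rfl⟩
      exact hg
    · intro hf
      exact ⟨⟨f, hequi.continuous ⟨f, hf⟩⟩, hf, rfl⟩
  · exact hequi.comp fun f : modulusSet T F M r => ⟨f.1, f.2⟩

/-- **Kolmogorov's tightness criterion** on a compact subset `T` of `ℝ ^ d`, for random fields which
are defined on all of `ℝ ^ d`. The chaining takes place on a cube which contains `T`, whose grid
points need not lie in `T`. -/
theorem isTightMeasureSet_of_increments {d : ℕ} {T : Set (EuclideanSpace ℝ (Fin d))}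
    (hT : IsCompact T) {F : Type*} [NormedAddCommGroup F] [ProperSpace F]
    [MeasurableSpace C(T, F)] [BorelSpace C(T, F)]
    {ι : Type*} {Ω : ι → Type*} [∀ i, MeasurableSpace (Ω i)] {P : ∀ i, Measure (Ω i)}
    {X : ∀ i, Ω i → EuclideanSpace ℝ (Fin d) → F} (hXc : ∀ i ω, Continuous (X i ω))
    (hXm : ∀ i x, AEStronglyMeasurable (fun ω => X i ω x) (P i))
    {Z : ∀ i, Ω i → C(T, F)} (hZ : ∀ i, AEMeasurable (Z i) (P i))
    (hZX : ∀ i ω (x : T), Z i ω x = X i ω x)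
    (hincr : ∀ R : ℕ, ∃ A : ℝ, 0 ≤ A ∧ ∀ i x y, (∀ j, |x j| ≤ (R : ℝ)) → (∀ j, |y j| ≤ (R : ℝ)) →
      ∫⁻ ω, ‖X i ω x - X i ω y‖ₑ ^ (4 * d + 2) ∂(P i)
        ≤ ENNReal.ofReal (A * ‖x - y‖ ^ (4 * d + 2)))
    (hpt : ∀ x, ∃ A : ℝ, 0 ≤ A ∧ ∀ i, ∫⁻ ω, ‖X i ω x‖ₑ ^ 1 ∂(P i) ≤ ENNReal.ofReal A) :
    IsTightMeasureSet {μ | ∃ i, μ = (P i).map (Z i)} := by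
  rw [isTightMeasureSet_iff_exists_isCompact_measure_compl_le]
  intro ε hε
  -- without loss of generality `ε` is a real number, which is split into two halves
  obtain ⟨δ, hδ0, hδε⟩ : ∃ δ : ℝ, 0 < δ ∧ ENNReal.ofReal (δ + δ) ≤ ε := by
    rcases eq_or_ne ε ⊤ with rfl | hε'
    · exact ⟨1, one_pos, le_top⟩
    · refine ⟨ε.toReal / 2, half_pos (ENNReal.toReal_pos hε.ne' hε'), ?_⟩
      rw [add_halves, ENNReal.ofReal_toReal hε']
  obtain ⟨R, hR⟩ : ∃ R : ℕ, ∀ x ∈ T, ∀ j, |x j| ≤ R := by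
    obtain ⟨C, hC⟩ := hT.isBounded.exists_norm_le
    obtain ⟨R, hR⟩ := exists_nat_ge C
    exact ⟨R, fun x hx j => (PiLp.norm_apply_le x j).trans ((hC x hx).trans hR)⟩
  obtain ⟨A, hA0, hA⟩ := hincr R
  obtain ⟨M, hM0, hM⟩ := exists_measure_gridPairs_le (d := d) R A hA0 hδ0
  -- the values at the finitely many centers of unit balls covering `T` bound the sup norm
  obtain ⟨t, htT, htf, htc⟩ := hT.finite_cover_balls one_pos
  choose B hB0 hB using hpt
  set t' := htf.toFinset
  set S : ℝ := ∑ x ∈ t', B x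
  have hS0 : 0 ≤ S := Finset.sum_nonneg fun x _ => hB0 x
  set b : ℝ := (S + 1) / δ
  have hb0 : 0 < b := by positivity
  set M' : ℝ := 3 * M / (1 - 3 / 4)
  have hM'0 : 0 ≤ M' := by positivity
  refine ⟨modulusSet T F (b + M') (3 / 4), isCompact_modulusSet T F _ (by norm_num) (by norm_num), ?_⟩
  rintro _ ⟨i, rfl⟩
  have hmeas : MeasurableSet (modulusSet T F (b + M') (3 / 4))ᶜ :=
    (isCompact_modulusSet T F _ (by norm_num) (by norm_num)).isClosed.measurableSet.compl
  rw [Measure.map_apply_of_aemeasurable (hZ i) hmeas]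
  -- outside the small events `E1` and `E2` the field belongs to the compact set
  set E1 : Set (Ω i) := {ω | ∃ k, ∃ m ∈ gridPairs d R k,
    M * (3 / 4) ^ k < ‖X i ω (gridPoint k m.1) - X i ω (gridPoint k m.2)‖}
  set E2 : Set (Ω i) := ⋃ x ∈ t', {ω | b < ‖X i ω x‖}
  have h1 : P i E1 ≤ ENNReal.ofReal δ := hM (hXm i) (hA i)
  have h2 : P i E2 ≤ ENNReal.ofReal δ := by
    refine (measure_biUnion_finset_le _ _).trans ((Finset.sum_le_sum fun x _ =>
      measure_lt_norm_le (hXm i x) hb0 (hB x i)).trans ?_)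
    rw [← ENNReal.ofReal_sum_of_nonneg fun x _ => div_nonneg (hB0 x) (by positivity)]
    refine ENNReal.ofReal_le_ofReal ?_
    rw [← Finset.sum_div, pow_one, div_le_iff₀ hb0]
    simp only [b]
    rw [mul_div_cancel₀ _ hδ0.ne']
    linarith
  refine (measure_mono (t := E1 ∪ E2) fun ω hω => ?_).trans
    ((measure_union_le _ _).trans ((add_le_add h1 h2).trans ?_))
  · by_contra hcon
    rw [Set.mem_union, not_or] at hcon
    refine hω ?_
    have g1 : ∀ k, ∀ m ∈ gridPairs d R k,
        ‖X i ω (gridPoint k m.1) - X i ω (gridPoint k m.2)‖ ≤ M * (3 / 4) ^ k := by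
      intro k m hm
      by_contra hlt
      exact hcon.1 ⟨k, m, hm, not_le.1 hlt⟩
    have g2 : ∀ x ∈ t, ‖X i ω x‖ ≤ b := by
      intro x hx
      by_contra hlt
      exact hcon.2 (Set.mem_biUnion (htf.mem_toFinset.2 hx) (not_le.1 hlt))
    have g3 := norm_sub_le_of_gridPairs (hXc i ω) hM0.le (by norm_num : (0 : ℝ) ≤ 3 / 4)
      (by norm_num) g1
    refine ⟨fun x => ?_, fun k x y hxy => ?_⟩
    · obtain ⟨u, hu, hxu⟩ := Set.mem_iUnion₂.1 (htc x.2)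
      have g4 := g3 0 (hR x x.2) (hR u (htT hu)) fun j => by
        rw [pow_zero]
        have := PiLp.norm_apply_le (x.1 - u) j
        rw [← dist_eq_norm] at this
        exact this.trans (Metric.mem_ball.1 hxu).le
      rw [pow_zero, mul_one] at g4
      rw [hZX]
      calc ‖X i ω x‖ ≤ ‖X i ω u‖ + ‖X i ω x - X i ω u‖ := norm_le_insert' _ _
        _ ≤ b + M' := add_le_add (g2 u hu) g4
    · rw [hZX, hZX]
      refine (g3 k (hR x x.2) (hR y y.2) hxy).trans ?_
      exact mul_le_mul_of_nonneg_right (le_add_of_nonneg_left hb0.le) (by positivity)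
  · rw [← ENNReal.ofReal_add hδ0.le hδ0.le]
    exact hδε

end Tightness

/-! ### Convergence in distribution in a space of continuous functions -/

section ContinuousFunctions

open scoped RealInnerProductSpace

/-- The Riesz representation of functionals on a finite power of a Hilbert space. -/
theorem continuousLinearMap_pi_eq_sum_inner {F : Type*} [NormedAddCommGroup F]
    [InnerProductSpace ℝ F] [CompleteSpace F] {α : Type*} [Fintype α] [DecidableEq α]
    (L : (α → F) →L[ℝ] ℝ) : ∃ t : α → F, ∀ v, L v = ∑ a, ⟪t a, v a⟫ := by
  refine ⟨fun a => (InnerProductSpace.toDual ℝ F).symm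
    (L.comp (ContinuousLinearMap.single ℝ (fun _ => F) a)), fun v => ?_⟩
  simp only [InnerProductSpace.toDual_symm_apply]
  conv_lhs => rw [← Finset.univ_sum_single v]
  rw [map_sum]
  rfl

variable {T : Type} {F : Type*} [MetricSpace T] [CompactSpace T] [NormedAddCommGroup F]
  [InnerProductSpace ℝ F] [FiniteDimensional ℝ F] [MeasurableSpace F] [BorelSpace F]
  [MeasurableSpace C(T, F)] [BorelSpace C(T, F)]

/-- The Borel sigma-algebra of `C(T, F)` is generated by countably many evaluations: evaluation
along a countable dense subset is injective, and hence a measurable embedding. -/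
theorem measurableEmbedding_eval_dense {D : Set T} (hDc : D.Countable) (hD : Dense D) :
    MeasurableEmbedding fun (f : C(T, F)) (x : D) => f x := by
  have := hDc.to_subtype
  have : CompleteSpace F := FiniteDimensional.complete ℝ F
  have := FiniteDimensional.proper_real F
  refine Continuous.measurableEmbedding (by fun_prop) fun f g hfg => ?_
  exact DFunLike.coe_injective (Continuous.ext_on hD f.continuous g.continuous
    fun x hx => congrFun hfg ⟨x, hx⟩)

theorem measurable_continuousMap_of_eval {Ω : Type*} [MeasurableSpace Ω] {Z : Ω → C(T, F)}
    (hZ : ∀ x, Measurable fun ω => Z ω x) : Measurable Z := by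
  obtain ⟨D, hDc, hD⟩ := TopologicalSpace.exists_countable_dense T
  exact (measurableEmbedding_eval_dense hDc hD).measurable_comp_iff.1
    (measurable_pi_lambda _ fun x => hZ x)

/-- The joint characteristic function of the values of a random continuous function at finitely
many points. -/
noncomputable def evalCharFun (ν : Measure C(T, F)) {α : Type*} [Fintype α] (x : α → T)
    (t : α → F) : ℂ :=
  ∫ f, Complex.exp ((∑ a, ⟪t a, f (x a)⟫ : ℝ) * Complex.I) ∂ν

/-- A law on `C(T, F)` is determined by its finite-dimensional characteristic functions. -/
theorem eq_of_evalCharFun_eq {ν ν' : Measure C(T, F)} [IsProbabilityMeasure ν]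
    [IsProbabilityMeasure ν']
    (h : ∀ (I : Finset T) (t : I → F), evalCharFun ν (fun a : I => (a : T)) t
      = evalCharFun ν' (fun a : I => (a : T)) t) : ν = ν' := by
  classical
  have : CompleteSpace F := FiniteDimensional.complete ℝ F
  have := FiniteDimensional.proper_real F
  have hm : Measurable fun (f : C(T, F)) (x : T) => f x :=
    measurable_pi_lambda _ fun x => (continuous_eval_const x).measurable
  have hmI : ∀ I : Finset T, Measurable fun (f : C(T, F)) (x : I) => f x := fun I =>
    measurable_pi_lambda _ fun x => (continuous_eval_const (x : T)).measurable
  have hfd : ∀ I : Finset T, ν.map (fun f (x : I) => f x) = ν'.map fun f (x : I) => f x := by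
    intro I
    have := Measure.isProbabilityMeasure_map (μ := ν) (hmI I).aemeasurable
    have := Measure.isProbabilityMeasure_map (μ := ν') (hmI I).aemeasurable
    refine Measure.ext_of_charFunDual ?_
    ext L
    obtain ⟨t, ht⟩ := continuousLinearMap_pi_eq_sum_inner L
    rw [charFunDual_apply, charFunDual_apply, integral_map (hmI I).aemeasurable (by fun_prop),
      integral_map (hmI I).aemeasurable (by fun_prop)]
    simp_rw [ht]
    exact h I t
  have hall : ν.map (fun f (x : T) => f x) = ν'.map fun f (x : T) => f x := by
    refine IsProjectiveLimit.unique (P := fun I : Finset T => ν.map fun f (x : I) => f x)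
      (fun I => ?_) fun I => ?_
    · rw [Measure.map_map (Finset.measurable_restrict I) hm]; rfl
    · rw [Measure.map_map (Finset.measurable_restrict I) hm]; exact (hfd I).symm
  obtain ⟨D, hDc, hD⟩ := TopologicalSpace.exists_countable_dense T
  have he := measurableEmbedding_eval_dense (F := F) hDc hD
  have hD' : ν.map (fun f (x : D) => f x) = ν'.map fun f (x : D) => f x := by
    have e : (fun (f : C(T, F)) (x : D) => f x)
        = (fun (g : T → F) (x : D) => g x) ∘ fun f (x : T) => f x := rfl
    rw [e, ← Measure.map_map (measurable_pi_lambda _ fun x => measurable_pi_apply _) hm, hall,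
      Measure.map_map (measurable_pi_lambda _ fun x => measurable_pi_apply _) hm]
  rw [← he.comap_map ν, ← he.comap_map ν', hD']

/-- Tight random continuous functions whose finite-dimensional characteristic functions converge
are convergent in distribution. Prokhorov's theorem gives a limit along every ultrafilter, and
all these limits agree because they have the same characteristic functions. -/
theorem exists_tendstoInDistribution_of_isTight {ι : Type*} {l : Filter ι} [l.NeBot]
    {Ω : ι → Type*} [∀ i, MeasurableSpace (Ω i)] {P : ∀ i, Measure (Ω i)}
    [∀ i, IsProbabilityMeasure (P i)] {Z : ∀ i, Ω i → C(T, F)} (hZ : ∀ i, AEMeasurable (Z i) (P i))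
    (htight : IsTightMeasureSet {μ | ∃ i, μ = (P i).map (Z i)})
    {Φ : ∀ {α : Type} [Fintype α], (α → T) → (α → F) → ℂ}
    (hΦ : ∀ {α : Type} [Fintype α] (x : α → T) (t : α → F), Tendsto
      (fun i => ∫ ω, Complex.exp ((∑ a, ⟪t a, Z i ω (x a)⟫ : ℝ) * Complex.I) ∂(P i)) l
      (𝓝 (Φ x t))) :
    ∃ ν : ProbabilityMeasure C(T, F),
      TendstoInDistribution Z l id P (ν : Measure C(T, F)) ∧
      ∀ {α : Type} [Fintype α] (x : α → T) (t : α → F),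
        evalCharFun (ν : Measure C(T, F)) x t = Φ x t := by
  have : CompleteSpace F := FiniteDimensional.complete ℝ F
  have := FiniteDimensional.proper_real F
  set law : ι → ProbabilityMeasure C(T, F) := fun i =>
    ⟨(P i).map (Z i), Measure.isProbabilityMeasure_map (hZ i)⟩ with hlaw
  have hcomp : IsCompact (closure (Set.range law)) := by
    refine isCompact_closure_of_isTightMeasureSet ?_
    convert htight using 1
    ext μ
    constructor
    · rintro ⟨_, ⟨i, rfl⟩, rfl⟩; exact ⟨i, rfl⟩
    · rintro ⟨i, rfl⟩; exact ⟨law i, ⟨i, rfl⟩, rfl⟩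
  have hlim : ∀ U : Ultrafilter ι, ↑U ≤ l → ∃ ν : ProbabilityMeasure C(T, F),
      Tendsto law U (𝓝 ν) ∧ ∀ {α : Type} [Fintype α] (x : α → T) (t : α → F),
        evalCharFun (ν : Measure C(T, F)) x t = Φ x t := by
    intro U hU
    obtain ⟨ν, -, hν⟩ := hcomp.ultrafilter_le_nhds (U.map law) (by
      rw [le_principal_iff]
      exact Filter.mem_of_superset (Ultrafilter.mem_map.2 (univ_mem' fun i => Set.mem_range_self i))
        subset_closure)
    refine ⟨ν, hν, fun {α} _ x t => ?_⟩
    have hν' : Tendsto law U (𝓝 ν) := hν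
    rw [ProbabilityMeasure.tendsto_iff_forall_integral_rclike_tendsto ℂ] at hν'
    let g : BoundedContinuousFunction C(T, F) ℂ := BoundedContinuousFunction.ofNormedAddCommGroup
      (fun f => Complex.exp ((∑ a, ⟪t a, f (x a)⟫ : ℝ) * Complex.I)) (by fun_prop) 1
      fun f => (Complex.norm_exp_ofReal_mul_I _).le
    refine tendsto_nhds_unique (hν' g) ?_
    refine ((hΦ x t).mono_left hU).congr fun i => ?_
    exact (integral_map (hZ i) g.continuous.aestronglyMeasurable).symm
  obtain ⟨ν, -, hν⟩ := hlim (Ultrafilter.of l) (Ultrafilter.of_le l)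
  refine ⟨ν, ⟨hZ, aemeasurable_id, ?_⟩, hν⟩
  have hid : (⟨(ν : Measure C(T, F)).map id,
      Measure.isProbabilityMeasure_map aemeasurable_id⟩ : ProbabilityMeasure C(T, F)) = ν := by
    ext; simp
  rw [hid]
  refine (tendsto_iff_ultrafilter _ _ _).2 fun U hU => ?_
  obtain ⟨ν', hν't, hν'⟩ := hlim U hU
  have : ν' = ν := by
    refine Subtype.ext (eq_of_evalCharFun_eq (ν := (ν' : Measure C(T, F)))
      (ν' := (ν : Measure C(T, F))) fun I t => ?_)
    exact (hν' _ t).trans (hν _ t).symm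
  rwa [this] at hν't

end ContinuousFunctions

/-! ### Gaussian processes with independent coordinates -/

section GaussianField

open scoped RealInnerProductSpace

/-- The variance of `∑ a, ⟪t a, f (x a)⟫` when the coordinates of `f` are uncorrelated, each with
covariance function `K`. -/
noncomputable def isotropicVariance {T : Type} {m : ℕ} (K : T → T → ℝ) {α : Type}
    [Fintype α] (x : α → T) (t : α → EuclideanSpace ℝ (Fin m)) : ℝ :=
  ∑ a, ∑ b, ∑ i, t a i * t b i * K (x a) (x b)

theorem isotropicVariance_smul {T : Type} {m : ℕ} (K : T → T → ℝ) {α : Type} [Fintype α] (x : α → T)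
    (t : α → EuclideanSpace ℝ (Fin m)) (u : ℝ) :
    isotropicVariance K x (fun a => u • t a) = u ^ 2 * isotropicVariance K x t := by
  simp only [isotropicVariance, Finset.mul_sum]
  refine Finset.sum_congr rfl fun a _ => Finset.sum_congr rfl fun b _ =>
    Finset.sum_congr rfl fun i _ => ?_
  simp only [PiLp.smul_apply, smul_eq_mul]
  ring

variable {T : Type} {m : ℕ} [MetricSpace T]
  [MeasurableSpace C(T, EuclideanSpace ℝ (Fin m))] [BorelSpace C(T, EuclideanSpace ℝ (Fin m))]

/-- The law of a random continuous function `f` is that of a centered Gaussian process with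
independent coordinates, each with covariance function `K`, expressed by the joint characteristic
functions of finitely many values of `f`. -/
def IsIsotropicGaussian (ν : Measure C(T, EuclideanSpace ℝ (Fin m))) (K : T → T → ℝ) : Prop :=
  ∀ {α : Type} [Fintype α] (x : α → T) (t : α → EuclideanSpace ℝ (Fin m)),
    evalCharFun ν x t = (Real.exp (-(1 / 2) * isotropicVariance K x t) : ℝ)

namespace IsIsotropicGaussian

variable {ν : Measure C(T, EuclideanSpace ℝ (Fin m))} [IsProbabilityMeasure ν] {K : T → T → ℝ}

omit [BorelSpace C(T, EuclideanSpace ℝ (Fin m))] in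
/-- The exponential in `IsIsotropicGaussian` is a characteristic function, hence at most `1`. -/
theorem variance_nonneg (h : IsIsotropicGaussian ν K) {α : Type} [Fintype α] (x : α → T)
    (t : α → EuclideanSpace ℝ (Fin m)) : 0 ≤ isotropicVariance K x t := by
  have h1 : ‖evalCharFun ν x t‖ ≤ 1 := by
    refine (norm_integral_le_of_norm_le_const (C := 1) (ae_of_all _ fun f => ?_)).trans (by simp)
    exact (Complex.norm_exp_ofReal_mul_I _).le
  rw [h, Complex.norm_real, Real.norm_of_nonneg (Real.exp_pos _).le, Real.exp_le_one_iff] at h1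
  linarith

theorem map_sum_inner (h : IsIsotropicGaussian ν K) {α : Type} [Fintype α] (x : α → T)
    (t : α → EuclideanSpace ℝ (Fin m)) :
    ν.map (fun f => ∑ a, ⟪t a, f (x a)⟫) = gaussianReal 0 (isotropicVariance K x t).toNNReal := by
  have hm : Measurable fun f : C(T, EuclideanSpace ℝ (Fin m)) => ∑ a, ⟪t a, f (x a)⟫ :=
    Continuous.measurable (by fun_prop)
  have := Measure.isProbabilityMeasure_map (μ := ν) hm.aemeasurable
  refine Measure.ext_of_charFun ?_
  ext u
  rw [charFun_gaussianReal, charFun_apply_real, integral_map hm.aemeasurable (by fun_prop)]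
  have h1 := h x fun a => u • t a
  rw [isotropicVariance_smul, evalCharFun] at h1
  simp only [inner_smul_left, RCLike.conj_to_real, ← Finset.mul_sum] at h1
  push_cast at h1 ⊢
  rw [h1, Real.coe_toNNReal _ (h.variance_nonneg x t)]
  congr 1
  ring

theorem isGaussian (h : IsIsotropicGaussian ν K) :
    IsGaussianProcess (fun (x : T) (f : C(T, EuclideanSpace ℝ (Fin m))) => f x) ν where
  hasGaussianLaw I := by
    classical
    have hm : Measurable fun (f : C(T, EuclideanSpace ℝ (Fin m))) =>
        I.restrict (fun x => f x) :=
      measurable_pi_lambda _ fun x => (continuous_eval_const (x : T)).measurable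
    refine ⟨isGaussian_of_map_eq_gaussianReal fun L => ?_⟩
    obtain ⟨t, ht⟩ := continuousLinearMap_pi_eq_sum_inner L
    refine ⟨0, (isotropicVariance K (fun a : I => (a : T)) t).toNNReal, ?_⟩
    rw [Measure.map_map (by fun_prop) hm, ← h.map_sum_inner]
    congr 1
    ext f
    exact ht _

theorem memLp_inner (h : IsIsotropicGaussian ν K) (x : T) (t : EuclideanSpace ℝ (Fin m)) :
    MemLp (fun f : C(T, EuclideanSpace ℝ (Fin m)) => ⟪t, f x⟫) 2 ν :=
  ((h.isGaussian.hasGaussianLaw_eval x).map (innerSL ℝ t)).memLp_two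

theorem memLp_apply (h : IsIsotropicGaussian ν K) (x : T) (i : Fin m) :
    MemLp (fun f : C(T, EuclideanSpace ℝ (Fin m)) => f x i) 2 ν := by
  simpa [PiLp.inner_apply] using h.memLp_inner x (EuclideanSpace.single i 1)

theorem integral_apply (h : IsIsotropicGaussian ν K) (x : T) :
    ∫ f : C(T, EuclideanSpace ℝ (Fin m)), f x ∂ν = 0 := by
  have hint : Integrable (fun f : C(T, EuclideanSpace ℝ (Fin m)) => f x) ν :=
    (h.isGaussian.hasGaussianLaw_eval x).memLp_two.integrable one_le_two
  refine ext_inner_left ℝ fun t => ?_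
  rw [← integral_inner hint, inner_zero_right]
  have h1 := h.map_sum_inner (α := Unit) (fun _ => x) fun _ => t
  simp only [Finset.univ_unique, Finset.sum_singleton] at h1
  have h2 : ∫ u, u ∂(ν.map fun f : C(T, EuclideanSpace ℝ (Fin m)) => ⟪t, f x⟫) = 0 := by
    rw [h1, integral_id_gaussianReal]
  rwa [integral_map (Continuous.measurable (by fun_prop)).aemeasurable (by fun_prop)] at h2

theorem variance_apply_add (h : IsIsotropicGaussian ν K) (x y : T)
    (s t : EuclideanSpace ℝ (Fin m)) :
    Var[fun f : C(T, EuclideanSpace ℝ (Fin m)) => ⟪s, f x⟫ + ⟪t, f y⟫; ν]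
      = isotropicVariance K ![x, y] ![s, t] := by
  have h1 := h.map_sum_inner ![x, y] ![s, t]
  simp only [Fin.sum_univ_two, Matrix.cons_val_zero, Matrix.cons_val_one] at h1
  have h2 := variance_id_gaussianReal (μ := 0) (v := (isotropicVariance K ![x, y] ![s, t]).toNNReal)
  rw [← h1, variance_map aemeasurable_id (Continuous.measurable (by fun_prop)).aemeasurable,
    Real.coe_toNNReal _ (h.variance_nonneg _ _)] at h2
  exact h2

/-- The covariances, by polarization from the variances. -/
theorem covariance_apply (h : IsIsotropicGaussian ν K) (hK : ∀ x y, K x y = K y x) (x y : T)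
    (i j : Fin m) :
    cov[fun f : C(T, EuclideanSpace ℝ (Fin m)) => f x i,
      fun f : C(T, EuclideanSpace ℝ (Fin m)) => f y j; ν] = if i = j then K x y else 0 := by
  have h1 := variance_fun_add (h.memLp_apply x i) (h.memLp_apply y j)
  have h2 := h.variance_apply_add x y (EuclideanSpace.single i 1) (EuclideanSpace.single j 1)
  have h3 := h.variance_apply_add x x (EuclideanSpace.single i 1) 0
  have h4 := h.variance_apply_add y y (EuclideanSpace.single j 1) 0
  simp only [PiLp.inner_apply, isotropicVariance, Fin.sum_univ_two, inner_zero_left, add_zero,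
    PiLp.single_apply, RCLike.inner_apply, Matrix.cons_val_zero, Matrix.cons_val_one,
    conj_trivial, mul_ite, mul_one, mul_zero, Finset.sum_ite_eq', Finset.mem_univ, if_true,
    PiLp.zero_apply, zero_mul, ite_mul, one_mul, Finset.sum_const_zero] at h2 h3 h4
  rw [h2, h3, h4, hK y x] at h1
  by_cases hij : i = j
  · subst hij
    simp only [if_true] at h1 ⊢
    linarith
  · simp only [hij, Ne.symm hij, if_false] at h1 ⊢
    linarith

/-- The coordinates are jointly Gaussian and uncorrelated, hence independent. -/
theorem iIndepFun_apply (h : IsIsotropicGaussian ν K) (hK : ∀ x y, K x y = K y x) :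
    iIndepFun (fun (i : Fin m) (f : C(T, EuclideanSpace ℝ (Fin m))) (x : T) => f x i) ν := by
  refine IsGaussianProcess.iIndepFun_of_covariance_eq_zero (S := fun _ : Fin m => T)
    (X := fun i x (f : C(T, EuclideanSpace ℝ (Fin m))) => f x i) ?_
    (fun i x => (h.memLp_apply x i).aemeasurable) ?_
  · refine IsGaussianProcess.of_isGaussianProcess h.isGaussian fun p => ⟨{p.2},
      (EuclideanSpace.proj p.1).comp (ContinuousLinearMap.proj ⟨p.2, by simp⟩), fun f => ?_⟩
    simp
  · intro i j hij x y
    rw [h.covariance_apply hK, if_neg hij]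

theorem identDistrib_apply (h : IsIsotropicGaussian ν K) (i j : Fin m) :
    IdentDistrib (fun (f : C(T, EuclideanSpace ℝ (Fin m))) (x : T) => f x i)
      (fun (f : C(T, EuclideanSpace ℝ (Fin m))) (x : T) => f x j) ν ν := by
  classical
  have hm : ∀ i : Fin m, Measurable fun (f : C(T, EuclideanSpace ℝ (Fin m))) (x : T) => f x i :=
    fun i => measurable_pi_lambda _ fun x => Continuous.measurable (by fun_prop)
  refine (identDistrib_iff_forall_finset_identDistrib
    (X := fun x (f : C(T, EuclideanSpace ℝ (Fin m))) => f x i)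
    (Y := fun x (f : C(T, EuclideanSpace ℝ (Fin m))) => f x j) (hm i).aemeasurable (hm j).aemeasurable).2 fun I => ?_
  have hmI : ∀ i : Fin m, Measurable fun f : C(T, EuclideanSpace ℝ (Fin m)) =>
      I.restrict fun x => f x i := fun i => (Finset.measurable_restrict I).comp (hm i)
  refine ⟨(hmI i).aemeasurable, (hmI j).aemeasurable, ?_⟩
  have := Measure.isProbabilityMeasure_map (μ := ν) (hmI i).aemeasurable
  have := Measure.isProbabilityMeasure_map (μ := ν) (hmI j).aemeasurable
  refine Measure.ext_of_charFunDual ?_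
  ext L
  obtain ⟨t, ht⟩ := continuousLinearMap_pi_eq_sum_inner L
  have key : ∀ i : Fin m, charFunDual (ν.map fun f : C(T, EuclideanSpace ℝ (Fin m)) =>
      I.restrict fun x => f x i) L
      = (Real.exp (-(1 / 2) * ∑ a : I, ∑ b : I, t a * t b * K a b) : ℝ) := by
    intro i
    have h1 := h (fun a : I => (a : T)) fun a => EuclideanSpace.single i (t a)
    have h2 : isotropicVariance K (fun a : I => (a : T))
        (fun a => EuclideanSpace.single i (t a)) = ∑ a : I, ∑ b : I, t a * t b * K a b := by
      simp [isotropicVariance, PiLp.single_apply]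
    rw [h2] at h1
    rw [charFunDual_apply, integral_map (hmI i).aemeasurable (by fun_prop), ← h1, evalCharFun]
    simp [ht, PiLp.inner_apply, PiLp.single_apply, mul_comm]
  rw [key, key]

end IsIsotropicGaussian

end GaussianField

/-! ### Random fully connected networks -/

/-- The vector of activations at layer `ℓ`: the input at layer `0`, and the image of the
pre-activations under `σ` at the later layers. -/
def activation {N : ℕ → ℕ} (σ : ℝ → ℝ) (W : ∀ ℓ, Matrix (Fin (N (ℓ + 1))) (Fin (N ℓ)) ℝ)
    (b : ∀ ℓ, Fin (N (ℓ + 1)) → ℝ) (x : EuclideanSpace ℝ (Fin (N 0))) : ∀ ℓ, Fin (N ℓ) → ℝ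
  | 0 => fun i => x i
  | ℓ + 1 => fun i => σ (preactivation σ W b x (ℓ + 1) i)

theorem preactivation_succ {N : ℕ → ℕ} (σ : ℝ → ℝ)
    (W : ∀ ℓ, Matrix (Fin (N (ℓ + 1))) (Fin (N ℓ)) ℝ) (b : ∀ ℓ, Fin (N (ℓ + 1)) → ℝ)
    (x : EuclideanSpace ℝ (Fin (N 0))) (ℓ : ℕ) (i : Fin (N (ℓ + 1))) :
    preactivation σ W b x (ℓ + 1) i = b ℓ i + ∑ j, W ℓ i j * activation σ W b x ℓ j := by
  cases ℓ <;> rfl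

section Network

variable {Ω : Type*} {N : ℕ → ℕ} {σ : ℝ → ℝ} {CW : ℝ}
  {What : Ω → ∀ ℓ, Matrix (Fin (N (ℓ + 1))) (Fin (N ℓ)) ℝ} {b : Ω → ∀ ℓ, Fin (N (ℓ + 1)) → ℝ}

/-- The activations of a random network, as random variables. -/
noncomputable def randomActivation (σ : ℝ → ℝ) (CW : ℝ)
    (What : Ω → ∀ ℓ, Matrix (Fin (N (ℓ + 1))) (Fin (N ℓ)) ℝ)
    (b : Ω → ∀ ℓ, Fin (N (ℓ + 1)) → ℝ) (x : EuclideanSpace ℝ (Fin (N 0))) (ℓ : ℕ)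
    (i : Fin (N ℓ)) (ω : Ω) : ℝ :=
  activation σ (scaledWeights CW (What ω)) (b ω) x ℓ i

/-- The factor `√(CW / N ℓ)` is moved from the weights to the activations, which exhibits the
pre-activations as linear combinations of the independent variables `What` and `b`. -/
theorem randomPreactivation_succ (x : EuclideanSpace ℝ (Fin (N 0))) (ℓ : ℕ)
    (i : Fin (N (ℓ + 1))) (ω : Ω) :
    randomPreactivation σ CW What b x (ℓ + 1) i ω = b ω ℓ i + ∑ j,
      What ω ℓ i j * (Real.sqrt (CW / N ℓ) * randomActivation σ CW What b x ℓ j ω) := by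
  rw [randomPreactivation, preactivation_succ]
  simp only [scaledWeights, Matrix.smul_apply, smul_eq_mul, randomActivation]
  congr 1
  exact Finset.sum_congr rfl fun j _ => by ring

/-- The index set of the weights and biases of the layers `1, …, L + 1`. -/
abbrev ParameterIndex (L : ℕ) (N : ℕ → ℕ) : Type :=
  (Σ ℓ : Fin (L + 1), Fin (N (ℓ + 1)) × Fin (N ℓ)) ⊕ (Σ ℓ : Fin (L + 1), Fin (N (ℓ + 1)))

/-- The family of all unscaled weights and biases of the layers `1, …, L + 1`. -/
def parameter (L : ℕ) (What : Ω → ∀ ℓ, Matrix (Fin (N (ℓ + 1))) (Fin (N ℓ)) ℝ)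
    (b : Ω → ∀ ℓ, Fin (N (ℓ + 1)) → ℝ) : ParameterIndex L N → Ω → ℝ :=
  Sum.elim (fun k ω => What ω k.1 k.2.1 k.2.2) (fun k ω => b ω k.1 k.2)

/-- The layer from which a weight or bias leads to the next one. -/
def ParameterIndex.layer {L : ℕ} {N : ℕ → ℕ} : ParameterIndex L N → ℕ :=
  Sum.elim (fun k => k.1) (fun k => k.1)

/-- The sigma-algebra generated by the weights and biases which lead to the layers `1, …, ℓ`. -/
abbrev layerSigma (L : ℕ) (What : Ω → ∀ ℓ, Matrix (Fin (N (ℓ + 1))) (Fin (N ℓ)) ℝ)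
    (b : Ω → ∀ ℓ, Fin (N (ℓ + 1)) → ℝ) (ℓ : ℕ) : MeasurableSpace Ω :=
  ⨆ k ∈ {k : ParameterIndex L N | k.layer < ℓ}, (inferInstance : MeasurableSpace ℝ).comap
    (parameter L What b k)

theorem layerSigma_mono {L : ℕ} {ℓ ℓ' : ℕ} (h : ℓ ≤ ℓ') :
    layerSigma L What b ℓ ≤ layerSigma L What b ℓ' :=
  biSup_mono fun _ hk => lt_of_lt_of_le hk h

theorem measurable_parameter_layerSigma {L : ℕ} {ℓ : ℕ} {k : ParameterIndex L N}
    (hk : k.layer < ℓ) : Measurable[layerSigma L What b ℓ] (parameter L What b k) :=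
  Measurable.mono (comap_measurable _)
    (le_biSup (fun k => (inferInstance : MeasurableSpace ℝ).comap (parameter L What b k))
      (show k ∈ {k : ParameterIndex L N | k.layer < ℓ} from hk)) le_rfl

theorem measurable_randomActivation_layerSigma {L : ℕ} (hσ : Measurable σ)
    (x : EuclideanSpace ℝ (Fin (N 0))) : ∀ ℓ ≤ L + 1, ∀ j,
      Measurable[layerSigma L What b ℓ] (randomActivation σ CW What b x ℓ j)
  | 0, _, j => @measurable_const _ _ _ (_) _
  | ℓ + 1, hℓ, j => by
    refine hσ.comp ?_
    have h1 : randomPreactivation σ CW What b x (ℓ + 1) j = fun ω => b ω ℓ j + ∑ i,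
        What ω ℓ j i * (Real.sqrt (CW / N ℓ) * randomActivation σ CW What b x ℓ i ω) :=
      funext fun ω => randomPreactivation_succ x ℓ j ω
    change Measurable[layerSigma L What b (ℓ + 1)] (randomPreactivation σ CW What b x (ℓ + 1) j)
    rw [h1]
    refine Measurable.add (measurable_parameter_layerSigma (L := L)
      (k := Sum.inr ⟨⟨ℓ, by omega⟩, j⟩) (Nat.lt_succ_self ℓ)) ?_
    refine Finset.measurable_fun_sum _ fun i _ => Measurable.mul
      (measurable_parameter_layerSigma (L := L) (k := Sum.inl ⟨⟨ℓ, by omega⟩, j, i⟩)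
        (Nat.lt_succ_self ℓ)) (Measurable.const_mul ?_ _)
    exact (measurable_randomActivation_layerSigma hσ x ℓ (by omega) i).mono
      (layerSigma_mono (Nat.le_succ ℓ)) le_rfl

/-- The weights and biases which lead from layer `ℓ` to the neurons `idx r` of layer `ℓ + 1`. The
index `Sum.inl (r, j)` stands for the weight between the neurons `j` and `idx r`, and `Sum.inr r` for
the bias of `idx r`. -/
def nextParameter (What : Ω → ∀ ℓ, Matrix (Fin (N (ℓ + 1))) (Fin (N ℓ)) ℝ)
    (b : Ω → ∀ ℓ, Fin (N (ℓ + 1)) → ℝ) (ℓ : ℕ) {ρ : Type} (idx : ρ → Fin (N (ℓ + 1))) :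
    (ρ × Fin (N ℓ)) ⊕ ρ → Ω → ℝ :=
  Sum.elim (fun k ω => What ω ℓ (idx k.1) k.2) (fun r ω => b ω ℓ (idx r))

/-- The position of `nextParameter` in the family of all parameters. -/
def nextParameterIndex {L : ℕ} {ℓ : ℕ} (hℓ : ℓ ≤ L) {ρ : Type} (idx : ρ → Fin (N (ℓ + 1))) :
    (ρ × Fin (N ℓ)) ⊕ ρ → ParameterIndex L N :=
  Sum.map (fun k => ⟨⟨ℓ, Nat.lt_succ_of_le hℓ⟩, idx k.1, k.2⟩)
    (fun r => ⟨⟨ℓ, Nat.lt_succ_of_le hℓ⟩, idx r⟩)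

theorem parameter_nextParameterIndex {L : ℕ} {ℓ : ℕ} (hℓ : ℓ ≤ L) {ρ : Type}
    (idx : ρ → Fin (N (ℓ + 1))) (k : (ρ × Fin (N ℓ)) ⊕ ρ) :
    parameter L What b (nextParameterIndex hℓ idx k) = nextParameter What b ℓ idx k := by
  cases k <;> rfl

theorem layer_nextParameterIndex {L : ℕ} {ℓ : ℕ} (hℓ : ℓ ≤ L) {ρ : Type}
    (idx : ρ → Fin (N (ℓ + 1))) (k : (ρ × Fin (N ℓ)) ⊕ ρ) :
    (nextParameterIndex hℓ idx k).layer = ℓ := by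
  cases k <;> rfl

theorem nextParameterIndex_injective {L : ℕ} {ℓ : ℕ} (hℓ : ℓ ≤ L) {ρ : Type}
    {idx : ρ → Fin (N (ℓ + 1))} (hidx : Function.Injective idx) :
    Function.Injective (nextParameterIndex (N := N) hℓ idx) := by
  refine Sum.map_injective.2 ⟨?_, ?_⟩
  · rintro ⟨r, j⟩ ⟨r', j'⟩ h
    simp only [Sigma.mk.injEq, heq_eq_eq, true_and, Prod.mk.injEq] at h
    rw [hidx h.1, h.2]
  · intro r r' h
    simp only [Sigma.mk.injEq, heq_eq_eq, true_and] at h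
    exact hidx h

variable [MeasurableSpace Ω] {P : Measure Ω} {L : ℕ} {μ : Measure ℝ}
  {Cb : ℝ≥0}

/-- A random initialization whose weights and biases are measurable, rather than almost everywhere
measurable. -/
structure IsMeasurableInit (P : Measure Ω) (L : ℕ) (N : ℕ → ℕ) (μ : Measure ℝ) (Cb : ℝ≥0)
    (What : Ω → ∀ ℓ, Matrix (Fin (N (ℓ + 1))) (Fin (N ℓ)) ℝ)
    (b : Ω → ∀ ℓ, Fin (N (ℓ + 1)) → ℝ) : Prop extends IsRandomInit P L N μ Cb What b where
  measurable_weight : ∀ ℓ ≤ L, ∀ i j, Measurable fun ω => What ω ℓ i j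
  measurable_bias : ∀ ℓ ≤ L, ∀ i, Measurable fun ω => b ω ℓ i

namespace IsMeasurableInit

theorem measurable_parameter (h : IsMeasurableInit P L N μ Cb What b) :
    ∀ k, Measurable (parameter L What b k)
  | Sum.inl k => h.measurable_weight _ (Nat.le_of_lt_succ k.1.2) _ _
  | Sum.inr k => h.measurable_bias _ (Nat.le_of_lt_succ k.1.2) _

theorem layerSigma_le (h : IsMeasurableInit P L N μ Cb What b) (ℓ : ℕ) :
    layerSigma L What b ℓ ≤ ‹MeasurableSpace Ω› :=
  iSup₂_le fun k _ => (h.measurable_parameter k).comap_le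

theorem measurable_randomActivation (h : IsMeasurableInit P L N μ Cb What b) (hσ : Measurable σ)
    (x : EuclideanSpace ℝ (Fin (N 0))) {ℓ : ℕ} (hℓ : ℓ ≤ L + 1) (j : Fin (N ℓ)) :
    Measurable (randomActivation σ CW What b x ℓ j) :=
  (measurable_randomActivation_layerSigma hσ x ℓ hℓ j).mono (h.layerSigma_le ℓ) le_rfl

theorem measurable_nextParameter (h : IsMeasurableInit P L N μ Cb What b) {ℓ : ℕ} (hℓ : ℓ ≤ L)
    {ρ : Type} (idx : ρ → Fin (N (ℓ + 1))) (k : (ρ × Fin (N ℓ)) ⊕ ρ) :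
    Measurable (nextParameter What b ℓ idx k) := by
  rw [← parameter_nextParameterIndex hℓ]
  exact h.measurable_parameter _

theorem measurable_randomPreactivation (h : IsMeasurableInit P L N μ Cb What b)
    (hσ : Measurable σ) (x : EuclideanSpace ℝ (Fin (N 0))) :
    ∀ {ℓ : ℕ}, ℓ ≤ L + 1 → ∀ j : Fin (N ℓ), Measurable (randomPreactivation σ CW What b x ℓ j)
  | 0, _, j => measurable_const
  | ℓ + 1, hℓ, j => by
    have h0 : randomPreactivation σ CW What b x (ℓ + 1) j = fun ω => b ω ℓ j + ∑ i,
        What ω ℓ j i * (Real.sqrt (CW / N ℓ) * randomActivation σ CW What b x ℓ i ω) :=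
      funext fun ω => randomPreactivation_succ x ℓ j ω
    rw [h0]
    have h1 := h.measurable_bias ℓ (by omega) j
    have h2 := h.measurable_weight ℓ (by omega) j
    have h3 := fun i => h.measurable_randomActivation (CW := CW) hσ x (ℓ := ℓ) (by omega) i
    fun_prop

theorem iIndepFun_nextParameter (h : IsMeasurableInit P L N μ Cb What b) {ℓ : ℕ} (hℓ : ℓ ≤ L)
    {ρ : Type} {idx : ρ → Fin (N (ℓ + 1))} (hidx : Function.Injective idx) :
    iIndepFun (nextParameter What b ℓ idx) P := by
  have h1 := h.indep.precomp (nextParameterIndex_injective (N := N) hℓ hidx)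
  convert! h1 using 1
  ext k ω
  exact congrFun (parameter_nextParameterIndex hℓ idx k).symm ω

/-- The weights and biases leading out of a layer are independent of everything that happens up to
that layer. -/
theorem indepFun_nextParameter (h : IsMeasurableInit P L N μ Cb What b) {ℓ : ℕ} (hℓ : ℓ ≤ L)
    {ρ : Type} (idx : ρ → Fin (N (ℓ + 1))) {κ : Type*} {s : κ → Ω → ℝ}
    (hs : ∀ k, Measurable[layerSigma L What b ℓ] (s k)) :
    IndepFun (fun ω k => s k ω) (fun ω k => nextParameter What b ℓ idx k ω) P := by
  have hind : iIndep (fun k : ParameterIndex L N =>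
      (inferInstance : MeasurableSpace ℝ).comap (parameter L What b k)) P := h.indep
  have hdisj : Disjoint {k : ParameterIndex L N | k.layer < ℓ}
      {k : ParameterIndex L N | k.layer = ℓ} :=
    Set.disjoint_left.2 fun k h1 h2 => (ne_of_lt h1) h2
  have h1 := indep_iSup_of_disjoint (fun k => (h.measurable_parameter k).comap_le) hind hdisj
  refine (IndepFun_iff_Indep _ _ _).2 (indep_of_indep_of_le_left
    (indep_of_indep_of_le_right h1 ?_) ?_)
  · refine Measurable.comap_le (@measurable_pi_lambda _ _ _ (_) _ _ fun k => ?_)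
    rw [← parameter_nextParameterIndex hℓ]
    exact Measurable.mono (comap_measurable _)
      (le_biSup (fun k => (inferInstance : MeasurableSpace ℝ).comap (parameter L What b k))
        (show nextParameterIndex hℓ idx k ∈ {k : ParameterIndex L N | k.layer = ℓ} from
          layer_nextParameterIndex hℓ idx k)) le_rfl
  · exact Measurable.comap_le (@measurable_pi_lambda _ _ _ (_) _ _ hs)

theorem map_nextParameter_inl (h : IsMeasurableInit P L N μ Cb What b) {ℓ : ℕ} (hℓ : ℓ ≤ L)
    {ρ : Type} (idx : ρ → Fin (N (ℓ + 1))) (k : ρ × Fin (N ℓ)) :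
    P.map (nextParameter What b ℓ idx (Sum.inl k)) = μ :=
  (h.weight_law ℓ hℓ _ _).map_eq

theorem map_nextParameter_inr (h : IsMeasurableInit P L N μ Cb What b) {ℓ : ℕ} (hℓ : ℓ ≤ L)
    {ρ : Type} (idx : ρ → Fin (N (ℓ + 1))) (r : ρ) :
    P.map (nextParameter What b ℓ idx (Sum.inr r)) = gaussianReal 0 Cb :=
  (h.bias_law ℓ hℓ _).map_eq

end IsMeasurableInit

end Network

/-! ### Estimates for one layer given the previous ones -/

theorem abs_exp_neg_sub_exp_neg_le {x y : ℝ} (hx : 0 ≤ x) (hy : 0 ≤ y) :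
    |Real.exp (-x) - Real.exp (-y)| ≤ |x - y| := by
  wlog h : x ≤ y generalizing x y
  · rw [abs_sub_comm, abs_sub_comm x]
    exact this hy hx (le_of_not_ge h)
  have h1 : Real.exp (-y) ≤ Real.exp (-x) := Real.exp_le_exp.2 (by linarith)
  rw [abs_of_nonneg (by linarith), abs_sub_comm, abs_of_nonneg (by linarith)]
  have h2 : Real.exp (-y) = Real.exp (-x) * Real.exp (-(y - x)) := by
    rw [← Real.exp_add]; ring_nf
  have h3 : Real.exp (-x) ≤ 1 := Real.exp_le_one_iff.2 (by linarith)
  have h4 := Real.add_one_le_exp (-(y - x))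
  have h5 := Real.exp_pos (-x)
  rw [h2]
  nlinarith

section Network

variable {Ω : Type*} {N : ℕ → ℕ} {σ : ℝ → ℝ} {CW : ℝ}
  {What : Ω → ∀ ℓ, Matrix (Fin (N (ℓ + 1))) (Fin (N ℓ)) ℝ} {b : Ω → ∀ ℓ, Fin (N (ℓ + 1)) → ℝ}

/-- Coefficients for the family `nextParameter`: `√(CW / N ℓ) * u r j` for the weights and `c r`
for the biases. -/
noncomputable def nextCoefficient (N : ℕ → ℕ) (CW : ℝ) (ℓ : ℕ) {ρ : Type}
    (u : ρ → Fin (N ℓ) → Ω → ℝ) (c : ρ → ℝ) : (ρ × Fin (N ℓ)) ⊕ ρ → Ω → ℝ :=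
  Sum.elim (fun k ω => Real.sqrt (CW / N ℓ) * u k.1 k.2 ω) (fun r _ => c r)

theorem sum_nextCoefficient_mul {ℓ : ℕ} {ρ : Type} [Fintype ρ] (idx : ρ → Fin (N (ℓ + 1)))
    (u : ρ → Fin (N ℓ) → Ω → ℝ) (c : ρ → ℝ) (ω : Ω) :
    ∑ k, nextCoefficient N CW ℓ u c k ω * nextParameter What b ℓ idx k ω
      = ∑ r, (c r * b ω ℓ (idx r)
        + ∑ j, Real.sqrt (CW / N ℓ) * u r j ω * What ω ℓ (idx r) j) := by
  rw [Fintype.sum_sum_type, Fintype.sum_prod_type, add_comm, ← Finset.sum_add_distrib]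
  rfl

/-- Linear combinations of pre-activations at several inputs are linear combinations of the
independent parameters of the last layer, with coefficients that depend on the layers before. -/
theorem sum_mul_randomPreactivation_succ {ℓ : ℕ} {ρ α : Type} [Fintype ρ] [Fintype α]
    (idx : ρ → Fin (N (ℓ + 1))) (x : α → EuclideanSpace ℝ (Fin (N 0))) (t : ρ → α → ℝ) (ω : Ω) :
    ∑ r, ∑ a, t r a * randomPreactivation σ CW What b (x a) (ℓ + 1) (idx r) ω
      = ∑ k, nextCoefficient N CW ℓ
          (fun r j ω => ∑ a, t r a * randomActivation σ CW What b (x a) ℓ j ω)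
          (fun r => ∑ a, t r a) k ω * nextParameter What b ℓ idx k ω := by
  rw [sum_nextCoefficient_mul]
  refine Finset.sum_congr rfl fun r _ => ?_
  simp_rw [randomPreactivation_succ, mul_add, Finset.sum_add_distrib, Finset.sum_mul,
    Finset.mul_sum, Finset.sum_mul]
  congr 1
  rw [Finset.sum_comm]
  exact Finset.sum_congr rfl fun j _ => Finset.sum_congr rfl fun a _ => by ring

theorem measurable_nextCoefficient_layerSigma {L : ℕ} {ℓ : ℕ} {ρ : Type}
    {u : ρ → Fin (N ℓ) → Ω → ℝ}
    (hu : ∀ r j, Measurable[layerSigma L What b ℓ] (u r j)) (c : ρ → ℝ) :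
    ∀ k, Measurable[layerSigma L What b ℓ] (nextCoefficient N CW ℓ u c k)
  | Sum.inl k => (hu k.1 k.2).const_mul _
  | Sum.inr _ => @measurable_const _ _ _ (_) _

/-- The conditional variance of `∑ k, nextCoefficient k * nextParameter k` given the previous
layers. -/
noncomputable def conditionalVariance (N : ℕ → ℕ) (CW : ℝ) (Cb : ℝ≥0) (ℓ : ℕ) {ρ : Type}
    [Fintype ρ] (u : ρ → Fin (N ℓ) → Ω → ℝ) (c : ρ → ℝ) (ω : Ω) : ℝ :=
  ∑ r, (Cb * c r ^ 2 + CW * ((N ℓ : ℝ)⁻¹ * ∑ j, u r j ω ^ 2))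

variable [MeasurableSpace Ω] {P : Measure Ω} {L : ℕ} {μ : Measure ℝ} {Cb : ℝ≥0}

namespace IsMeasurableInit

variable [IsProbabilityMeasure P]

/-- Integrating out the weights and biases that lead to the neurons `idx r`. -/
theorem integral_exp_eq [IsProbabilityMeasure μ] (h : IsMeasurableInit P L N μ Cb What b) {ℓ : ℕ}
    (hℓ : ℓ ≤ L) {ρ : Type} [Fintype ρ] {idx : ρ → Fin (N (ℓ + 1))} (hidx : Function.Injective idx)
    {u : ρ → Fin (N ℓ) → Ω → ℝ} (hu : ∀ r j, Measurable[layerSigma L What b ℓ] (u r j))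
    (c : ρ → ℝ) :
    ∫ ω, Complex.exp ((∑ k, nextCoefficient N CW ℓ u c k ω * nextParameter What b ℓ idx k ω : ℝ)
        * Complex.I) ∂P
      = ∫ ω, ((∏ k : ρ × Fin (N ℓ), charFun μ (Real.sqrt (CW / N ℓ) * u k.1 k.2 ω))
        * ∏ r, charFun (gaussianReal 0 Cb) (c r)) ∂P := by
  have hs := measurable_nextCoefficient_layerSigma (CW := CW) hu c
  rw [integral_exp_sum_mul_eq (h.measurable_nextParameter hℓ idx)
    (fun k => (hs k).mono (h.layerSigma_le ℓ) le_rfl) (h.iIndepFun_nextParameter hℓ hidx)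
    (h.indepFun_nextParameter hℓ idx hs)]
  refine integral_congr_ae (ae_of_all _ fun ω => ?_)
  beta_reduce
  rw [Fintype.prod_sum_type]
  simp only [h.map_nextParameter_inl hℓ, h.map_nextParameter_inr hℓ]
  rfl

/-- Quantitative central limit theorem for the neurons of one layer. The first error term comes
from replacing the weights by Gaussian ones, the second from the fluctuations of the conditional
variance around the constant `A`. -/
theorem norm_integral_exp_sub_le [IsProbabilityMeasure μ] (h : IsMeasurableInit P L N μ Cb What b)
    (hCW : 0 ≤ CW) {C : ℝ}
    (hC : ∀ u, ‖charFun μ u - Real.exp (-(u ^ 2 / 2))‖ ≤ C * |u| ^ 3)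
    {ℓ : ℕ} (hℓ : ℓ ≤ L) {ρ : Type} [Fintype ρ] {idx : ρ → Fin (N (ℓ + 1))}
    (hidx : Function.Injective idx) {u : ρ → Fin (N ℓ) → Ω → ℝ}
    (hu : ∀ r j, Measurable[layerSigma L What b ℓ] (u r j)) (hu3 : ∀ r j, MemLp (u r j) 3 P)
    (c : ρ → ℝ) {A : ℝ} (hA : 0 ≤ A) :
    ‖∫ ω, Complex.exp ((∑ k, nextCoefficient N CW ℓ u c k ω * nextParameter What b ℓ idx k ω : ℝ)
        * Complex.I) ∂P - (Real.exp (-(1 / 2) * A) : ℝ)‖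
      ≤ C * ∑ r, ∑ j, Real.sqrt (CW / N ℓ) ^ 3 * ∫ ω, |u r j ω| ^ 3 ∂P
        + 1 / 2 * ∫ ω, |conditionalVariance N CW Cb ℓ u c ω - A| ∂P := by
  rw [h.integral_exp_eq hℓ hidx hu]
  have hum : ∀ r j, Measurable (u r j) := fun r j => (hu r j).mono (h.layerSigma_le ℓ) le_rfl
  have hcf : ∀ {ν : Measure ℝ} [IsProbabilityMeasure ν], Measurable (charFun ν) := fun {ν} _ =>
    continuous_charFun.measurable
  have hi3 : ∀ r j, Integrable (fun ω => |u r j ω| ^ 3) P := fun r j => by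
    simpa using (hu3 r j).integrable_norm_pow (by norm_num)
  have hi2 : ∀ r j, Integrable (fun ω => u r j ω ^ 2) P := fun r j =>
    ((hu3 r j).mono_exponent (by norm_num)).integrable_sq
  have hAi : Integrable (conditionalVariance N CW Cb ℓ u c) P := by
    unfold conditionalVariance
    refine integrable_finsetSum _ fun r _ => (integrable_const _).add (Integrable.const_mul
      (Integrable.const_mul (integrable_finsetSum _ fun j _ => hi2 r j) _) _)
  have hb1 : ∀ ω, ‖(∏ k : ρ × Fin (N ℓ), charFun μ (Real.sqrt (CW / N ℓ) * u k.1 k.2 ω))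
        * ∏ r, charFun (gaussianReal 0 Cb) (c r)‖ ≤ 1 := fun ω => by
    rw [norm_mul, norm_prod, norm_prod]
    exact mul_le_one₀ (Finset.prod_le_one (fun _ _ => norm_nonneg _) fun _ _ => norm_charFun_le_one _)
      (Finset.prod_nonneg fun _ _ => norm_nonneg _)
      (Finset.prod_le_one (fun _ _ => norm_nonneg _) fun _ _ => norm_charFun_le_one _)
  have hint : Integrable (fun ω => (∏ k : ρ × Fin (N ℓ), charFun μ (Real.sqrt (CW / N ℓ) *
      u k.1 k.2 ω)) * ∏ r, charFun (gaussianReal 0 Cb) (c r)) P := by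
    refine (integrable_const (1 : ℝ)).mono' ?_ (ae_of_all _ hb1)
    refine Measurable.aestronglyMeasurable (Measurable.mul_const ?_ _)
    exact Finset.measurable_fun_prod _ fun k _ => hcf.comp ((hum k.1 k.2).const_mul _)
  have e1 : ((Real.exp (-(1 / 2) * A) : ℝ) : ℂ) = ∫ _, ((Real.exp (-(1 / 2) * A) : ℝ) : ℂ) ∂P := by
    simp
  rw [e1, ← integral_sub hint (integrable_const _)]
  have e2 : C * ∑ r, ∑ j, Real.sqrt (CW / N ℓ) ^ 3 * ∫ ω, |u r j ω| ^ 3 ∂P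
        + 1 / 2 * ∫ ω, |conditionalVariance N CW Cb ℓ u c ω - A| ∂P
      = ∫ ω, (C * ∑ r, ∑ j, Real.sqrt (CW / N ℓ) ^ 3 * |u r j ω| ^ 3
        + 1 / 2 * |conditionalVariance N CW Cb ℓ u c ω - A|) ∂P := by
    rw [integral_add, integral_const_mul, integral_const_mul, integral_finsetSum]
    · congr 2
      refine Finset.sum_congr rfl fun r _ => ?_
      rw [integral_finsetSum _ fun j _ => (hi3 r j).const_mul _]
      exact Finset.sum_congr rfl fun j _ => (integral_const_mul _ _).symm
    · exact fun r _ => integrable_finsetSum _ fun j _ => (hi3 r j).const_mul _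
    · exact (integrable_finsetSum _ fun r _ => integrable_finsetSum _ fun j _ =>
        (hi3 r j).const_mul _).const_mul _
    · exact ((hAi.sub (integrable_const _)).abs).const_mul _
  rw [e2]
  refine norm_integral_le_of_norm_le ?_ (ae_of_all _ fun ω => ?_)
  · exact ((integrable_finsetSum _ fun r _ => integrable_finsetSum _ fun j _ =>
        (hi3 r j).const_mul _).const_mul _).add
      (((hAi.sub (integrable_const _)).abs).const_mul _)
  set s : ρ × Fin (N ℓ) → ℝ := fun k => Real.sqrt (CW / N ℓ) * u k.1 k.2 ω with hs
  have hgauss : ∀ r, charFun (gaussianReal 0 Cb) (c r)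
      = (Real.exp (-(Cb * c r ^ 2 / 2)) : ℝ) := by
    intro r
    rw [charFun_gaussianReal]
    push_cast
    congr 1
    ring
  -- the Gaussian product is the exponential of the conditional variance
  have hprod : (∏ k, ((Real.exp (-(s k ^ 2 / 2)) : ℝ) : ℂ))
      * ∏ r, charFun (gaussianReal 0 Cb) (c r)
      = (Real.exp (-(1 / 2 * conditionalVariance N CW Cb ℓ u c ω)) : ℝ) := by
    simp_rw [hgauss]
    rw [← Complex.ofReal_prod, ← Complex.ofReal_prod, ← Complex.ofReal_mul, ← Real.exp_sum,
      ← Real.exp_sum, ← Real.exp_add]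
    congr 2
    rw [Fintype.sum_prod_type, ← Finset.sum_add_distrib, conditionalVariance, Finset.mul_sum,
      ← Finset.sum_neg_distrib]
    refine Finset.sum_congr rfl fun r _ => ?_
    rw [Finset.mul_sum, Finset.mul_sum, mul_add, Finset.mul_sum, neg_add, add_comm,
      ← Finset.sum_neg_distrib]
    congr 1
    · ring
    · refine Finset.sum_congr rfl fun j _ => ?_
      simp only [hs, mul_pow, Real.sq_sqrt (div_nonneg hCW (Nat.cast_nonneg (N ℓ)))]
      ring
  -- the weights are replaced by Gaussian ones one at a time
  have hstep : ‖(∏ k, charFun μ (s k)) * ∏ r, charFun (gaussianReal 0 Cb) (c r)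
      - (∏ k, ((Real.exp (-(s k ^ 2 / 2)) : ℝ) : ℂ)) * ∏ r, charFun (gaussianReal 0 Cb) (c r)‖
      ≤ C * ∑ r, ∑ j, Real.sqrt (CW / N ℓ) ^ 3 * |u r j ω| ^ 3 := by
    rw [← sub_mul, norm_mul]
    have h1 : ‖∏ r, charFun (gaussianReal 0 Cb) (c r)‖ ≤ 1 := by
      rw [norm_prod]
      exact Finset.prod_le_one (fun _ _ => norm_nonneg _) fun _ _ => norm_charFun_le_one _
    refine (mul_le_of_le_one_right (norm_nonneg _) h1).trans ?_
    refine (norm_prod_sub_prod_le _ _ _ (fun _ _ => norm_charFun_le_one _) fun k _ => ?_).trans ?_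
    · rw [Complex.norm_real, Real.norm_of_nonneg (Real.exp_pos _).le, Real.exp_le_one_iff]
      have := sq_nonneg (s k)
      linarith
    · rw [Finset.mul_sum, Fintype.sum_prod_type]
      refine Finset.sum_le_sum fun r _ => ?_
      rw [Finset.mul_sum]
      refine Finset.sum_le_sum fun j _ => (hC _).trans (le_of_eq ?_)
      rw [hs, abs_mul, mul_pow, abs_of_nonneg (Real.sqrt_nonneg _)]
  refine (norm_sub_le_norm_sub_add_norm_sub _ _ _).trans (add_le_add hstep ?_)
  rw [hprod, ← Complex.ofReal_sub, Complex.norm_real, Real.norm_eq_abs]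
  have hA0 : 0 ≤ conditionalVariance N CW Cb ℓ u c ω :=
    Finset.sum_nonneg fun r _ => by positivity
  rw [neg_mul]
  refine (abs_exp_neg_sub_exp_neg_le (by positivity) (by positivity)).trans (le_of_eq ?_)
  rw [← mul_sub, abs_mul, abs_of_nonneg (by norm_num : (0 : ℝ) ≤ 1 / 2)]

/-- The moments of one layer are controlled by those of the previous one. The coefficient `c` of
the bias is `1` for the values of a neuron, and `0` for their increments, in which the bias
cancels. -/
theorem eLpNorm_next_sq_le (h : IsMeasurableInit P L N μ Cb What b) (hCW : 0 ≤ CW)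
    (hμ : ∀ q : ℕ, MemLp id q μ) (hμ0 : ∫ w, w ∂μ = 0) (p : ℕ) {M : ℝ} (hM1 : 1 ≤ M)
    (hMμ : ∀ q ≤ 2 * p + 2, ∫ w, |w| ^ q ∂μ ≤ M)
    (hMb : ∀ q ≤ 2 * p + 2, ∫ w, |w| ^ q ∂(gaussianReal 0 Cb) ≤ M)
    {ℓ : ℕ} (hℓ : ℓ ≤ L) (hN : N ℓ ≠ 0) (i : Fin (N (ℓ + 1))) {u : Fin (N ℓ) → Ω → ℝ}
    (hu : ∀ j, Measurable[layerSigma L What b ℓ] (u j)) {B : ENNReal}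
    (hB : ∀ j, eLpNorm (u j) (2 * (p + 1) : ℕ) P ≤ B) (c : ℝ) :
    eLpNorm (fun ω => c * b ω ℓ i + ∑ j, Real.sqrt (CW / N ℓ) * u j ω * What ω ℓ i j)
        (2 * (p + 1) : ℕ) P ^ 2
      ≤ ENNReal.ofReal (4 ^ (p + 1) * M) * (ENNReal.ofReal CW * B ^ 2 + ‖c‖ₑ ^ 2) := by
  let idx : Unit → Fin (N (ℓ + 1)) := fun _ => i
  let s := nextCoefficient N CW ℓ (fun _ => u) (fun _ : Unit => c)
  let V := nextParameter What b ℓ idx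
  have hs : ∀ k, Measurable[layerSigma L What b ℓ] (s k) :=
    measurable_nextCoefficient_layerSigma (fun _ => hu) _
  have hVm : ∀ k, Measurable (V k) := h.measurable_nextParameter hℓ idx
  have hlaw : ∀ k, P.map (V k) = μ ∨ P.map (V k) = gaussianReal 0 Cb := by
    rintro (k | r)
    · exact Or.inl (h.map_nextParameter_inl hℓ idx k)
    · exact Or.inr (h.map_nextParameter_inr hℓ idx r)
  have hVL : ∀ k, ∀ q : ℕ, MemLp (V k) q P := by
    intro k q
    refine (memLp_map_measure_iff aestronglyMeasurable_id (hVm k).aemeasurable).1 ?_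
    rcases hlaw k with e | e <;> rw [e]
    · exact hμ q
    · exact memLp_id_gaussianReal q
  have hV0 : ∀ k, ∫ ω, V k ω ∂P = 0 := by
    intro k
    rw [← integral_map (f := fun w => w) (hVm k).aemeasurable (by fun_prop)]
    rcases hlaw k with e | e <;> rw [e]
    · exact hμ0
    · exact integral_id_gaussianReal
  have hVM : ∀ k, ∀ q ≤ 2 * p + 2, ∫ ω, |V k ω| ^ q ∂P ≤ M := by
    intro k q hq
    rw [← integral_map (f := fun w => |w| ^ q) (hVm k).aemeasurable (by fun_prop)]
    rcases hlaw k with e | e <;> rw [e]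
    · exact hMμ q hq
    · exact hMb q hq
  have h1 := eLpNorm_sum_mul_sq_le hVm hVL
    (h.iIndepFun_nextParameter hℓ (Function.injective_of_subsingleton idx)) hV0 p hM1 hVM
    (fun k => (hs k).mono (h.layerSigma_le ℓ) le_rfl) (h.indepFun_nextParameter hℓ idx hs)
  have e1 : (fun ω => c * b ω ℓ i + ∑ j, Real.sqrt (CW / N ℓ) * u j ω * What ω ℓ i j)
      = fun ω => ∑ k, s k ω * V k ω := by
    ext ω
    rw [sum_nextCoefficient_mul idx (fun _ => u)]
    simp [idx]
  rw [e1]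
  refine h1.trans ?_
  gcongr
  rw [Fintype.sum_sum_type, Fintype.sum_prod_type]
  simp only [Finset.univ_unique, Finset.sum_singleton]
  have hq : ((2 * (p + 1) : ℕ) : ENNReal) ≠ 0 := by exact_mod_cast (by omega : 2 * (p + 1) ≠ 0)
  refine add_le_add ?_ (le_of_eq ?_)
  · have h2 : ∀ j, eLpNorm (s (Sum.inl ((), j))) (2 * (p + 1) : ℕ) P ^ 2
        ≤ ENNReal.ofReal (CW / N ℓ) * B ^ 2 := by
      intro j
      have e3 : s (Sum.inl ((), j)) = Real.sqrt (CW / N ℓ) • u j := rfl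
      rw [e3, eLpNorm_const_smul, mul_pow]
      refine mul_le_mul' (le_of_eq ?_) (pow_le_pow_left' (hB j) 2)
      rw [← ofReal_norm, ← ENNReal.ofReal_pow (norm_nonneg _), Real.norm_eq_abs, sq_abs,
        Real.sq_sqrt (by positivity)]
    refine (Finset.sum_le_sum fun j _ => h2 j).trans (le_of_eq ?_)
    rw [Finset.sum_const, Finset.card_univ, Fintype.card_fin, nsmul_eq_mul, ← mul_assoc]
    congr 1
    rw [← ENNReal.ofReal_natCast, ← ENNReal.ofReal_mul (Nat.cast_nonneg _)]
    congr 1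
    have : (N ℓ : ℝ) ≠ 0 := by exact_mod_cast hN
    field_simp
  · have e3 : s (Sum.inr default) = fun _ => c := rfl
    rw [e3, eLpNorm_const _ hq (IsProbabilityMeasure.ne_zero P)]
    simp

end IsMeasurableInit

end Network

/-! ### Uniform moment bounds -/

section MomentBounds

variable {ι : Type*} {Ω : ι → Type*} [∀ i, MeasurableSpace (Ω i)] {P : ∀ i, Measure (Ω i)} {d : ℕ}

/-- Bounds, uniform in the index `i` and for `x`, `y` in a bounded set, for all moments of the
random fields `X i` and of their increments. Bounded sets are described by bounds for the coordinates,
as for the cubes in the chaining argument. -/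
structure HasMomentBounds (P : ∀ i, Measure (Ω i))
    (X : ∀ i, EuclideanSpace ℝ (Fin d) → Ω i → ℝ) : Prop where
  value : ∀ q R : ℕ, ∃ C : ℝ≥0, ∀ i x, (∀ a, |x a| ≤ (R : ℝ)) → eLpNorm (X i x) q (P i) ≤ C
  increment : ∀ q R : ℕ, ∃ C : ℝ≥0, ∀ i x y, (∀ a, |x a| ≤ (R : ℝ)) → (∀ a, |y a| ≤ (R : ℝ)) →
    eLpNorm (fun ω => X i x ω - X i y ω) q (P i) ≤ C * ‖x - y‖ₑ

theorem eLpNorm_abs_pow_le {Ω : Type*} [MeasurableSpace Ω] {P : Measure Ω}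
    [IsProbabilityMeasure P] (f : Ω → ℝ) (k : ℕ) {q : ℕ} (hq : q ≠ 0) :
    eLpNorm (fun ω => |f ω| ^ k) q P ≤ 1 + eLpNorm f (k * q : ℕ) P ^ k := by
  rcases Nat.eq_zero_or_pos k with rfl | hk
  · simp only [pow_zero]
    rw [eLpNorm_const _ (by exact_mod_cast hq) (IsProbabilityMeasure.ne_zero P)]
    simp
  · rw [eLpNorm_fun_pow (fun ω => |f ω|) hk.ne' hq]
    refine le_add_left (le_of_eq ?_)
    congr 1
    exact eLpNorm_norm f

variable [∀ i, IsProbabilityMeasure (P i)] {X : ∀ i, EuclideanSpace ℝ (Fin d) → Ω i → ℝ}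

theorem HasMomentBounds.exists_eLpNorm_one_add_pow_le (h : HasMomentBounds P X)
    (hX : ∀ i x, Measurable (X i x)) (k : ℕ) {q : ℕ} (hq : q ≠ 0) (R : ℕ) :
    ∃ C : ℝ≥0, ∀ i x y, (∀ a, |x a| ≤ (R : ℝ)) → (∀ a, |y a| ≤ (R : ℝ)) →
      eLpNorm (fun ω => 1 + |X i x ω| ^ k + |X i y ω| ^ k) q (P i) ≤ C := by
  obtain ⟨C, hC⟩ := h.value (k * q) R
  refine ⟨1 + (1 + C ^ k) + (1 + C ^ k), fun i x y hx hy => ?_⟩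
  have hq1 : (1 : ENNReal) ≤ q := by exact_mod_cast Nat.one_le_iff_ne_zero.2 hq
  have hm : ∀ x, AEStronglyMeasurable (fun ω => |X i x ω| ^ k) (P i) := fun x =>
    ((hX i x).abs.pow_const k).aestronglyMeasurable
  have h1 : eLpNorm (fun _ : Ω i => (1 : ℝ)) q (P i) ≤ 1 := by
    rw [eLpNorm_const _ (by exact_mod_cast hq) (IsProbabilityMeasure.ne_zero (P i))]
    simp
  have h2 : ∀ x : EuclideanSpace ℝ (Fin d), (∀ a, |x a| ≤ (R : ℝ)) →
      eLpNorm (fun ω => |X i x ω| ^ k) q (P i) ≤ 1 + (C : ENNReal) ^ k := fun x hx =>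
    (eLpNorm_abs_pow_le _ k hq).trans (by gcongr; exact hC i x hx)
  refine (eLpNorm_add_le (f := fun ω => 1 + |X i x ω| ^ k) (aestronglyMeasurable_const.add (hm x))
    (hm y) hq1).trans ?_
  push_cast
  refine add_le_add ?_ (h2 y hy)
  refine (eLpNorm_add_le (f := fun _ => (1 : ℝ)) aestronglyMeasurable_const (hm x) hq1).trans ?_
  exact add_le_add h1 (h2 x hx)

/-- A non-linearity with Lipschitz constants of polynomial growth preserves moment bounds. The
increments are estimated by Hölder's inequality, at the price of twice the exponent. -/
theorem HasMomentBounds.comp {σ : ℝ → ℝ} (hσm : Measurable σ) {C : ℝ≥0} {k : ℕ}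
    (hσ : ∀ u v, |σ u - σ v| ≤ C * (1 + |u| ^ k + |v| ^ k) * |u - v|)
    (h : HasMomentBounds P X) (hX : ∀ i x, Measurable (X i x)) :
    HasMomentBounds P fun i x ω => σ (X i x ω) where
  value q R := by
    obtain ⟨C', k', hσ'⟩ := exists_polynomial_growth hσ
    obtain ⟨D, hD⟩ := h.exists_eLpNorm_one_add_pow_le hX k' (q := q + 1) (by omega) R
    refine ⟨C' * D, fun i x hx => ?_⟩
    refine (eLpNorm_le_eLpNorm_of_exponent_le (q := (q + 1 : ℕ)) (by exact_mod_cast Nat.le_succ q)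
      (hσm.comp (hX i x)).aestronglyMeasurable).trans ?_
    have h1 : eLpNorm (fun ω => σ (X i x ω)) (q + 1 : ℕ) (P i) ≤
        eLpNorm ((C' : ℝ) • fun ω => 1 + |X i x ω| ^ k' + |X i x ω| ^ k') (q + 1 : ℕ) (P i) := by
      refine eLpNorm_mono_real fun ω => (hσ' _).trans ?_
      simp only [Pi.smul_apply, smul_eq_mul]
      gcongr
      have : 0 ≤ |X i x ω| ^ k' := by positivity
      linarith
    refine h1.trans ?_
    rw [eLpNorm_const_smul]
    rw [ENNReal.coe_mul]
    exact mul_le_mul' (le_of_eq (by simp)) (hD i x x hx hx)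
  increment q R := by
    obtain ⟨D, hD⟩ := h.exists_eLpNorm_one_add_pow_le hX k (q := 2 * (q + 1)) (by omega) R
    obtain ⟨D', hD'⟩ := h.increment (2 * (q + 1)) R
    refine ⟨C * D * D', fun i x y hx hy => ?_⟩
    have hm := (hσm.comp (hX i x)).sub (hσm.comp (hX i y))
    refine (eLpNorm_le_eLpNorm_of_exponent_le (q := (q + 1 : ℕ)) (by exact_mod_cast Nat.le_succ q)
      hm.aestronglyMeasurable).trans ?_
    have h1 : eLpNorm (fun ω => σ (X i x ω) - σ (X i y ω)) (q + 1 : ℕ) (P i) ≤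
        eLpNorm ((C : ℝ) • ((fun ω => 1 + |X i x ω| ^ k + |X i y ω| ^ k)
          • fun ω => X i x ω - X i y ω)) (q + 1 : ℕ) (P i) := by
      refine eLpNorm_mono fun ω => ?_
      change |_| ≤ |(C : ℝ) * ((1 + |X i x ω| ^ k + |X i y ω| ^ k) * (X i x ω - X i y ω))|
      rw [abs_mul, abs_mul, NNReal.abs_eq,
        abs_of_nonneg (by positivity : 0 ≤ 1 + |X i x ω| ^ k + |X i y ω| ^ k), ← mul_assoc]
      exact hσ _ _
    refine h1.trans ?_
    have : ENNReal.HolderTriple (2 * (q + 1) : ℕ) (2 * (q + 1) : ℕ) (q + 1 : ℕ) := by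
      constructor
      rw [Nat.cast_mul, ENNReal.mul_inv (by simp) (by simp), ← add_mul]
      simp [ENNReal.inv_two_add_inv_two]
    rw [eLpNorm_const_smul, ENNReal.coe_mul, ENNReal.coe_mul, mul_assoc, mul_assoc]
    refine mul_le_mul' (le_of_eq (by simp)) ?_
    refine (eLpNorm_smul_le_mul_eLpNorm (p := (2 * (q + 1) : ℕ)) (q := (2 * (q + 1) : ℕ))
      ((hX i x).sub (hX i y)).aestronglyMeasurable
      ((((hX i x).abs.pow_const k).const_add 1).add
        ((hX i y).abs.pow_const k)).aestronglyMeasurable).trans ?_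
    exact mul_le_mul' (hD i x y hx hy) (hD' i x y hx hy)

end MomentBounds

/-! ### Moment bounds for all layers -/

section NetworkFamily

variable {L n₀ nOut : ℕ} {σ : ℝ → ℝ} {CW : ℝ} {μ : Measure ℝ} {Cb : ℝ≥0}
  {Ω : (Fin L → ℕ+) → Type*} [∀ n, MeasurableSpace (Ω n)] {P : ∀ n, Measure (Ω n)}
  [∀ n, IsProbabilityMeasure (P n)]
  {What : ∀ n, Ω n → ∀ ℓ,
    Matrix (Fin (layerWidth n₀ nOut n (ℓ + 1))) (Fin (layerWidth n₀ nOut n ℓ)) ℝ}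
  {b : ∀ n, Ω n → ∀ ℓ, Fin (layerWidth n₀ nOut n (ℓ + 1)) → ℝ}

theorem layerWidth_ne_zero (hn₀ : 1 ≤ n₀) (n : Fin L → ℕ+) {ℓ : ℕ} (hℓ : ℓ ≤ L) :
    layerWidth n₀ nOut n ℓ ≠ 0 := by
  cases ℓ with
  | zero => exact Nat.one_le_iff_ne_zero.1 hn₀
  | succ ℓ =>
    have : ℓ < L := hℓ
    simp [layerWidth, this]

theorem tendsto_layerWidth {ℓ : ℕ} (hℓ1 : 1 ≤ ℓ) (hℓ : ℓ ≤ L) :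
    Tendsto (fun n : Fin L → ℕ+ => layerWidth n₀ nOut n ℓ) atTop atTop := by
  obtain ⟨k, rfl⟩ : ∃ k, ℓ = k + 1 := ⟨ℓ - 1, by omega⟩
  have hk : k < L := hℓ
  simp only [layerWidth, hk, dif_pos]
  refine tendsto_atTop.2 fun m => ?_
  filter_upwards [eventually_ge_atTop fun _ : Fin L => (⟨m + 1, m.succ_pos⟩ : ℕ+)] with n hn
  have h1 : ((⟨m + 1, m.succ_pos⟩ : ℕ+) : ℕ) ≤ n ⟨k, hk⟩ := hn ⟨k, hk⟩
  have h2 : ((⟨m + 1, m.succ_pos⟩ : ℕ+) : ℕ) = m + 1 := rfl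
  omega

/-- The activation of neuron `p.2` of layer `ℓ` of the network with hidden widths `p.1`. -/
noncomputable abbrev activationField (σ : ℝ → ℝ) (CW : ℝ)
    (What : ∀ n, Ω n → ∀ ℓ,
      Matrix (Fin (layerWidth n₀ nOut n (ℓ + 1))) (Fin (layerWidth n₀ nOut n ℓ)) ℝ)
    (b : ∀ n, Ω n → ∀ ℓ, Fin (layerWidth n₀ nOut n (ℓ + 1)) → ℝ) (ℓ : ℕ)
    (p : Σ n : Fin L → ℕ+, Fin (layerWidth n₀ nOut n ℓ)) (x : EuclideanSpace ℝ (Fin n₀)) :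
    Ω p.1 → ℝ :=
  randomActivation (N := layerWidth n₀ nOut p.1) σ CW (What p.1) (b p.1) x ℓ p.2

/-- The pre-activation of neuron `p.2` of layer `ℓ` of the network with hidden widths `p.1`. -/
noncomputable abbrev preactivationField (σ : ℝ → ℝ) (CW : ℝ)
    (What : ∀ n, Ω n → ∀ ℓ,
      Matrix (Fin (layerWidth n₀ nOut n (ℓ + 1))) (Fin (layerWidth n₀ nOut n ℓ)) ℝ)
    (b : ∀ n, Ω n → ∀ ℓ, Fin (layerWidth n₀ nOut n (ℓ + 1)) → ℝ) (ℓ : ℕ)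
    (p : Σ n : Fin L → ℕ+, Fin (layerWidth n₀ nOut n ℓ)) (x : EuclideanSpace ℝ (Fin n₀)) :
    Ω p.1 → ℝ :=
  randomPreactivation (N := layerWidth n₀ nOut p.1) σ CW (What p.1) (b p.1) x ℓ p.2

theorem hasMomentBounds_activationField_zero :
    HasMomentBounds (fun p => P p.1) (activationField σ CW What b 0) where
  value q R := by
    refine ⟨R, fun p x hx => ?_⟩
    have h1 : activationField σ CW What b 0 p x = fun _ => x p.2 := rfl
    rw [h1]
    refine (eLpNorm_le_eLpNorm_of_exponent_le (le_top) aestronglyMeasurable_const).trans ?_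
    rw [eLpNorm_const _ (by simp) (IsProbabilityMeasure.ne_zero _)]
    simp only [measure_univ, ENNReal.one_rpow, mul_one]
    rw [← ofReal_norm, Real.norm_eq_abs]
    refine (ENNReal.ofReal_le_ofReal (hx _)).trans (by simp)
  increment q R := by
    refine ⟨1, fun p x y _ _ => ?_⟩
    have h1 : (fun ω => activationField σ CW What b 0 p x ω - activationField σ CW What b 0 p y ω)
      = fun _ => (x - y) p.2 := rfl
    rw [h1]
    refine (eLpNorm_le_eLpNorm_of_exponent_le (le_top) aestronglyMeasurable_const).trans ?_
    rw [eLpNorm_const _ (by simp) (IsProbabilityMeasure.ne_zero _)]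
    simp only [measure_univ, ENNReal.one_rpow, mul_one, ENNReal.coe_one, one_mul]
    exact enorm_le_iff_norm_le.2 (PiLp.norm_apply_le _ _)

variable (h : ∀ n, IsMeasurableInit (P n) L (layerWidth n₀ nOut n) μ Cb (What n) (b n))
include h

theorem hasMomentBounds_preactivationField_succ (hσ : Measurable σ) (hn₀ : 1 ≤ n₀) (hCW : 0 ≤ CW)
    (hμ : ∀ q : ℕ, MemLp id q μ) (hμ0 : ∫ w, w ∂μ = 0) {ℓ : ℕ} (hℓ : ℓ ≤ L)
    (hact : HasMomentBounds (fun p => P p.1) (activationField σ CW What b ℓ)) :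
    HasMomentBounds (fun p => P p.1) (preactivationField σ CW What b (ℓ + 1)) := by
  have hM : ∀ p : ℕ, ∃ M : ℝ, 1 ≤ M ∧ (∀ q ≤ 2 * p + 2, ∫ w, |w| ^ q ∂μ ≤ M) ∧
      ∀ q ≤ 2 * p + 2, ∫ w, |w| ^ q ∂(gaussianReal 0 Cb) ≤ M := by
    intro p
    have h0 : ∀ q ∈ Finset.range (2 * p + 3),
        0 ≤ ∫ w, |w| ^ q ∂μ + ∫ w, |w| ^ q ∂(gaussianReal 0 Cb) := fun q _ =>
      add_nonneg (integral_nonneg fun w => by positivity) (integral_nonneg fun w => by positivity)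
    refine ⟨1 + ∑ q ∈ Finset.range (2 * p + 3),
      (∫ w, |w| ^ q ∂μ + ∫ w, |w| ^ q ∂(gaussianReal 0 Cb)), ?_, fun q hq => ?_, fun q hq => ?_⟩
    · linarith [Finset.sum_nonneg h0]
    all_goals
      have h1 := Finset.single_le_sum h0 (Finset.mem_range.2 (by omega : q < 2 * p + 3))
      have h2 : 0 ≤ ∫ w, |w| ^ q ∂μ := integral_nonneg fun w => by positivity
      have h3 : 0 ≤ ∫ w, |w| ^ q ∂(gaussianReal 0 Cb) := integral_nonneg fun w => by positivity
      linarith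
  have hle : ∀ q : ℕ, (q : ENNReal) ≤ (2 * (q + 1) : ℕ) := fun q => by
    exact_mod_cast (by omega : q ≤ 2 * (q + 1))
  have hpm : ∀ n x i, Measurable (randomPreactivation (N := layerWidth n₀ nOut n) σ CW (What n)
      (b n) x (ℓ + 1) i) := fun n x i =>
    (h n).measurable_randomPreactivation hσ x (by omega) i
  have ham : ∀ n x j, Measurable[layerSigma L (What n) (b n) ℓ] (randomActivation
      (N := layerWidth n₀ nOut n) σ CW (What n) (b n) x ℓ j) := fun n x j =>
    measurable_randomActivation_layerSigma hσ x ℓ (by omega) j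
  constructor
  · intro q R
    obtain ⟨M, hM1, hMμ, hMb⟩ := hM q
    obtain ⟨C, hC⟩ := hact.value (2 * (q + 1)) R
    refine ⟨NNReal.sqrt ((4 ^ (q + 1) * M).toNNReal * (CW.toNNReal * C ^ 2 + 1)),
      fun p x hx => ?_⟩
    refine (eLpNorm_le_eLpNorm_of_exponent_le (hle q) (hpm _ _ _).aestronglyMeasurable).trans ?_
    refine (ENNReal.pow_right_strictMono two_ne_zero).le_iff_le.1 ?_
    have h1 := (h p.1).eLpNorm_next_sq_le hCW hμ hμ0 q hM1 hMμ hMb hℓ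
      (layerWidth_ne_zero hn₀ p.1 hℓ) p.2 (ham p.1 x) (B := C) (fun j => hC ⟨p.1, j⟩ x hx) 1
    have e1 : preactivationField σ CW What b (ℓ + 1) p x = fun ω => 1 * b p.1 ω ℓ p.2 +
        ∑ j, Real.sqrt (CW / (layerWidth n₀ nOut p.1 ℓ : ℕ)) * randomActivation
          (N := layerWidth n₀ nOut p.1) σ CW (What p.1) (b p.1) x ℓ j ω * What p.1 ω ℓ p.2 j := by
      ext ω
      refine (randomPreactivation_succ (N := layerWidth n₀ nOut p.1) x ℓ p.2 ω).trans ?_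
      rw [one_mul]
      congr 1
      exact Finset.sum_congr rfl fun j _ => mul_comm _ _
    refine (le_of_eq (congrArg (fun f => eLpNorm f _ _ ^ 2) e1)).trans (h1.trans (le_of_eq ?_))
    rw [← ENNReal.coe_pow (NNReal.sqrt _), NNReal.sq_sqrt]
    simp [ENNReal.ofReal]
  · intro q R
    obtain ⟨M, hM1, hMμ, hMb⟩ := hM q
    obtain ⟨C, hC⟩ := hact.increment (2 * (q + 1)) R
    refine ⟨NNReal.sqrt ((4 ^ (q + 1) * M).toNNReal * (CW.toNNReal * C ^ 2)),
      fun p x y hx hy => ?_⟩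
    refine (eLpNorm_le_eLpNorm_of_exponent_le (hle q)
      ((hpm _ _ _).sub (hpm _ _ _)).aestronglyMeasurable).trans ?_
    refine (ENNReal.pow_right_strictMono two_ne_zero).le_iff_le.1 ?_
    have h1 := (h p.1).eLpNorm_next_sq_le hCW hμ hμ0 q hM1 hMμ hMb hℓ
      (layerWidth_ne_zero hn₀ p.1 hℓ) p.2 (fun j => (ham p.1 x j).sub (ham p.1 y j))
      (B := C * ‖x - y‖ₑ) (fun j => hC ⟨p.1, j⟩ x y hx hy) 0
    have e1 : (fun ω => preactivationField σ CW What b (ℓ + 1) p x ω -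
        preactivationField σ CW What b (ℓ + 1) p y ω) = fun ω => 0 * b p.1 ω ℓ p.2 +
        ∑ j, Real.sqrt (CW / (layerWidth n₀ nOut p.1 ℓ : ℕ)) * (randomActivation
          (N := layerWidth n₀ nOut p.1) σ CW (What p.1) (b p.1) x ℓ j ω - randomActivation
          (N := layerWidth n₀ nOut p.1) σ CW (What p.1) (b p.1) y ℓ j ω) * What p.1 ω ℓ p.2 j := by
      ext ω
      unfold preactivationField
      rw [randomPreactivation_succ (N := layerWidth n₀ nOut p.1) x ℓ p.2 ω,
        randomPreactivation_succ (N := layerWidth n₀ nOut p.1) y ℓ p.2 ω, add_sub_add_left_eq_sub,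
        ← Finset.sum_sub_distrib, zero_mul, zero_add]
      exact Finset.sum_congr rfl fun j _ => by ring
    refine (le_of_eq (congrArg (fun f => eLpNorm f _ _ ^ 2) e1)).trans (h1.trans (le_of_eq ?_))
    simp only [mul_pow]
    rw [← ENNReal.coe_pow (NNReal.sqrt _), NNReal.sq_sqrt]
    simp [ENNReal.ofReal, mul_assoc]

/-- All layers satisfy moment bounds, the input as a layer of deterministic activations. -/
theorem hasMomentBounds_fields (hσ : Measurable σ) {C : ℝ≥0} {k : ℕ}
    (hσ' : ∀ u v, |σ u - σ v| ≤ C * (1 + |u| ^ k + |v| ^ k) * |u - v|) (hn₀ : 1 ≤ n₀)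
    (hCW : 0 ≤ CW) (hμ : ∀ q : ℕ, MemLp id q μ) (hμ0 : ∫ w, w ∂μ = 0) :
    ∀ {ℓ : ℕ}, ℓ ≤ L → HasMomentBounds (fun p => P p.1) (activationField σ CW What b ℓ) ∧
      HasMomentBounds (fun p => P p.1) (preactivationField σ CW What b (ℓ + 1))
  | 0, hℓ => ⟨hasMomentBounds_activationField_zero,
      hasMomentBounds_preactivationField_succ h hσ hn₀ hCW hμ hμ0 hℓ
        hasMomentBounds_activationField_zero⟩
  | ℓ + 1, hℓ => by
    have h1 : HasMomentBounds (fun p => P p.1) (activationField σ CW What b (ℓ + 1)) :=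
      HasMomentBounds.comp hσ hσ' (hasMomentBounds_fields hσ hσ' hn₀ hCW hμ hμ0
        (Nat.le_of_succ_le hℓ)).2 fun p x =>
          (h p.1).measurable_randomPreactivation hσ x (by omega) p.2
    exact ⟨h1, hasMomentBounds_preactivationField_succ h hσ hn₀ hCW hμ hμ0 hℓ h1⟩

end NetworkFamily

/-! ### The central limit theorem for one layer -/

theorem integral_abs_pow_le_of_eLpNorm_le {Ω : Type*} [MeasurableSpace Ω] {P : Measure Ω}
    {f : Ω → ℝ} (hf : AEStronglyMeasurable f P) {q : ℕ} (hq : q ≠ 0) {D : ℝ≥0}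
    (h : eLpNorm f q P ≤ D) : ∫ ω, |f ω| ^ q ∂P ≤ (D : ℝ) ^ q := by
  have h1 : ∫⁻ ω, ENNReal.ofReal (|f ω| ^ q) ∂P ≤ (D : ENNReal) ^ q := by
    refine le_trans (le_of_eq ?_) (pow_le_pow_left' h q)
    rw [eLpNorm_natCast_pow _ hq]
    refine lintegral_congr fun ω => ?_
    rw [ENNReal.ofReal_pow (abs_nonneg _), ← Real.norm_eq_abs, ofReal_norm]
  have hm : AEStronglyMeasurable (fun ω => |f ω| ^ q) P :=
    (continuous_abs.comp_aestronglyMeasurable hf).pow q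
  rw [integral_eq_lintegral_of_nonneg_ae (ae_of_all _ fun ω => by positivity) hm]
  refine ENNReal.toReal_le_of_le_ofReal (by positivity) (h1.trans (le_of_eq ?_))
  rw [ENNReal.ofReal_pow (by positivity), ENNReal.ofReal_coe_nnreal]

theorem exists_nat_abs_apply_le {α : Type*} [Fintype α] {d : ℕ}
    (x : α → EuclideanSpace ℝ (Fin d)) : ∃ R : ℕ, ∀ a i, |x a i| ≤ (R : ℝ) := by
  obtain ⟨R, hR⟩ := exists_nat_ge (∑ a, ‖x a‖)
  refine ⟨R, fun a i => ?_⟩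
  refine ((PiLp.norm_apply_le (x a) i).trans ?_).trans hR
  exact Finset.single_le_sum (f := fun a => ‖x a‖) (fun a _ => norm_nonneg _) (Finset.mem_univ a)

section NetworkFamily

variable {L n₀ nOut : ℕ} {σ : ℝ → ℝ} {CW : ℝ} {μ : Measure ℝ} {Cb : ℝ≥0}
  {Ω : (Fin L → ℕ+) → Type*} [∀ n, MeasurableSpace (Ω n)] {P : ∀ n, Measure (Ω n)}
  {What : ∀ n, Ω n → ∀ ℓ,
    Matrix (Fin (layerWidth n₀ nOut n (ℓ + 1))) (Fin (layerWidth n₀ nOut n ℓ)) ℝ}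
  {b : ∀ n, Ω n → ∀ ℓ, Fin (layerWidth n₀ nOut n (ℓ + 1)) → ℝ}

/-- In the limit of infinite width, the neurons of layer `ℓ` are independent, and the values of
each of them at finitely many inputs `x` have the characteristic function `Ψ x`. The rate of
convergence `δ` is uniform over the choice of distinct neurons `idx r`, which therefore may vary with
the widths. -/
def HasLimitCharFun (P : ∀ n, Measure (Ω n)) (σ : ℝ → ℝ) (CW : ℝ)
    (What : ∀ n, Ω n → ∀ ℓ,
      Matrix (Fin (layerWidth n₀ nOut n (ℓ + 1))) (Fin (layerWidth n₀ nOut n ℓ)) ℝ)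
    (b : ∀ n, Ω n → ∀ ℓ, Fin (layerWidth n₀ nOut n (ℓ + 1)) → ℝ) (ℓ : ℕ)
    (Ψ : ∀ {α : Type} [Fintype α], (α → EuclideanSpace ℝ (Fin n₀)) → (α → ℝ) → ℂ) : Prop :=
  ∀ (ρ α : Type) [Fintype ρ] [Fintype α] (x : α → EuclideanSpace ℝ (Fin n₀)) (t : ρ → α → ℝ),
    ∃ δ : (Fin L → ℕ+) → ℝ, Tendsto δ atTop (𝓝 0) ∧
      ∀ n (idx : ρ → Fin (layerWidth n₀ nOut n ℓ)), Function.Injective idx →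
        ‖∫ ω, Complex.exp ((∑ r, ∑ a, t r a * randomPreactivation (N := layerWidth n₀ nOut n) σ CW
          (What n) (b n) (x a) ℓ (idx r) ω : ℝ) * Complex.I) ∂(P n) - ∏ r, Ψ x (t r)‖ ≤ δ n

/-- The law of large numbers for layer `ℓ`: the average over the neurons of the products of the
activations at two inputs converges to `M` in mean. -/
def HasLimitSecondMoment (P : ∀ n, Measure (Ω n)) (σ : ℝ → ℝ) (CW : ℝ)
    (What : ∀ n, Ω n → ∀ ℓ,
      Matrix (Fin (layerWidth n₀ nOut n (ℓ + 1))) (Fin (layerWidth n₀ nOut n ℓ)) ℝ)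
    (b : ∀ n, Ω n → ∀ ℓ, Fin (layerWidth n₀ nOut n (ℓ + 1)) → ℝ) (ℓ : ℕ)
    (M : EuclideanSpace ℝ (Fin n₀) → EuclideanSpace ℝ (Fin n₀) → ℝ) : Prop :=
  ∀ x y, Tendsto (fun n => ∫ ω, |(layerWidth n₀ nOut n ℓ : ℝ)⁻¹ * ∑ j,
    randomActivation (N := layerWidth n₀ nOut n) σ CW (What n) (b n) x ℓ j ω *
    randomActivation (N := layerWidth n₀ nOut n) σ CW (What n) (b n) y ℓ j ω - M x y| ∂(P n))
    atTop (𝓝 0)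

/-- The joint characteristic function of the values of one neuron of the first layer at the
inputs `x a`. -/
noncomputable def firstLayerCharFun (μ : Measure ℝ) (CW : ℝ) (Cb : ℝ≥0) {n₀ : ℕ} {α : Type}
    [Fintype α] (x : α → EuclideanSpace ℝ (Fin n₀)) (t : α → ℝ) : ℂ :=
  (∏ j : Fin n₀, charFun μ (Real.sqrt (CW / n₀) * ∑ a, t a * x a j))
    * charFun (gaussianReal 0 Cb) (∑ a, t a)

/-- The joint characteristic function of centered Gaussian variables with covariance `K`. -/
noncomputable def gaussianCharFun {E : Type*} (K : E → E → ℝ) {α : Type} [Fintype α] (x : α → E)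
    (t : α → ℝ) : ℂ :=
  (Real.exp (-(1 / 2) * ∑ a, ∑ b, t a * t b * K (x a) (x b)) : ℝ)

variable [∀ n, IsProbabilityMeasure (P n)] [IsProbabilityMeasure μ]
  (h : ∀ n, IsMeasurableInit (P n) L (layerWidth n₀ nOut n) μ Cb (What n) (b n))
include h

/-- At every finite width, the neurons of the first layer are exactly independent. -/
theorem integral_exp_firstLayer {ρ α : Type} [Fintype ρ] [Fintype α]
    (x : α → EuclideanSpace ℝ (Fin n₀)) (t : ρ → α → ℝ) (n : Fin L → ℕ+)
    {idx : ρ → Fin (layerWidth n₀ nOut n 1)} (hidx : Function.Injective idx) :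
    ∫ ω, Complex.exp ((∑ r, ∑ a, t r a * randomPreactivation (N := layerWidth n₀ nOut n) σ CW
      (What n) (b n) (x a) 1 (idx r) ω : ℝ) * Complex.I) ∂(P n)
      = ∏ r, firstLayerCharFun μ CW Cb x (t r) := by
  simp_rw [sum_mul_randomPreactivation_succ (N := layerWidth n₀ nOut n) (ℓ := 0) idx x t]
  refine ((h n).integral_exp_eq (CW := CW) (ℓ := 0) (Nat.zero_le L) hidx
    (u := fun r j _ => ∑ a, t r a * x a j) (fun _ _ => @measurable_const _ _ _ (_) _) _).trans ?_
  rw [integral_const, Fintype.prod_prod_type, ← Finset.prod_mul_distrib]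
  simp only [probReal_univ, one_smul]
  rfl

theorem hasLimitCharFun_firstLayer : HasLimitCharFun P σ CW What b 1
    (fun {_} _ x t => firstLayerCharFun μ CW Cb x t) := by
  intro ρ α _ _ x t
  refine ⟨fun _ => 0, tendsto_const_nhds, fun n idx hidx => ?_⟩
  rw [integral_exp_firstLayer h x t n hidx, sub_self, norm_zero]

/-- The central limit theorem: given a law of large numbers for the products of the activations
of a layer, the neurons of the next layer become independent Gaussian. -/
theorem HasLimitSecondMoment.hasLimitCharFun_succ (hσ : Measurable σ) (hCW : 0 ≤ CW) {C : ℝ}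
    (hC0 : 0 ≤ C) (hC : ∀ u, ‖charFun μ u - Real.exp (-(u ^ 2 / 2))‖ ≤ C * |u| ^ 3) {ℓ : ℕ}
    (hℓ1 : 1 ≤ ℓ) (hℓ : ℓ ≤ L)
    (hact : HasMomentBounds (fun p => P p.1) (activationField σ CW What b ℓ))
    {M : EuclideanSpace ℝ (Fin n₀) → EuclideanSpace ℝ (Fin n₀) → ℝ}
    (hM : HasLimitSecondMoment P σ CW What b ℓ M) :
    HasLimitCharFun P σ CW What b (ℓ + 1)
      (fun {_} _ x t => gaussianCharFun (fun x y => Cb + CW * M x y) x t) := by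
  intro ρ α _ _ x t
  obtain ⟨R, hR⟩ := exists_nat_abs_apply_le x
  obtain ⟨B, hB⟩ := hact.value 3 R
  let D : ρ → ℝ≥0 := fun r => ∑ a, ‖t r a‖₊ * B
  let act := fun n x j => randomActivation (N := layerWidth n₀ nOut n) σ CW (What n) (b n) x ℓ j
  have hactm : ∀ n x j, Measurable (act n x j) := fun n x j =>
    (h n).measurable_randomActivation hσ x (by omega) j
  let u : ∀ n, ρ → Fin (layerWidth n₀ nOut n ℓ) → Ω n → ℝ :=
    fun n r j ω => ∑ a, t r a * act n (x a) j ω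
  let c : ρ → ℝ := fun r => ∑ a, t r a
  let A : ℝ := ∑ r, ∑ a, ∑ a', t r a * t r a' * (Cb + CW * M (x a) (x a'))
  let err : (Fin L → ℕ+) → α → α → ℝ := fun n a a' =>
    ∫ ω, |(layerWidth n₀ nOut n ℓ : ℝ)⁻¹ * ∑ j, act n (x a) j ω * act n (x a') j ω
      - M (x a) (x a')| ∂(P n)
  let e : (Fin L → ℕ+) → ℝ := fun n => ∑ r, ∑ a, ∑ a', |t r a * t r a'| * CW * err n a a'
  have hum : ∀ n r j, Measurable[layerSigma L (What n) (b n) ℓ] (u n r j) := fun n r j =>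
    Finset.measurable_fun_sum _ fun a _ =>
      (measurable_randomActivation_layerSigma hσ (x a) ℓ (by omega) j).const_mul _
  have hact3 : ∀ n a j, MemLp (act n (x a) j) 3 (P n) := fun n a j =>
    ⟨(hactm n (x a) j).aestronglyMeasurable,
      lt_of_le_of_lt (hB ⟨n, j⟩ (x a) (hR a)) ENNReal.coe_lt_top⟩
  have hu3 : ∀ n r j, MemLp (u n r j) 3 (P n) := fun n r j =>
    memLp_finsetSum _ fun a _ => (hact3 n a j).const_mul _
  have huD : ∀ n r j, ∫ ω, |u n r j ω| ^ 3 ∂(P n) ≤ (D r : ℝ) ^ 3 := by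
    intro n r j
    refine integral_abs_pow_le_of_eLpNorm_le (hu3 n r j).1 three_ne_zero ?_
    have h1 := eLpNorm_sum_le (μ := P n) (p := 3) (s := Finset.univ)
      (f := fun a ω => t r a * act n (x a) j ω)
      (fun a _ => ((hactm n (x a) j).const_mul _).aestronglyMeasurable) (by norm_num)
    have e1 : (∑ a, fun ω => t r a * act n (x a) j ω) = u n r j := by
      ext ω; simp [u]
    rw [e1] at h1
    refine h1.trans ?_
    simp only [D]
    push_cast
    refine Finset.sum_le_sum fun a _ => ?_
    have e2 : (fun ω => t r a * act n (x a) j ω) = t r a • act n (x a) j := rfl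
    rw [e2, eLpNorm_const_smul]
    exact mul_le_mul' le_rfl (hB ⟨n, j⟩ (x a) (hR a))
  have hint : ∀ n a a', Integrable (fun ω => (layerWidth n₀ nOut n ℓ : ℝ)⁻¹ *
      ∑ j, act n (x a) j ω * act n (x a') j ω - M (x a) (x a')) (P n) := fun n a a' =>
    ((integrable_finsetSum _ fun j _ => MemLp.integrable_mul
      ((hact3 n a j).mono_exponent (by norm_num) : MemLp _ 2 _)
      ((hact3 n a' j).mono_exponent (by norm_num) : MemLp _ 2 _)).const_mul _).sub
      (integrable_const _)
  have hcv : ∀ n ω, conditionalVariance (layerWidth n₀ nOut n) CW Cb ℓ (u n) c ω - A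
      = ∑ r, ∑ a, ∑ a', t r a * t r a' * CW * ((layerWidth n₀ nOut n ℓ : ℝ)⁻¹ *
        ∑ j, act n (x a) j ω * act n (x a') j ω - M (x a) (x a')) := by
    intro n ω
    simp only [conditionalVariance, A]
    rw [← Finset.sum_sub_distrib]
    refine Finset.sum_congr rfl fun r _ => ?_
    have e1 : c r ^ 2 = ∑ a, ∑ a', t r a * t r a' := by
      simp only [c]
      rw [sq, Finset.sum_mul_sum]
    have e2 : ∑ j, u n r j ω ^ 2
        = ∑ a, ∑ a', t r a * t r a' * ∑ j, act n (x a) j ω * act n (x a') j ω := by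
      simp only [u]
      simp_rw [sq, Finset.sum_mul_sum, Finset.mul_sum]
      rw [Finset.sum_comm]
      refine Finset.sum_congr rfl fun a _ => ?_
      rw [Finset.sum_comm]
      exact Finset.sum_congr rfl fun a' _ => Finset.sum_congr rfl fun j _ => by ring
    rw [e1, e2]
    simp only [Finset.mul_sum, ← Finset.sum_add_distrib, ← Finset.sum_sub_distrib]
    refine Finset.sum_congr rfl fun a _ => Finset.sum_congr rfl fun a' _ => ?_
    rw [mul_sub, Finset.mul_sum, ← Finset.mul_sum (a := CW), mul_add]
    simp only [Finset.mul_sum]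
    have e3 : ∀ j, CW * ((layerWidth n₀ nOut n ℓ : ℝ)⁻¹ * (t r a * t r a' * (act n (x a) j ω *
        act n (x a') j ω))) = t r a * t r a' * CW * ((layerWidth n₀ nOut n ℓ : ℝ)⁻¹ *
          (act n (x a) j ω * act n (x a') j ω)) := fun j => by ring
    simp only [e3]
    ring
  have he : ∀ n, ∫ ω, |conditionalVariance (layerWidth n₀ nOut n) CW Cb ℓ (u n) c ω - A| ∂(P n)
      ≤ e n := by
    intro n
    have hi : ∀ r a a', Integrable (fun ω => |t r a * t r a'| * CW *
        |(layerWidth n₀ nOut n ℓ : ℝ)⁻¹ * ∑ j, act n (x a) j ω * act n (x a') j ω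
          - M (x a) (x a')|) (P n) := fun r a a' => (hint n a a').abs.const_mul _
    have e1 : e n = ∫ ω, ∑ r, ∑ a, ∑ a', |t r a * t r a'| * CW *
        |(layerWidth n₀ nOut n ℓ : ℝ)⁻¹ * ∑ j, act n (x a) j ω * act n (x a') j ω
          - M (x a) (x a')| ∂(P n) := by
      rw [integral_finsetSum _ fun r _ => integrable_finsetSum _ fun a _ =>
        integrable_finsetSum _ fun a' _ => hi r a a']
      refine Finset.sum_congr rfl fun r _ => ?_
      rw [integral_finsetSum _ fun a _ => integrable_finsetSum _ fun a' _ => hi r a a']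
      refine Finset.sum_congr rfl fun a _ => ?_
      rw [integral_finsetSum _ fun a' _ => hi r a a']
      exact Finset.sum_congr rfl fun a' _ => (integral_const_mul _ _).symm
    rw [e1]
    refine integral_mono_of_nonneg (ae_of_all _ fun ω => abs_nonneg _)
      (integrable_finsetSum _ fun r _ => integrable_finsetSum _ fun a _ =>
        integrable_finsetSum _ fun a' _ => hi r a a') (ae_of_all _ fun ω => ?_)
    beta_reduce
    rw [hcv]
    refine (Finset.abs_sum_le_sum_abs _ _).trans (Finset.sum_le_sum fun r _ => ?_)
    refine (Finset.abs_sum_le_sum_abs _ _).trans (Finset.sum_le_sum fun a _ => ?_)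
    refine (Finset.abs_sum_le_sum_abs _ _).trans (Finset.sum_le_sum fun a' _ => ?_)
    rw [abs_mul, abs_mul (t r a * t r a'), abs_of_nonneg hCW]
  have het : Tendsto e atTop (𝓝 0) := by
    have h1 : Tendsto e atTop (𝓝 (∑ r : ρ, ∑ a, ∑ a', |t r a * t r a'| * CW * 0)) :=
      tendsto_finsetSum _ fun r _ => tendsto_finsetSum _ fun a _ =>
        tendsto_finsetSum _ fun a' _ => (hM (x a) (x a')).const_mul _
    simpa using h1
  -- the limiting variance is nonnegative, as a limit of expectations of conditional variances
  have hA : 0 ≤ A := by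
    have h1 : ∀ n, -e n ≤ A := by
      intro n
      have h2 : ∀ ω, 0 ≤ conditionalVariance (layerWidth n₀ nOut n) CW Cb ℓ (u n) c ω := fun ω =>
        Finset.sum_nonneg fun r _ => by positivity
      have h3 : -A ≤ ∫ ω, |conditionalVariance (layerWidth n₀ nOut n) CW Cb ℓ (u n) c ω - A|
          ∂(P n) := by
        have h4 : ∫ _, -A ∂(P n) = -A := by simp
        rw [← h4]
        refine integral_mono (integrable_const _) (Integrable.abs ?_) fun ω => ?_
        · simp_rw [hcv]
          exact integrable_finsetSum _ fun r _ => integrable_finsetSum _ fun a _ =>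
            integrable_finsetSum _ fun a' _ => (hint n a a').const_mul _
        · have := h2 ω
          have := le_abs_self (conditionalVariance (layerWidth n₀ nOut n) CW Cb ℓ (u n) c ω - A)
          beta_reduce
          linarith
      linarith [he n]
    exact le_of_tendsto' (f := fun n => -e n) (by simpa using het.neg) h1
  -- the sum of `N ℓ` third moments, each with a factor `(CW / N ℓ) ^ (3/2)`
  let g : (Fin L → ℕ+) → ℝ := fun n => CW * Real.sqrt (CW / layerWidth n₀ nOut n ℓ)
  have hg : Tendsto g atTop (𝓝 0) := by
    have h1 : Tendsto (fun n : Fin L → ℕ+ => CW / (layerWidth n₀ nOut n ℓ : ℝ)) atTop (𝓝 0) :=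
      tendsto_const_nhds.div_atTop
        (tendsto_natCast_atTop_atTop.comp (tendsto_layerWidth hℓ1 hℓ))
    have h2 := (Real.continuous_sqrt.tendsto 0).comp h1
    rw [Real.sqrt_zero] at h2
    have h3 := h2.const_mul CW
    rwa [mul_zero] at h3
  refine ⟨fun n => C * ∑ r, g n * (D r : ℝ) ^ 3 + 1 / 2 * e n, ?_, fun n idx hidx => ?_⟩
  · have h1 : Tendsto (fun n => C * ∑ r, g n * (D r : ℝ) ^ 3 + 1 / 2 * e n) atTop
        (𝓝 (C * ∑ r, 0 * (D r : ℝ) ^ 3 + 1 / 2 * 0)) :=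
      ((tendsto_finsetSum _ fun r _ => hg.mul_const _).const_mul C).add (het.const_mul _)
    simpa using h1
  · have hprod : ∏ r, gaussianCharFun (fun x y => Cb + CW * M x y) x (t r)
        = (Real.exp (-(1 / 2) * A) : ℝ) := by
      simp only [gaussianCharFun, A]
      rw [← Complex.ofReal_prod, ← Real.exp_sum, Finset.mul_sum]
    rw [hprod]
    simp_rw [sum_mul_randomPreactivation_succ (N := layerWidth n₀ nOut n) idx x t]
    refine ((h n).norm_integral_exp_sub_le hCW hC hℓ hidx (hum n) (hu3 n) c hA).trans ?_
    refine add_le_add (mul_le_mul_of_nonneg_left (Finset.sum_le_sum fun r _ => ?_) hC0)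
      (mul_le_mul_of_nonneg_left (he n) (by norm_num))
    refine (Finset.sum_le_sum fun j _ => mul_le_mul_of_nonneg_left (huD n r j)
      (pow_nonneg (Real.sqrt_nonneg _) 3)).trans ?_
    rw [Finset.sum_const, Finset.card_univ, Fintype.card_fin, nsmul_eq_mul, ← mul_assoc]
    refine mul_le_mul_of_nonneg_right ?_ (by positivity)
    rw [pow_succ, Real.sq_sqrt (by positivity), ← mul_assoc]
    refine mul_le_mul_of_nonneg_right ?_ (Real.sqrt_nonneg _)
    -- in a layer of width zero the sum is empty
    rcases eq_or_ne (layerWidth n₀ nOut n ℓ : ℝ) 0 with h0 | h0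
    · rw [h0]; simpa using hCW
    · rw [mul_div_cancel₀ _ h0]

end NetworkFamily

/-! ### The law of large numbers for one layer -/

/-- Weak law of large numbers for nearly uncorrelated variables. -/
theorem integral_abs_average_le {Ω : Type*} [MeasurableSpace Ω] {P : Measure Ω}
    [IsProbabilityMeasure P] {N : ℕ} (hN : N ≠ 0) {f : Fin N → Ω → ℝ} (hf : ∀ j, MemLp (f j) 2 P)
    {D ε : ℝ} (hε : 0 ≤ ε) (hD : ∀ j, ∫ ω, f j ω ^ 2 ∂P ≤ D)
    (hoff : ∀ i j, i ≠ j → ∫ ω, f i ω * f j ω ∂P ≤ ε) :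
    ∫ ω, |(N : ℝ)⁻¹ * ∑ j, f j ω| ∂P ≤ Real.sqrt (D / N + ε) := by
  have hN' : (0 : ℝ) < N := by exact_mod_cast Nat.pos_of_ne_zero hN
  set X : Ω → ℝ := fun ω => (N : ℝ)⁻¹ * ∑ j, f j ω with hX
  have hXL : MemLp X 2 P := (memLp_finsetSum _ fun j _ => hf j).const_mul _
  have h1 : (∫ ω, |X ω| ∂P) ^ 2 ≤ ∫ ω, X ω ^ 2 ∂P := by
    have h2 := variance_nonneg |X| P
    rw [variance_eq_sub hXL.abs] at h2
    simp only [Pi.pow_apply, Pi.abs_apply, sq_abs] at h2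
    linarith
  refine Real.le_sqrt_of_sq_le (h1.trans ?_)
  have e1 : ∀ ω, X ω ^ 2 = (N : ℝ)⁻¹ ^ 2 * ∑ i, ∑ j, f i ω * f j ω := fun ω => by
    rw [hX, mul_pow, sq (∑ j, f j ω), Finset.sum_mul_sum]
  simp_rw [e1]
  have hi : ∀ i j, Integrable (fun ω => f i ω * f j ω) P := fun i j =>
    MemLp.integrable_mul (hf i) (hf j)
  rw [integral_const_mul, integral_finsetSum _ fun i _ => integrable_finsetSum _ fun j _ => hi i j]
  have h3 : ∀ i, ∫ ω, ∑ j, f i ω * f j ω ∂P ≤ D + N * ε := by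
    intro i
    rw [integral_finsetSum _ fun j _ => hi i j]
    have h4 : ∀ j, ∫ ω, f i ω * f j ω ∂P ≤ (if i = j then D else 0) + ε := by
      intro j
      by_cases hij : i = j
      · subst hij
        have := hD i
        simp only [if_true, ← sq]
        linarith
      · simpa [hij] using hoff i j hij
    refine (Finset.sum_le_sum fun j _ => h4 j).trans (le_of_eq ?_)
    simp [Finset.sum_add_distrib]
  refine (mul_le_mul_of_nonneg_left (Finset.sum_le_sum fun i _ => h3 i) (by positivity)).trans
    (le_of_eq ?_)
  rw [Finset.sum_const, Finset.card_univ, Fintype.card_fin, nsmul_eq_mul]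
  field_simp

theorem eLpNorm_mul_le_mul {Ω : Type*} [MeasurableSpace Ω] {P : Measure Ω} {f g : Ω → ℝ}
    (hf : AEStronglyMeasurable f P) (hg : AEStronglyMeasurable g P) (q : ℕ) :
    eLpNorm (fun ω => f ω * g ω) q P ≤ eLpNorm f (2 * q : ℕ) P * eLpNorm g (2 * q : ℕ) P := by
  have : ENNReal.HolderTriple (2 * q : ℕ) (2 * q : ℕ) (q : ℕ) := by
    constructor
    rw [Nat.cast_mul, ENNReal.mul_inv (by simp) (by simp), ← add_mul]
    simp [ENNReal.inv_two_add_inv_two]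
  have e : (fun ω => f ω * g ω) = f • g := rfl
  rw [e]
  exact eLpNorm_smul_le_mul_eLpNorm (p := (2 * q : ℕ)) (q := (2 * q : ℕ)) (r := (q : ℕ)) hg hf

theorem HasMomentBounds.memLp {ι : Type*} {Ω : ι → Type*} [∀ i, MeasurableSpace (Ω i)]
    {P : ∀ i, Measure (Ω i)} {d : ℕ} {X : ∀ i, EuclideanSpace ℝ (Fin d) → Ω i → ℝ}
    (h : HasMomentBounds P X) (hX : ∀ i x, Measurable (X i x)) (i : ι)
    (x : EuclideanSpace ℝ (Fin d)) (q : ℕ) : MemLp (X i x) q (P i) := by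
  obtain ⟨R, hR⟩ := exists_nat_abs_apply_le fun _ : Unit => x
  obtain ⟨C, hC⟩ := h.value q R
  exact ⟨(hX i x).aestronglyMeasurable, (hC i x (hR ())).trans_lt ENNReal.coe_lt_top⟩

section NetworkFamily

variable {L n₀ nOut : ℕ} {σ : ℝ → ℝ} {CW : ℝ} {μ : Measure ℝ} {Cb : ℝ≥0}
  {Ω : (Fin L → ℕ+) → Type*} [∀ n, MeasurableSpace (Ω n)] {P : ∀ n, Measure (Ω n)}
  {What : ∀ n, Ω n → ∀ ℓ,
    Matrix (Fin (layerWidth n₀ nOut n (ℓ + 1))) (Fin (layerWidth n₀ nOut n ℓ)) ℝ}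
  {b : ∀ n, Ω n → ∀ ℓ, Fin (layerWidth n₀ nOut n (ℓ + 1)) → ℝ}
  [∀ n, IsProbabilityMeasure (P n)]
  (h : ∀ n, IsMeasurableInit (P n) L (layerWidth n₀ nOut n) μ Cb (What n) (b n))
include h

/-- The values of a finite family of neurons at two inputs. -/
noncomputable abbrev neuronPair (σ : ℝ → ℝ) (CW : ℝ)
    (What : ∀ n, Ω n → ∀ ℓ,
      Matrix (Fin (layerWidth n₀ nOut n (ℓ + 1))) (Fin (layerWidth n₀ nOut n ℓ)) ℝ)
    (b : ∀ n, Ω n → ∀ ℓ, Fin (layerWidth n₀ nOut n (ℓ + 1)) → ℝ) (ℓ : ℕ)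
    (x : Fin 2 → EuclideanSpace ℝ (Fin n₀)) {ρ : Type} (n : Fin L → ℕ+)
    (idx : ρ → Fin (layerWidth n₀ nOut n ℓ)) (ω : Ω n) :
    PiLp 2 fun _ : ρ => EuclideanSpace ℝ (Fin 2) :=
  WithLp.toLp 2 fun r => WithLp.toLp 2 fun a =>
    randomPreactivation (N := layerWidth n₀ nOut n) σ CW (What n) (b n) (x a) ℓ (idx r) ω

omit [∀ n, IsProbabilityMeasure (P n)] in
theorem measurable_neuronPair (hσ : Measurable σ) {ℓ : ℕ} (hℓ : ℓ ≤ L + 1)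
    (x : Fin 2 → EuclideanSpace ℝ (Fin n₀)) {ρ : Type} [Fintype ρ] (n : Fin L → ℕ+)
    (idx : ρ → Fin (layerWidth n₀ nOut n ℓ)) :
    Measurable (neuronPair σ CW What b ℓ x n idx) := by
  refine (WithLp.measurable_toLp 2 _).comp (measurable_pi_lambda _ fun r =>
    (WithLp.measurable_toLp 2 _).comp (measurable_pi_lambda _ fun a => ?_))
  exact (h n).measurable_randomPreactivation hσ (x a) hℓ (idx r)

/-- Asymptotic independence of distinct neurons, in the form of the convergence of expectations of
products of functions of the neurons. The filter `comap Sigma.fst atTop` on pairs of widths and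
distinct neurons expresses uniformity in the choice of the neurons. -/
theorem HasLimitCharFun.tendsto_integral_prod (hσ : Measurable σ) {ℓ : ℕ} (hℓ : ℓ ≤ L + 1)
    {Ψ : ∀ {α : Type} [Fintype α], (α → EuclideanSpace ℝ (Fin n₀)) → (α → ℝ) → ℂ}
    (hΨ : HasLimitCharFun P σ CW What b ℓ Ψ) (x : Fin 2 → EuclideanSpace ℝ (Fin n₀))
    {γ : Measure (EuclideanSpace ℝ (Fin 2))} [IsProbabilityMeasure γ]
    (hγ : ∀ t : EuclideanSpace ℝ (Fin 2), charFun γ t = Ψ x t) {ρ : Type} [Fintype ρ]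
    {f : EuclideanSpace ℝ (Fin 2) → ℝ} (hf : Continuous f) (hfγ : MemLp f 2 γ) {C : ℝ≥0}
    (hC : ∀ n (idx : ρ → Fin (layerWidth n₀ nOut n ℓ)), Function.Injective idx →
      eLpNorm (fun ω => ∏ r, f (neuronPair σ CW What b ℓ x n idx ω r)) 2 (P n) ≤ C) :
    Tendsto (fun i : Σ n : Fin L → ℕ+, {idx : ρ → Fin (layerWidth n₀ nOut n ℓ) //
        Function.Injective idx} =>
      ∫ ω, ∏ r, f (neuronPair σ CW What b ℓ x i.1 i.2.1 ω r) ∂(P i.1))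
      (comap Sigma.fst atTop) (𝓝 (∏ _r : ρ, ∫ v, f v ∂γ)) := by
  have hm := fun n (idx : ρ → Fin (layerWidth n₀ nOut n ℓ)) =>
    measurable_neuronPair (CW := CW) h hσ hℓ x n idx
  let ν : (Σ n : Fin L → ℕ+, {idx : ρ → Fin (layerWidth n₀ nOut n ℓ) // Function.Injective idx}) →
      ProbabilityMeasure (PiLp 2 fun _ : ρ => EuclideanSpace ℝ (Fin 2)) := fun i =>
    ⟨(P i.1).map (neuronPair σ CW What b ℓ x i.1 i.2.1),
      Measure.isProbabilityMeasure_map (hm i.1 i.2.1).aemeasurable⟩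
  let ν₀ : ProbabilityMeasure (PiLp 2 fun _ : ρ => EuclideanSpace ℝ (Fin 2)) :=
    ⟨(Measure.pi fun _ : ρ => γ).map (WithLp.toLp 2),
      Measure.isProbabilityMeasure_map (WithLp.measurable_toLp 2 _).aemeasurable⟩
  let g : (PiLp 2 fun _ : ρ => EuclideanSpace ℝ (Fin 2)) → ℝ := fun w => ∏ r, f (w r)
  have hg : Continuous g := by fun_prop
  have hν : Tendsto ν (comap Sigma.fst atTop) (𝓝 ν₀) := by
    refine tendsto_probabilityMeasure_of_charFun fun t => ?_
    obtain ⟨δ, hδ, hδ'⟩ := hΨ ρ (Fin 2) x fun r a => t r a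
    have e0 : charFun (ν₀ : Measure _) t = ∏ r, Ψ x (t r) := by
      refine (charFun_pi t).trans ?_
      exact Finset.prod_congr rfl fun r _ => hγ (t r)
    have e1 : ∀ i, charFun (ν i : Measure _) t = ∫ ω, Complex.exp ((∑ r, ∑ a, t r a *
        randomPreactivation (N := layerWidth n₀ nOut i.1) σ CW (What i.1) (b i.1) (x a) ℓ
          (i.2.1 r) ω : ℝ) * Complex.I) ∂(P i.1) := by
      intro i
      change charFun ((P i.1).map _) t = _
      rw [charFun_apply, integral_map (hm i.1 i.2.1).aemeasurable (by fun_prop)]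
      simp [PiLp.inner_apply, mul_comm]
    rw [e0, tendsto_iff_norm_sub_tendsto_zero]
    refine squeeze_zero (fun _ => norm_nonneg _) (fun i => ?_) (hδ.comp tendsto_comap)
    rw [e1]
    exact hδ' i.1 i.2.1 i.2.2
  have hgm : ∀ i, eLpNorm g 2 (ν i : Measure _) ≤ C := fun i => by
    refine le_of_eq_of_le ?_ (hC i.1 i.2.1 i.2.2)
    exact eLpNorm_map_measure hg.aestronglyMeasurable (hm i.1 i.2.1).aemeasurable
  have h1 := tendsto_integral_of_bounded_sq hν hg (C := (C : ℝ) ^ 2)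
    (fun i => ⟨hg.aestronglyMeasurable, (hgm i).trans_lt ENNReal.coe_lt_top⟩)
    (fun i => by
      have := integral_abs_pow_le_of_eLpNorm_le (P := (ν i : Measure _))
        hg.aestronglyMeasurable two_ne_zero (by exact_mod_cast hgm i)
      simpa only [sq_abs] using this) ?_
  · have e2 : ∫ w, g w ∂(ν₀ : Measure _) = ∏ _r : ρ, ∫ v, f v ∂γ := by
      refine (integral_map (WithLp.measurable_toLp 2 _).aemeasurable
        hg.aestronglyMeasurable).trans ?_
      exact integral_fintype_prod_eq_prod fun _ => f
    rw [e2] at h1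
    refine h1.congr fun i => ?_
    exact integral_map (hm i.1 i.2.1).aemeasurable hg.aestronglyMeasurable
  · refine (memLp_map_measure_iff hg.aestronglyMeasurable
      (WithLp.measurable_toLp 2 _).aemeasurable).2 ?_
    have hgm' : Continuous (g ∘ WithLp.toLp 2) := by fun_prop
    refine (memLp_two_iff_integrable_sq hgm'.aestronglyMeasurable).2 ?_
    have h2 := Integrable.fintype_prod (μ := fun _ : ρ => γ) (f := fun _ v => f v ^ 2)
      fun _ => hfγ.integrable_sq
    refine h2.congr (ae_of_all _ fun w => ?_)
    simp [g, Finset.prod_pow]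

/-- The law of large numbers for the products of activations follows from the asymptotic
independence of the neurons: centered at their limiting expectation, the products at distinct
neurons are asymptotically uncorrelated, uniformly in the neurons. -/
theorem HasLimitCharFun.hasLimitSecondMoment (hn₀ : 1 ≤ n₀) (hσ : Continuous σ) {ℓ : ℕ}
    (hℓ1 : 1 ≤ ℓ) (hℓ : ℓ ≤ L)
    {Ψ : ∀ {α : Type} [Fintype α], (α → EuclideanSpace ℝ (Fin n₀)) → (α → ℝ) → ℂ}
    (hΨ : HasLimitCharFun P σ CW What b ℓ Ψ)
    (hact : HasMomentBounds (fun p => P p.1) (activationField σ CW What b ℓ))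
    {γ : EuclideanSpace ℝ (Fin n₀) → EuclideanSpace ℝ (Fin n₀) →
      Measure (EuclideanSpace ℝ (Fin 2))} [∀ x y, IsProbabilityMeasure (γ x y)]
    (hγ : ∀ x y (t : EuclideanSpace ℝ (Fin 2)), charFun (γ x y) t = Ψ ![x, y] t)
    (hγL : ∀ x y, MemLp (fun v => σ (v 0) * σ (v 1)) 2 (γ x y)) :
    HasLimitSecondMoment P σ CW What b ℓ fun x y => ∫ v, σ (v 0) * σ (v 1) ∂(γ x y) := by
  intro x y
  beta_reduce
  obtain ⟨k, rfl⟩ : ∃ k, ℓ = k + 1 := ⟨ℓ - 1, by omega⟩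
  set m : ℝ := ∫ v, σ (v 0) * σ (v 1) ∂(γ x y) with hm
  -- the product of activations, centered at its limiting expectation
  let f : EuclideanSpace ℝ (Fin 2) → ℝ := fun v => σ (v 0) * σ (v 1) - m
  have hf : Continuous f := by fun_prop
  have hfγ : MemLp f 2 (γ x y) := (hγL x y).sub (memLp_const m)
  have hf0 : ∫ v, f v ∂(γ x y) = 0 := by
    rw [integral_sub ((hγL x y).integrable one_le_two) (integrable_const _)]
    simp [hm]
  obtain ⟨R, hR⟩ := exists_nat_abs_apply_le ![x, y]
  obtain ⟨B, hB⟩ := hact.value 8 R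
  have hBx := fun p => hB p x (hR 0)
  have hBy := fun p => hB p y (hR 1)
  let F : ∀ n, Fin (layerWidth n₀ nOut n (k + 1)) → Ω n → ℝ := fun n j ω =>
    randomActivation (N := layerWidth n₀ nOut n) σ CW (What n) (b n) x (k + 1) j ω *
      randomActivation (N := layerWidth n₀ nOut n) σ CW (What n) (b n) y (k + 1) j ω - m
  have ham : ∀ n x j, Measurable (randomActivation (N := layerWidth n₀ nOut n) σ CW (What n) (b n)
      x (k + 1) j) := fun n x j => (h n).measurable_randomActivation hσ.measurable x (by omega) j
  have hFm : ∀ n j, Measurable (F n j) := fun n j => ((ham n x j).mul (ham n y j)).sub_const m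
  have hF4 : ∀ n j, eLpNorm (F n j) 4 (P n) ≤ (B * B + ‖m‖₊ : ℝ≥0) := by
    intro n j
    refine (eLpNorm_sub_le ((ham n x j).mul (ham n y j)).aestronglyMeasurable
      aestronglyMeasurable_const (by norm_num)).trans ?_
    push_cast
    refine add_le_add ?_ ?_
    · refine (eLpNorm_mul_le_mul (ham n x j).aestronglyMeasurable
        (ham n y j).aestronglyMeasurable 4).trans ?_
      exact mul_le_mul' (hBx ⟨n, j⟩) (hBy ⟨n, j⟩)
    · rw [eLpNorm_const _ (by norm_num) (IsProbabilityMeasure.ne_zero (P n))]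
      simp
      rfl
  have hF2 : ∀ n j, eLpNorm (F n j) 2 (P n) ≤ (B * B + ‖m‖₊ : ℝ≥0) := fun n j =>
    (eLpNorm_le_eLpNorm_of_exponent_le (by norm_num) (hFm n j).aestronglyMeasurable).trans (hF4 n j)
  set D : ℝ≥0 := B * B + ‖m‖₊ with hD
  have key := hΨ.tendsto_integral_prod h hσ.measurable (ℓ := k + 1) (by omega) ![x, y]
    (hγ x y) (ρ := Fin 2) hf hfγ (C := D * D) (fun n idx _ => by
      simp only [Fin.prod_univ_two]
      refine (eLpNorm_mul_le_mul (hFm n (idx 0)).aestronglyMeasurable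
        (hFm n (idx 1)).aestronglyMeasurable 2).trans ?_
      rw [ENNReal.coe_mul]
      exact mul_le_mul' (hF4 n (idx 0)) (hF4 n (idx 1)))
  simp only [Fin.prod_univ_two, hf0, mul_zero] at key
  refine Metric.tendsto_nhds.2 fun ε hε => ?_
  have h1 := Metric.tendsto_nhds.1 key (ε ^ 2 / 4) (by positivity)
  have h2 : Tendsto (fun n : Fin L → ℕ+ => (D : ℝ) ^ 2 / (layerWidth n₀ nOut n (k + 1) : ℝ)) atTop
      (𝓝 0) := tendsto_const_nhds.div_atTop
        (tendsto_natCast_atTop_atTop.comp (tendsto_layerWidth hℓ1 hℓ))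
  filter_upwards [eventually_comap.1 h1, h2.eventually_lt_const
    (by positivity : (0 : ℝ) < ε ^ 2 / 4)] with n hn hn2
  have h3 := integral_abs_average_le (P := P n) (layerWidth_ne_zero (nOut := nOut) hn₀ n hℓ)
    (f := F n) (D := (D : ℝ) ^ 2)
    (fun j => ⟨(hFm n j).aestronglyMeasurable, (hF2 n j).trans_lt ENNReal.coe_lt_top⟩)
    (by positivity : 0 ≤ ε ^ 2 / 4) (fun j => by
      have := integral_abs_pow_le_of_eLpNorm_le (P := P n) (hFm n j).aestronglyMeasurable
        two_ne_zero (by exact_mod_cast hF2 n j)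
      simpa only [sq_abs] using this)
    (fun i j hij => by
      have h4 := hn ⟨n, ![i, j], by
        intro r s hrs
        fin_cases r <;> fin_cases s <;> simp_all [Ne.symm]⟩ rfl
      rw [Real.dist_eq, sub_zero] at h4
      exact (le_abs_self _).trans h4.le)
  have e1 : ∀ ω, (layerWidth n₀ nOut n (k + 1) : ℝ)⁻¹ * ∑ j,
      randomActivation (N := layerWidth n₀ nOut n) σ CW (What n) (b n) x (k + 1) j ω *
      randomActivation (N := layerWidth n₀ nOut n) σ CW (What n) (b n) y (k + 1) j ω - m
      = (layerWidth n₀ nOut n (k + 1) : ℝ)⁻¹ * ∑ j, F n j ω := by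
    intro ω
    have h0 : (layerWidth n₀ nOut n (k + 1) : ℝ) ≠ 0 := by
      exact_mod_cast layerWidth_ne_zero (nOut := nOut) hn₀ n hℓ
    simp only [F]
    rw [Finset.sum_sub_distrib, mul_sub, Finset.sum_const, Finset.card_univ, Fintype.card_fin,
      nsmul_eq_mul, inv_mul_cancel_left₀ h0]
  simp_rw [e1]
  rw [Real.dist_eq, sub_zero, abs_of_nonneg (integral_nonneg fun ω => abs_nonneg _)]
  refine h3.trans_lt ?_
  rw [Real.sqrt_lt' hε]
  linarith [sq_nonneg ε, pow_pos hε 2]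

end NetworkFamily

/-! ### The limiting kernels -/

section Kernels

theorem memLp_comp_of_growth {Ω : Type*} [MeasurableSpace Ω] {P : Measure Ω}
    [IsProbabilityMeasure P] {σ : ℝ → ℝ} (hσm : Measurable σ) {C : ℝ≥0} {k : ℕ}
    (hσ : ∀ u, |σ u| ≤ C * (1 + |u| ^ k)) {X : Ω → ℝ} (hXm : Measurable X)
    (hX : ∀ q : ℕ, MemLp X q P) (q : ℕ) : MemLp (fun ω => σ (X ω)) q P := by
  have hm : MemLp (fun ω => |X ω| ^ k) (q + 1 : ℕ) P :=
    ⟨(hXm.abs.pow_const k).aestronglyMeasurable, (eLpNorm_abs_pow_le X k (by omega)).trans_lt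
      (ENNReal.add_lt_top.2 ⟨ENNReal.one_lt_top, ENNReal.pow_lt_top (hX _).2⟩)⟩
  have h1 : MemLp (fun ω => (C : ℝ) * (1 + |X ω| ^ k)) (q + 1 : ℕ) P :=
    ((memLp_const (1 : ℝ)).add hm).const_mul _
  have h2 : MemLp (fun ω => σ (X ω)) (q + 1 : ℕ) P :=
    h1.of_le (hσm.comp hXm).aestronglyMeasurable
      (ae_of_all _ fun ω => (hσ _).trans (le_abs_self _))
  exact h2.mono_exponent (by exact_mod_cast Nat.le_succ q)

theorem memLp_two_mul {Ω : Type*} [MeasurableSpace Ω] {P : Measure Ω} {f g : Ω → ℝ}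
    (hf : MemLp f 4 P) (hg : MemLp g 4 P) : MemLp (fun ω => f ω * g ω) 2 P :=
  ⟨hf.1.mul hg.1, (eLpNorm_mul_le_mul hf.1 hg.1 2).trans_lt
    (ENNReal.mul_lt_top (by exact_mod_cast hf.2) (by exact_mod_cast hg.2))⟩

/-- The covariance matrix of a field with covariance function `K` at the points `x` and `y`. -/
abbrev pairMatrix {E : Type*} (K : E → E → ℝ) (x y : E) : Matrix (Fin 2) (Fin 2) ℝ :=
  !![K x x, K x y; K x y, K y y]

theorem posSemidef_fin_two {a b c : ℝ} (h : ∀ s t : ℝ, 0 ≤ a * s ^ 2 + 2 * b * s * t + c * t ^ 2) :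
    !![a, b; b, c].PosSemidef := by
  refine Matrix.PosSemidef.of_dotProduct_mulVec_nonneg ?_ fun v => ?_
  · ext i j
    fin_cases i <;> fin_cases j <;> simp
  · have := h (v 0) (v 1)
    simp only [star_trivial, dotProduct, Matrix.mulVec, Fin.sum_univ_two, Matrix.of_apply,
      Matrix.cons_val_zero, Matrix.cons_val_one]
    simp
    nlinarith

/-- The matrix into which the kernel recursion turns the Gram matrix of `X` and `Y` is positive
semidefinite. -/
theorem posSemidef_add_mul_integral {Ω : Type*} [MeasurableSpace Ω] {P : Measure Ω}
    {X Y : Ω → ℝ} (hX : MemLp X 2 P) (hY : MemLp Y 2 P)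
    (Cb : ℝ≥0) {CW : ℝ} (hCW : 0 ≤ CW) :
    !![Cb + CW * ∫ ω, X ω * X ω ∂P, Cb + CW * ∫ ω, X ω * Y ω ∂P;
      Cb + CW * ∫ ω, X ω * Y ω ∂P, Cb + CW * ∫ ω, Y ω * Y ω ∂P].PosSemidef := by
  refine posSemidef_fin_two fun s t => ?_
  have h1 : 0 ≤ ∫ ω, (s * X ω + t * Y ω) ^ 2 ∂P := integral_nonneg fun ω => sq_nonneg _
  have h2 : ∫ ω, (s * X ω + t * Y ω) ^ 2 ∂P = s ^ 2 * ∫ ω, X ω * X ω ∂P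
      + 2 * s * t * ∫ ω, X ω * Y ω ∂P + t ^ 2 * ∫ ω, Y ω * Y ω ∂P := by
    have hXX : Integrable (fun ω => s ^ 2 * (X ω * X ω)) P :=
      (MemLp.integrable_mul hX hX).const_mul (s ^ 2)
    have hXY : Integrable (fun ω => 2 * s * t * (X ω * Y ω)) P :=
      (MemLp.integrable_mul hX hY).const_mul (2 * s * t)
    have hYY : Integrable (fun ω => t ^ 2 * (Y ω * Y ω)) P :=
      (MemLp.integrable_mul hY hY).const_mul (t ^ 2)
    have e : ∀ ω, (s * X ω + t * Y ω) ^ 2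
        = (s ^ 2 * (X ω * X ω) + 2 * s * t * (X ω * Y ω)) + t ^ 2 * (Y ω * Y ω) := fun ω => by ring
    simp_rw [e]
    have hXXY : Integrable (fun ω => s ^ 2 * (X ω * X ω) + 2 * s * t * (X ω * Y ω)) P :=
      hXX.add hXY
    rw [integral_add hXXY hYY, integral_add hXX hXY, integral_const_mul,
      integral_const_mul, integral_const_mul]
  rw [h2] at h1
  have h3 := mul_nonneg hCW h1
  have h4 : 0 ≤ (Cb : ℝ) * (s + t) ^ 2 := by positivity
  nlinarith

variable {E : Type*} {K : E → E → ℝ}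

theorem charFun_multivariateGaussian_pairMatrix (hK : ∀ x y, K x y = K y x) {x y : E}
    (hS : (pairMatrix K x y).PosSemidef) (t : EuclideanSpace ℝ (Fin 2)) :
    charFun (multivariateGaussian 0 (pairMatrix K x y)) t = gaussianCharFun K ![x, y] t := by
  rw [charFun_multivariateGaussian hS, gaussianCharFun]
  simp only [inner_zero_right, Complex.ofReal_zero, zero_mul, zero_sub, dotProduct, Matrix.mulVec,
    Fin.sum_univ_two, Matrix.of_apply, Matrix.cons_val_zero, Matrix.cons_val_one, hK y x]
  rw [← Complex.ofReal_ofNat, ← Complex.ofReal_div, ← Complex.ofReal_neg, ← Complex.ofReal_exp]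
  congr 2
  simp
  ring

theorem multivariateGaussian_pairMatrix_swap (hK : ∀ x y, K x y = K y x) {x y : E}
    (hS : (pairMatrix K x y).PosSemidef) (hS' : (pairMatrix K y x).PosSemidef) :
    (multivariateGaussian 0 (pairMatrix K x y)).map
      (fun v => (!₂[v 1, v 0] : EuclideanSpace ℝ (Fin 2)))
      = multivariateGaussian 0 (pairMatrix K y x) := by
  have hm : Measurable fun v : EuclideanSpace ℝ (Fin 2) =>
      (!₂[v 1, v 0] : EuclideanSpace ℝ (Fin 2)) := by fun_prop
  have := Measure.isProbabilityMeasure_map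
    (μ := multivariateGaussian 0 (pairMatrix K x y)) hm.aemeasurable
  refine Measure.ext_of_charFun ?_
  ext t
  have h1 := charFun_multivariateGaussian_pairMatrix hK hS !₂[t 1, t 0]
  rw [charFun_apply] at h1
  rw [charFun_apply, integral_map hm.aemeasurable (by fun_prop),
    charFun_multivariateGaussian_pairMatrix hK hS']
  have e : ∀ v : EuclideanSpace ℝ (Fin 2), inner ℝ (!₂[v 1, v 0] : EuclideanSpace ℝ (Fin 2)) t
      = inner ℝ v !₂[t 1, t 0] := fun v => by
    simp [PiLp.inner_apply, Fin.sum_univ_two, add_comm]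
  simp_rw [e]
  rw [h1, gaussianCharFun, gaussianCharFun]
  congr 3
  simp only [Fin.sum_univ_two, Matrix.cons_val_zero, Matrix.cons_val_one]
  ring

/-- On the diagonal the Gaussian law is degenerate, and concentrated on the line `v 0 = v 1`. -/
theorem multivariateGaussian_pairMatrix_self (x : E) (hS : (pairMatrix K x x).PosSemidef) :
    (gaussianReal 0 (K x x).toNNReal).map
      (fun w => (!₂[w, w] : EuclideanSpace ℝ (Fin 2)))
      = multivariateGaussian 0 (pairMatrix K x x) := by
  have hm : Measurable fun w : ℝ => (!₂[w, w] : EuclideanSpace ℝ (Fin 2)) := by fun_prop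
  have := Measure.isProbabilityMeasure_map
    (μ := gaussianReal 0 (K x x).toNNReal) hm.aemeasurable
  have hpos : 0 ≤ K x x := hS.diag_nonneg (i := 0)
  refine Measure.ext_of_charFun ?_
  ext t
  have h1 := charFun_gaussianReal (μ := 0) (v := (K x x).toNNReal) (t 0 + t 1)
  rw [charFun_apply_real] at h1
  rw [charFun_multivariateGaussian hS, charFun_apply, integral_map hm.aemeasurable (by fun_prop)]
  have e : ∀ w : ℝ, ((inner ℝ (!₂[w, w] : EuclideanSpace ℝ (Fin 2)) t : ℝ) : ℂ)
      = ((t 0 + t 1 : ℝ) : ℂ) * w := fun w => by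
    simp [PiLp.inner_apply, Fin.sum_univ_two]
    ring
  simp_rw [e]
  rw [h1, Real.coe_toNNReal _ hpos]
  simp only [inner_zero_right, Complex.ofReal_zero, zero_mul, mul_zero, zero_sub, dotProduct,
    Matrix.mulVec, Fin.sum_univ_two, Matrix.of_apply, Matrix.cons_val_zero, Matrix.cons_val_one]
  congr 1
  simp
  ring

theorem memLp_eval_multivariateGaussian {S : Matrix (Fin 2) (Fin 2) ℝ} (hS : S.PosSemidef)
    (i : Fin 2) (q : ℕ) :
    MemLp (fun v : EuclideanSpace ℝ (Fin 2) => v i) q (multivariateGaussian 0 S) := by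
  have h1 := measurePreserving_eval_multivariateGaussian (μ := 0) hS (i := i)
  refine (memLp_map_measure_iff aestronglyMeasurable_id h1.measurable.aemeasurable).1 ?_
  rw [h1.map_eq]
  exact memLp_id_gaussianReal q

/-- The covariance functions of the limiting Gaussian processes at the layers `2, 3, …`, if
`γ₁ x y` is the law of the values of a neuron of the first layer at `x` and `y`. -/
noncomputable def kernelSeq (σ : ℝ → ℝ) (CW : ℝ) (Cb : ℝ≥0)
    (γ₁ : E → E → Measure (EuclideanSpace ℝ (Fin 2))) : ℕ → E → E → ℝ
  | 0 => fun x y => Cb + CW * ∫ v, σ (v 0) * σ (v 1) ∂(γ₁ x y)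
  | k + 1 => fun x y => Cb + CW * ∫ v, σ (v 0) * σ (v 1)
      ∂(multivariateGaussian 0 (pairMatrix (kernelSeq σ CW Cb γ₁ k) x y))

variable {σ : ℝ → ℝ} {C : ℝ≥0} {k : ℕ} (hσ : Continuous σ) (hσ' : ∀ u, |σ u| ≤ C * (1 + |u| ^ k))
include hσ hσ'

theorem memLp_comp_eval_multivariateGaussian {S : Matrix (Fin 2) (Fin 2) ℝ} (hS : S.PosSemidef)
    (i : Fin 2) (q : ℕ) :
    MemLp (fun v : EuclideanSpace ℝ (Fin 2) => σ (v i)) q (multivariateGaussian 0 S) :=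
  memLp_comp_of_growth hσ.measurable hσ' (by fun_prop) (memLp_eval_multivariateGaussian hS i) q

theorem memLp_mul_eval_multivariateGaussian {S : Matrix (Fin 2) (Fin 2) ℝ} (hS : S.PosSemidef) :
    MemLp (fun v : EuclideanSpace ℝ (Fin 2) => σ (v 0) * σ (v 1)) 2 (multivariateGaussian 0 S) :=
  memLp_two_mul (memLp_comp_eval_multivariateGaussian hσ hσ' hS 0 4)
    (memLp_comp_eval_multivariateGaussian hσ hσ' hS 1 4)

variable {γ₁ : E → E → Measure (EuclideanSpace ℝ (Fin 2))} {Ω : Type*} [MeasurableSpace Ω]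
  {P : Measure Ω} [IsProbabilityMeasure P] {Z : E → Ω → ℝ} (hZm : ∀ x, Measurable (Z x))
  (hZ : ∀ x, ∀ q : ℕ, MemLp (Z x) q P)
  (hγ₁ : ∀ x y, P.map (fun ω => (!₂[Z x ω, Z y ω] : EuclideanSpace ℝ (Fin 2))) = γ₁ x y)
include hZm hZ hγ₁

omit hσ' [IsProbabilityMeasure P] hZ in
theorem kernelSeq_zero_eq (CW : ℝ) (Cb : ℝ≥0) (x y : E) :
    kernelSeq σ CW Cb γ₁ 0 x y = Cb + CW * ∫ ω, σ (Z x ω) * σ (Z y ω) ∂P := by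
  have h1 := hZm x
  have h2 := hZm y
  change (Cb : ℝ) + CW * ∫ v, σ (v 0) * σ (v 1) ∂(γ₁ x y) = _
  rw [← hγ₁, integral_map (by fun_prop) (by fun_prop)]
  rfl

/-- Symmetry and positivity are proved together, since the Gaussian law in the recursion has the
prescribed covariance only if the matrix is positive semidefinite. -/
theorem kernelSeq_symm_and_posSemidef {CW : ℝ} (hCW : 0 ≤ CW) (Cb : ℝ≥0) : ∀ k,
    (∀ x y, kernelSeq σ CW Cb γ₁ k x y = kernelSeq σ CW Cb γ₁ k y x) ∧
      ∀ x y, (pairMatrix (kernelSeq σ CW Cb γ₁ k) x y).PosSemidef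
  | 0 => by
    have e := kernelSeq_zero_eq hσ hZm hγ₁ CW Cb
    refine ⟨fun x y => ?_, fun x y => ?_⟩
    · rw [e, e]
      simp_rw [mul_comm (σ (Z x _))]
    · rw [pairMatrix, e, e, e]
      have h1 := fun x => memLp_comp_of_growth hσ.measurable hσ' (hZm x) (hZ x) 2
      exact posSemidef_add_mul_integral (h1 x) (h1 y) Cb hCW
  | k + 1 => by
    obtain ⟨hsymm, hpos⟩ := kernelSeq_symm_and_posSemidef hCW Cb k
    set K := kernelSeq σ CW Cb γ₁ k with hK
    have e : ∀ x y, kernelSeq σ CW Cb γ₁ (k + 1) x y = Cb + CW * ∫ v, σ (v 0) * σ (v 1)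
        ∂(multivariateGaussian 0 (pairMatrix K x y)) := fun x y => rfl
    have hdiag : ∀ x, ∫ v, σ (v 0) * σ (v 1) ∂(multivariateGaussian 0 (pairMatrix K x x))
        = ∫ w, σ w * σ w ∂(gaussianReal 0 (K x x).toNNReal) := by
      intro x
      rw [← multivariateGaussian_pairMatrix_self x (hpos x x),
        integral_map (by fun_prop) (by fun_prop)]
      rfl
    have hmarg : ∀ x y (i : Fin 2), ∫ v, σ (v i) * σ (v i)
        ∂(multivariateGaussian 0 (pairMatrix K x y))
        = ∫ w, σ w * σ w ∂(gaussianReal 0 (pairMatrix K x y i i).toNNReal) := by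
      intro x y i
      have h1 := measurePreserving_eval_multivariateGaussian (μ := 0) (hpos x y) (i := i)
      rw [← PiLp.zero_apply (p := 2) (β := fun _ : Fin 2 => ℝ) i, ← h1.map_eq,
        integral_map h1.measurable.aemeasurable (by fun_prop)]
    refine ⟨fun x y => ?_, fun x y => ?_⟩
    · rw [e, e, ← multivariateGaussian_pairMatrix_swap hsymm (hpos x y) (hpos y x),
        integral_map (by fun_prop) (by fun_prop)]
      simp [mul_comm]
    · rw [pairMatrix, e, e, e, hdiag, hdiag]
      have h1 := posSemidef_add_mul_integral (memLp_comp_eval_multivariateGaussian hσ hσ'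
        (hpos x y) 0 2) (memLp_comp_eval_multivariateGaussian hσ hσ' (hpos x y) 1 2) Cb hCW
      rwa [hmarg, hmarg] at h1

end Kernels

section NetworkFamily

variable {L n₀ nOut : ℕ} {σ : ℝ → ℝ} {CW : ℝ} {μ : Measure ℝ} {Cb : ℝ≥0}
  {Ω : (Fin L → ℕ+) → Type*} [∀ n, MeasurableSpace (Ω n)] {P : ∀ n, Measure (Ω n)}
  {What : ∀ n, Ω n → ∀ ℓ,
    Matrix (Fin (layerWidth n₀ nOut n (ℓ + 1))) (Fin (layerWidth n₀ nOut n ℓ)) ℝ}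
  {b : ∀ n, Ω n → ∀ ℓ, Fin (layerWidth n₀ nOut n (ℓ + 1)) → ℝ}
  [∀ n, IsProbabilityMeasure (P n)] [IsProbabilityMeasure μ]
  (h : ∀ n, IsMeasurableInit (P n) L (layerWidth n₀ nOut n) μ Cb (What n) (b n))
include h

/-- The law of the values of one neuron of the first layer at two inputs depends neither on the
widths nor on the neuron. -/
theorem exists_firstLayerLaw (hσ : Measurable σ) (hL : 1 ≤ L) :
    ∃ γ₁ : EuclideanSpace ℝ (Fin n₀) → EuclideanSpace ℝ (Fin n₀) →
      Measure (EuclideanSpace ℝ (Fin 2)), (∀ x y, IsProbabilityMeasure (γ₁ x y)) ∧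
      (∀ x y (t : EuclideanSpace ℝ (Fin 2)),
        charFun (γ₁ x y) t = firstLayerCharFun μ CW Cb ![x, y] t) ∧
      ∀ x y n i, (P n).map (fun ω => (!₂[randomPreactivation (N := layerWidth n₀ nOut n) σ CW
        (What n) (b n) x 1 i ω, randomPreactivation (N := layerWidth n₀ nOut n) σ CW
        (What n) (b n) y 1 i ω] : EuclideanSpace ℝ (Fin 2))) = γ₁ x y := by
  let n₁ : Fin L → ℕ+ := fun _ => 1
  have hi : layerWidth n₀ nOut n₁ 1 = 1 := by simp [layerWidth, n₁, Nat.lt_of_succ_le hL]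
  let i₁ : Fin (layerWidth n₀ nOut n₁ 1) := ⟨0, by rw [hi]; exact one_pos⟩
  let law := fun n (i : Fin (layerWidth n₀ nOut n 1)) x y =>
    (P n).map (fun ω => (!₂[randomPreactivation (N := layerWidth n₀ nOut n) σ CW
        (What n) (b n) x 1 i ω, randomPreactivation (N := layerWidth n₀ nOut n) σ CW
        (What n) (b n) y 1 i ω] : EuclideanSpace ℝ (Fin 2)))
  have hm : ∀ n (i : Fin (layerWidth n₀ nOut n 1)) x y, Measurable fun ω =>
      (!₂[randomPreactivation (N := layerWidth n₀ nOut n) σ CW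
        (What n) (b n) x 1 i ω, randomPreactivation (N := layerWidth n₀ nOut n) σ CW
        (What n) (b n) y 1 i ω] : EuclideanSpace ℝ (Fin 2)) := by
    intro n i x y
    have h1 := (h n).measurable_randomPreactivation (CW := CW) hσ x (ℓ := 1) (by omega) i
    have h2 := (h n).measurable_randomPreactivation (CW := CW) hσ y (ℓ := 1) (by omega) i
    fun_prop
  have hprob : ∀ n i x y, IsProbabilityMeasure (law n i x y) := fun n i x y =>
    Measure.isProbabilityMeasure_map (hm n i x y).aemeasurable
  have hcf : ∀ n i x y (t : EuclideanSpace ℝ (Fin 2)),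
      charFun (law n i x y) t = firstLayerCharFun μ CW Cb ![x, y] t := by
    intro n i x y t
    have h1 := integral_exp_firstLayer (σ := σ) (CW := CW) h ![x, y] (fun _ : Unit => t) n
      (idx := fun _ => i) (Function.injective_of_subsingleton _)
    simp only [Finset.univ_unique, Finset.prod_singleton, Finset.sum_singleton] at h1
    rw [← h1, charFun_apply, integral_map (hm n i x y).aemeasurable (by fun_prop)]
    refine integral_congr_ae (ae_of_all _ fun ω => ?_)
    simp [PiLp.inner_apply, Fin.sum_univ_two]
  refine ⟨law n₁ i₁, hprob n₁ i₁, hcf n₁ i₁, fun x y n i => ?_⟩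
  have := hprob n i x y
  have := hprob n₁ i₁ x y
  refine Measure.ext_of_charFun (μ := law n i x y) ?_
  ext t
  rw [hcf, hcf]

/-- The layers `2, …, L + 1` converge to Gaussian processes with the kernels `kernelSeq`. -/
theorem hasLimitCharFun_kernelSeq (hσ : Continuous σ) {Cσ : ℝ≥0} {kσ : ℕ}
    (hσ' : ∀ u v, |σ u - σ v| ≤ Cσ * (1 + |u| ^ kσ + |v| ^ kσ) * |u - v|) (hn₀ : 1 ≤ n₀)
    (hCW : 0 ≤ CW) (hμ : ∀ p : ℕ, Integrable (fun w => |w| ^ p) μ) (hμ0 : ∫ w, w ∂μ = 0)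
    (hμ1 : ∫ w, w ^ 2 ∂μ = 1) (hμL : ∀ q : ℕ, MemLp id q μ)
    {γ₁ : EuclideanSpace ℝ (Fin n₀) → EuclideanSpace ℝ (Fin n₀) →
      Measure (EuclideanSpace ℝ (Fin 2))} [∀ x y, IsProbabilityMeasure (γ₁ x y)]
    (hγ₁ : ∀ x y (t : EuclideanSpace ℝ (Fin 2)),
        charFun (γ₁ x y) t = firstLayerCharFun μ CW Cb ![x, y] t)
    (hγ₁' : ∀ x y n i, (P n).map (fun ω => (!₂[randomPreactivation (N := layerWidth n₀ nOut n) σ CW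
        (What n) (b n) x 1 i ω, randomPreactivation (N := layerWidth n₀ nOut n) σ CW
        (What n) (b n) y 1 i ω] : EuclideanSpace ℝ (Fin 2))) = γ₁ x y)
    (hsymm : ∀ k x y, kernelSeq σ CW Cb γ₁ k x y = kernelSeq σ CW Cb γ₁ k y x)
    (hpos : ∀ k x y, (pairMatrix (kernelSeq σ CW Cb γ₁ k) x y).PosSemidef) :
    ∀ k, k + 1 ≤ L → HasLimitCharFun P σ CW What b (k + 2)
      (fun {_} _ x t => gaussianCharFun (kernelSeq σ CW Cb γ₁ k) x t) := by
  obtain ⟨C', hC'0, hC'⟩ := exists_charFun_sub_exp_le hμ hμ0 hμ1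
  obtain ⟨Cg, kg, hg⟩ := exists_polynomial_growth hσ'
  have hmom := fun {ℓ : ℕ} (hℓ : ℓ ≤ L) =>
    hasMomentBounds_fields (ℓ := ℓ) h hσ.measurable hσ' hn₀ hCW hμL hμ0 hℓ
  intro k
  induction k with
  | zero =>
    intro hk
    have hγL : ∀ x y, MemLp (fun v => σ (v 0) * σ (v 1)) 2 (γ₁ x y) := by
      intro x y
      have hm := fun x i => (h fun _ => 1).measurable_randomPreactivation (CW := CW) hσ.measurable x
        (ℓ := 1) (by omega) i
      let i : Fin (layerWidth n₀ nOut (fun _ : Fin L => 1) 1) :=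
        ⟨0, Nat.pos_of_ne_zero (layerWidth_ne_zero hn₀ _ hk)⟩
      have h1 := hm x i
      have h2 := hm y i
      rw [← hγ₁' x y (fun _ => 1) i]
      refine (memLp_map_measure_iff (by fun_prop) (by fun_prop)).2 ?_
      have h3 := fun x => (hmom (ℓ := 1) hk).1.memLp (fun p x =>
        (h p.1).measurable_randomActivation hσ.measurable x (by omega) p.2) ⟨fun _ => 1, i⟩ x 4
      exact memLp_two_mul (h3 x) (h3 y)
    have h1 := (hasLimitCharFun_firstLayer (σ := σ) (CW := CW) h).hasLimitSecondMoment h hn₀ hσ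
      le_rfl hk (hmom hk).1 hγ₁ hγL
    exact h1.hasLimitCharFun_succ h hσ.measurable hCW hC'0 hC' le_rfl hk (hmom hk).1
  | succ k ih =>
    intro hk
    have h1 := (ih (by omega)).hasLimitSecondMoment h hn₀ hσ (by omega) hk (hmom hk).1
      (γ := fun x y => multivariateGaussian 0 (pairMatrix (kernelSeq σ CW Cb γ₁ k) x y))
      (fun x y t => charFun_multivariateGaussian_pairMatrix (hsymm k) (hpos k x y) t)
      (fun x y => memLp_mul_eval_multivariateGaussian hσ hg (hpos k x y))
    exact h1.hasLimitCharFun_succ h hσ.measurable hCW hC'0 hC' (by omega) hk (hmom hk).1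

omit [IsProbabilityMeasure μ] in
/-- Convergence of the covariances, from the convergence in law of pairs and the moment bounds. The
neuron `i n` may vary with the widths. -/
theorem HasLimitCharFun.tendsto_covariance (hσ : Measurable σ) {ℓ : ℕ} (hℓ : ℓ ≤ L + 1)
    {K : EuclideanSpace ℝ (Fin n₀) → EuclideanSpace ℝ (Fin n₀) → ℝ}
    (hK : ∀ x y, K x y = K y x) (hpos : ∀ x y, (pairMatrix K x y).PosSemidef)
    (hΨ : HasLimitCharFun P σ CW What b ℓ (fun {_} _ x t => gaussianCharFun K x t))
    (hpre : HasMomentBounds (fun p => P p.1) (preactivationField σ CW What b ℓ))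
    (x y : EuclideanSpace ℝ (Fin n₀)) (i : ∀ n, Fin (layerWidth n₀ nOut n ℓ)) :
    Tendsto (fun n => cov[randomPreactivation (N := layerWidth n₀ nOut n) σ CW (What n) (b n) x ℓ
      (i n), randomPreactivation (N := layerWidth n₀ nOut n) σ CW (What n) (b n) y ℓ (i n); P n])
      atTop (𝓝 (K x y)) := by
  have hm : ∀ (p : Σ n : Fin L → ℕ+, Fin (layerWidth n₀ nOut n ℓ)) x,
      Measurable (preactivationField σ CW What b ℓ p x) := fun p x =>
    (h p.1).measurable_randomPreactivation hσ x hℓ p.2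
  obtain ⟨R, hR⟩ := exists_nat_abs_apply_le ![x, y]
  obtain ⟨B, hB⟩ := hpre.value 4 R
  have hB2 : ∀ p x, (∀ a, |x a| ≤ (R : ℝ)) →
      eLpNorm (preactivationField σ CW What b ℓ p x) 2 (P p.1) ≤ B := fun p x hx =>
    (eLpNorm_le_eLpNorm_of_exponent_le (by norm_num) (hm p x).aestronglyMeasurable).trans
      (hB p x hx)
  set γ := multivariateGaussian 0 (pairMatrix K x y) with hγ
  have hcf := fun t => charFun_multivariateGaussian_pairMatrix hK (hpos x y) t
  have hL2 := fun i => memLp_eval_multivariateGaussian (hpos x y) i 2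
  have hL4 := fun i => memLp_eval_multivariateGaussian (hpos x y) i 4
  have hsec : Tendsto (fun n => (⟨n, fun _ => i n, Function.injective_of_subsingleton _⟩ :
      Σ n : Fin L → ℕ+, {idx : Unit → Fin (layerWidth n₀ nOut n ℓ) // Function.Injective idx}))
      atTop (comap Sigma.fst atTop) := tendsto_comap_iff.2 tendsto_id
  have key : ∀ (f : EuclideanSpace ℝ (Fin 2) → ℝ), Continuous f → MemLp f 2 γ → ∀ D : ℝ≥0,
      (∀ n (j : Fin (layerWidth n₀ nOut n ℓ)), eLpNorm (fun ω => f
        (WithLp.toLp 2 fun a => randomPreactivation (N := layerWidth n₀ nOut n) σ CW (What n) (b n)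
          (![x, y] a) ℓ j ω)) 2 (P n) ≤ D) →
      Tendsto (fun n => ∫ ω, f (WithLp.toLp 2 fun a => randomPreactivation
        (N := layerWidth n₀ nOut n) σ CW (What n) (b n) (![x, y] a) ℓ (i n) ω) ∂(P n)) atTop
        (𝓝 (∫ v, f v ∂γ)) := by
    intro f hf hfγ D hD
    have h1 := (hΨ.tendsto_integral_prod h hσ hℓ ![x, y] (γ := γ) hcf (ρ := Unit) hf hfγ (C := D)
      (fun n idx _ => by simpa using hD n (idx ()))).comp hsec
    simp only [Finset.univ_unique, Finset.prod_singleton] at h1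
    exact h1
  have hmean : ∀ i : Fin 2, ∫ v, v i ∂γ = 0 := by
    intro i
    have h1 := measurePreserving_eval_multivariateGaussian (μ := 0) (hpos x y) (i := i)
    rw [← integral_map (f := fun w => w) h1.measurable.aemeasurable (by fun_prop), h1.map_eq]
    simp
  have h0 := key (fun v => v 0) (by fun_prop) (hL2 0) B fun n j => hB2 ⟨n, j⟩ x (hR 0)
  have h1 := key (fun v => v 1) (by fun_prop) (hL2 1) B fun n j => hB2 ⟨n, j⟩ y (hR 1)
  have h01 := key (fun v => v 0 * v 1) (by fun_prop) (memLp_two_mul (hL4 0) (hL4 1)) (B * B)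
    fun n j => by
      refine (eLpNorm_mul_le_mul (hm ⟨n, j⟩ x).aestronglyMeasurable
        (hm ⟨n, j⟩ y).aestronglyMeasurable 2).trans ?_
      rw [ENNReal.coe_mul]
      exact mul_le_mul' (hB ⟨n, j⟩ x (hR 0)) (hB ⟨n, j⟩ y (hR 1))
  have hK01 : ∫ v, v 0 * v 1 ∂γ = K x y := by
    have h2 := covariance_eval_multivariateGaussian (μ := 0) (hpos x y) 0 1
    rw [covariance_eq_sub (hL2 0) (hL2 1), ← hγ, hmean, hmean] at h2
    simpa using h2
  have h2 := h01.sub (h0.mul h1)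
  rw [hK01, hmean, hmean, mul_zero, sub_zero] at h2
  refine h2.congr fun n => ?_
  rw [covariance_eq_sub
    ⟨(hm ⟨n, i n⟩ x).aestronglyMeasurable, (hB2 ⟨n, i n⟩ x (hR 0)).trans_lt ENNReal.coe_lt_top⟩
    ⟨(hm ⟨n, i n⟩ y).aestronglyMeasurable, (hB2 ⟨n, i n⟩ y (hR 1)).trans_lt ENNReal.coe_lt_top⟩]
  rfl

end NetworkFamily

/-! ### Measurable versions of the weights and biases -/

theorem preactivation_congr {N : ℕ → ℕ} {σ : ℝ → ℝ} {L : ℕ}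
    {W W' : ∀ ℓ, Matrix (Fin (N (ℓ + 1))) (Fin (N ℓ)) ℝ} {b b' : ∀ ℓ, Fin (N (ℓ + 1)) → ℝ}
    (h : ∀ ℓ ≤ L, W ℓ = W' ℓ ∧ b ℓ = b' ℓ) (x : EuclideanSpace ℝ (Fin (N 0))) :
    ∀ ℓ ≤ L + 1, preactivation σ W b x ℓ = preactivation σ W' b' x ℓ
  | 0, _ => rfl
  | 1, _ => by
    obtain ⟨hW, hb⟩ := h 0 (Nat.zero_le L)
    simp only [preactivation, hW, hb]
  | ℓ + 2, hℓ => by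
    obtain ⟨hW, hb⟩ := h (ℓ + 1) (by omega)
    simp only [preactivation, hW, hb, preactivation_congr h x (ℓ + 1) (by omega)]

theorem covariance_congr_ae {Ω : Type*} [MeasurableSpace Ω] {P : Measure Ω} {X X' Y Y' : Ω → ℝ}
    (hX : X =ᵐ[P] X') (hY : Y =ᵐ[P] Y') : cov[X, Y; P] = cov[X', Y'; P] := by
  rw [covariance, covariance, integral_congr_ae hX, integral_congr_ae hY]
  refine integral_congr_ae ?_
  filter_upwards [hX, hY] with ω h1 h2
  rw [h1, h2]

/-- A random initialization can be modified on a null set so that all weights and biases are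
measurable. The values beyond layer `L + 1`, on which nothing is assumed, are set to zero. -/
theorem IsRandomInit.exists_isMeasurableInit {Ω : Type*} [MeasurableSpace Ω] {P : Measure Ω}
    {L : ℕ} {N : ℕ → ℕ} {μ : Measure ℝ} {Cb : ℝ≥0}
    {What : Ω → ∀ ℓ, Matrix (Fin (N (ℓ + 1))) (Fin (N ℓ)) ℝ}
    {b : Ω → ∀ ℓ, Fin (N (ℓ + 1)) → ℝ} (h : IsRandomInit P L N μ Cb What b) :
    ∃ (What' : Ω → ∀ ℓ, Matrix (Fin (N (ℓ + 1))) (Fin (N ℓ)) ℝ)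
      (b' : Ω → ∀ ℓ, Fin (N (ℓ + 1)) → ℝ), IsMeasurableInit P L N μ Cb What' b' ∧
      ∀ᵐ ω ∂P, ∀ ℓ ≤ L, What ω ℓ = What' ω ℓ ∧ b ω ℓ = b' ω ℓ := by
  let What' : Ω → ∀ ℓ, Matrix (Fin (N (ℓ + 1))) (Fin (N ℓ)) ℝ := fun ω ℓ i j =>
    if hℓ : ℓ ≤ L then (h.weight_law ℓ hℓ i j).aemeasurable.mk _ ω else 0
  let b' : Ω → ∀ ℓ, Fin (N (ℓ + 1)) → ℝ := fun ω ℓ i =>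
    if hℓ : ℓ ≤ L then (h.bias_law ℓ hℓ i).aemeasurable.mk _ ω else 0
  have hW : ∀ ℓ ≤ L, ∀ i j, (fun ω => What ω ℓ i j) =ᵐ[P] fun ω => What' ω ℓ i j := by
    intro ℓ hℓ i j
    simp only [What', dif_pos hℓ]
    exact (h.weight_law ℓ hℓ i j).aemeasurable.ae_eq_mk
  have hb : ∀ ℓ ≤ L, ∀ i, (fun ω => b ω ℓ i) =ᵐ[P] fun ω => b' ω ℓ i := by
    intro ℓ hℓ i
    simp only [b', dif_pos hℓ]
    exact (h.bias_law ℓ hℓ i).aemeasurable.ae_eq_mk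
  refine ⟨What', b', ⟨⟨fun ℓ hℓ i j => (h.weight_law ℓ hℓ i j).congr (hW ℓ hℓ i j).symm,
    fun ℓ hℓ i => (h.bias_law ℓ hℓ i).congr (hb ℓ hℓ i).symm, ?_⟩, ?_, ?_⟩, ?_⟩
  · refine h.indep.congr ?_
    rintro (k | k)
    · exact hW _ (Nat.le_of_lt_succ k.1.2) _ _
    · exact hb _ (Nat.le_of_lt_succ k.1.2) _
  · intro ℓ hℓ i j
    simp only [What', dif_pos hℓ]
    exact (h.weight_law ℓ hℓ i j).aemeasurable.measurable_mk
  · intro ℓ hℓ i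
    simp only [b', dif_pos hℓ]
    exact (h.bias_law ℓ hℓ i).aemeasurable.measurable_mk
  · refine ae_all_iff.2 fun ℓ => ?_
    by_cases hℓ : ℓ ≤ L
    · have h1 : ∀ᵐ ω ∂P, ∀ i j, What ω ℓ i j = What' ω ℓ i j :=
        ae_all_iff.2 fun i => ae_all_iff.2 fun j => hW ℓ hℓ i j
      have h2 : ∀ᵐ ω ∂P, ∀ i, b ω ℓ i = b' ω ℓ i := ae_all_iff.2 fun i => hb ℓ hℓ i
      filter_upwards [h1, h2] with ω h1 h2 _
      exact ⟨Matrix.ext h1, funext h2⟩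
    · exact ae_of_all _ fun ω h1 => absurd h1 hℓ

/-! ### Convergence of the output field -/

theorem norm_le_sum_norm_apply {m : ℕ} (v : EuclideanSpace ℝ (Fin m)) :
    ‖v‖ ≤ ∑ i, ‖v i‖ := by
  have h1 : v = ∑ i, v i • EuclideanSpace.single i (1 : ℝ) := by
    ext j
    simp [Pi.single_apply]
  conv_lhs => rw [h1]
  refine (norm_sum_le _ _).trans (Finset.sum_le_sum fun i _ => ?_)
  rw [norm_smul]
  simp

section NetworkFamily

variable {L n₀ nOut : ℕ} {σ : ℝ → ℝ} {CW : ℝ} {μ : Measure ℝ} {Cb : ℝ≥0}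
  {Ω : (Fin L → ℕ+) → Type*} [∀ n, MeasurableSpace (Ω n)] {P : ∀ n, Measure (Ω n)}
  {What : ∀ n, Ω n → ∀ ℓ,
    Matrix (Fin (layerWidth n₀ nOut n (ℓ + 1))) (Fin (layerWidth n₀ nOut n ℓ)) ℝ}
  {b : ∀ n, Ω n → ∀ ℓ, Fin (layerWidth n₀ nOut n (ℓ + 1)) → ℝ}
  [∀ n, IsProbabilityMeasure (P n)]
  (h : ∀ n, IsMeasurableInit (P n) L (layerWidth n₀ nOut n) μ Cb (What n) (b n))
  {T : Set (EuclideanSpace ℝ (Fin n₀))}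
  [MeasurableSpace C(T, EuclideanSpace ℝ (Fin nOut))]
  [BorelSpace C(T, EuclideanSpace ℝ (Fin nOut))]
include h

omit [∀ n, IsProbabilityMeasure (P n)] in
theorem measurable_outputField (hσ : Continuous σ) (hT : IsCompact T) (n : Fin L → ℕ+) :
    Measurable fun ω => outputField hσ T (scaledWeights CW (What n ω)) (b n ω) := by
  have := isCompact_iff_compactSpace.1 hT
  refine measurable_continuousMap_of_eval fun x => ?_
  refine (WithLp.measurable_toLp 2 _).comp (measurable_pi_lambda _ fun i => ?_)
  exact (h n).measurable_randomPreactivation hσ.measurable (x : EuclideanSpace ℝ (Fin n₀)) le_rfl _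

omit [∀ n, IsProbabilityMeasure (P n)] in
/-- Tightness of the output fields, from the moment bounds for the increments of the last layer. -/
theorem isTightMeasureSet_outputField (hσ : Continuous σ) (hT : IsCompact T)
    (hpre : HasMomentBounds (fun p => P p.1) (preactivationField σ CW What b (L + 1))) :
    IsTightMeasureSet {ν | ∃ n, ν = (P n).map
      fun ω => outputField hσ T (scaledWeights CW (What n ω)) (b n ω)} := by
  let z : ∀ n, Ω n → EuclideanSpace ℝ (Fin n₀) → EuclideanSpace ℝ (Fin nOut) := fun n ω x =>
    WithLp.toLp 2 fun i => randomPreactivation (N := layerWidth n₀ nOut n) σ CW (What n) (b n) x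
      (L + 1) (Fin.cast (layerWidth_output n₀ nOut n).symm i) ω
  have hm : ∀ (p : Σ n : Fin L → ℕ+, Fin (layerWidth n₀ nOut n (L + 1))) x,
      Measurable (preactivationField σ CW What b (L + 1) p x) := fun p x =>
    (h p.1).measurable_randomPreactivation hσ.measurable x le_rfl p.2
  have hzm : ∀ n x, Measurable fun ω => z n ω x := fun n x =>
    (WithLp.measurable_toLp 2 _).comp (measurable_pi_lambda _ fun i => hm ⟨n, _⟩ x)
  -- moments of vectors from moments of their coordinates
  have hvec : ∀ n (f : Ω n → EuclideanSpace ℝ (Fin nOut)), Measurable f → ∀ {q : ℕ}, q ≠ 0 →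
      ∀ c : ENNReal, (∀ i, eLpNorm (fun ω => f ω i) q (P n) ≤ c) →
      ∫⁻ ω, ‖f ω‖ₑ ^ q ∂(P n) ≤ (nOut * c) ^ q := by
    intro n f hf q hq c hc
    rw [← eLpNorm_natCast_pow _ hq]
    refine pow_le_pow_left' ?_ q
    have h1 : eLpNorm f q (P n) ≤ eLpNorm (∑ i, fun ω => ‖f ω i‖) q (P n) :=
      eLpNorm_mono_real fun ω => by
        rw [Finset.sum_apply]
        exact norm_le_sum_norm_apply (f ω)
    refine h1.trans ((eLpNorm_sum_le (fun i _ => ?_)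
      (by exact_mod_cast Nat.one_le_iff_ne_zero.2 hq)).trans ?_)
    · have : Measurable fun ω => f ω i := by fun_prop
      exact this.norm.aestronglyMeasurable
    · refine (Finset.sum_le_sum fun i _ => (le_of_eq (eLpNorm_norm _)).trans (hc i)).trans ?_
      simp
  refine isTightMeasureSet_of_increments hT (X := z) (fun n ω => ?_)
    (fun n x => (hzm n x).aestronglyMeasurable)
    (fun n => (measurable_outputField h hσ hT n).aemeasurable) (fun n ω x => rfl) ?_ ?_
  · exact (PiLp.continuous_toLp 2 _).comp (continuous_pi fun i =>
      continuous_preactivation (N := layerWidth n₀ nOut n) hσ _ _ (L + 1) _)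
  · intro R
    obtain ⟨C, hC⟩ := hpre.increment (4 * n₀ + 2) R
    refine ⟨(nOut * C : ℝ) ^ (4 * n₀ + 2), by positivity, fun n x y hx hy => ?_⟩
    refine (hvec n _ ((hzm n x).sub (hzm n y)) (by omega) _ fun i => hC ⟨n, _⟩ x y hx hy).trans
      (le_of_eq ?_)
    rw [← mul_pow, ENNReal.ofReal_pow (by positivity), ENNReal.ofReal_mul (by positivity),
      ENNReal.ofReal_mul (by positivity), ofReal_norm, ENNReal.ofReal_natCast,
      ENNReal.ofReal_coe_nnreal, mul_assoc]
  · intro x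
    obtain ⟨R, hR⟩ := exists_nat_abs_apply_le fun _ : Unit => x
    obtain ⟨C, hC⟩ := hpre.value 1 R
    refine ⟨nOut * C, by positivity, fun n => ?_⟩
    refine (hvec n _ (hzm n x) one_ne_zero _ fun i => hC ⟨n, _⟩ x (hR ())).trans (le_of_eq ?_)
    rw [pow_one, ENNReal.ofReal_mul (by positivity), ENNReal.ofReal_natCast,
      ENNReal.ofReal_coe_nnreal]

/-- The output field converges in distribution, uniformly on the compact set `T`, to the Gaussian
process with independent coordinates whose covariance function is the limiting kernel. -/
theorem exists_tendstoInDistribution_outputField (hσ : Continuous σ) (hT : IsCompact T)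
    {K : EuclideanSpace ℝ (Fin n₀) → EuclideanSpace ℝ (Fin n₀) → ℝ}
    (hΨ : HasLimitCharFun P σ CW What b (L + 1) (fun {_} _ x t => gaussianCharFun K x t))
    (hpre : HasMomentBounds (fun p => P p.1) (preactivationField σ CW What b (L + 1))) :
    ∃ ν : ProbabilityMeasure C(T, EuclideanSpace ℝ (Fin nOut)),
      TendstoInDistribution
        (fun n ω => outputField hσ T (scaledWeights CW (What n ω)) (b n ω)) atTop id P
        (ν : Measure C(T, EuclideanSpace ℝ (Fin nOut))) ∧
      IsIsotropicGaussian (ν : Measure C(T, EuclideanSpace ℝ (Fin nOut))) fun x y => K x y := by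
  have := isCompact_iff_compactSpace.1 hT
  refine exists_tendstoInDistribution_of_isTight
    (fun n => (measurable_outputField h hσ hT n).aemeasurable)
    (isTightMeasureSet_outputField h hσ hT hpre)
    (Φ := fun {α} _ x t => (Real.exp (-(1 / 2) * isotropicVariance (fun x y : T => K x y) x t) : ℝ))
    fun {α} _ x t => ?_
  obtain ⟨δ, hδ, hδ'⟩ := hΨ (Fin nOut) α (fun a => x a) fun r a => t a r
  have e1 : ∏ r : Fin nOut, gaussianCharFun K (fun a => (x a : EuclideanSpace ℝ (Fin n₀)))
      (fun a => t a r)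
      = (Real.exp (-(1 / 2) * isotropicVariance (fun x y : T => K x y) x t) : ℝ) := by
    simp only [gaussianCharFun, isotropicVariance]
    have e2 : ∑ r : Fin nOut, ∑ a, ∑ a', t a r * t a' r * K (x a) (x a')
        = ∑ a, ∑ a', ∑ r : Fin nOut, t a r * t a' r * K (x a) (x a') := by
      rw [Finset.sum_comm]
      exact Finset.sum_congr rfl fun a _ => Finset.sum_comm
    rw [← Complex.ofReal_prod, ← Real.exp_sum, ← Finset.mul_sum, e2]
  rw [tendsto_iff_norm_sub_tendsto_zero, ← e1]
  refine squeeze_zero (fun _ => norm_nonneg _) (fun n => ?_) hδ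
  refine le_of_eq_of_le ?_ (hδ' n (Fin.cast (layerWidth_output n₀ nOut n).symm)
    (Fin.cast_injective _))
  congr 3
  ext ω
  congr 3
  rw [Finset.sum_comm]
  refine Finset.sum_congr rfl fun a _ => ?_
  rw [PiLp.inner_apply]
  refine Finset.sum_congr rfl fun r _ => ?_
  exact mul_comm _ _

end NetworkFamily

/-! ### The infinite-width limit -/

theorem memLp_id_of_integrable_abs_pow {μ : Measure ℝ} [IsFiniteMeasure μ]
    (h : ∀ p : ℕ, Integrable (fun w => |w| ^ p) μ) (q : ℕ) : MemLp id q μ := by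
  have h1 : MemLp id ((q + 1 : ℕ) : ENNReal) μ := by
    rw [← integrable_norm_rpow_iff (by fun_prop) (by simp) (by simp)]
    simpa only [ENNReal.toReal_natCast, Real.rpow_natCast, id, Real.norm_eq_abs] using h (q + 1)
  exact h1.mono_exponent (by exact_mod_cast Nat.le_succ q)

theorem theorem1
    -- architecture: depth, input and output dimension
    (L n₀ nOut : ℕ) (hL : 1 ≤ L) (hn₀ : 1 ≤ n₀) (hnOut : 1 ≤ nOut)
    -- the compact set, and the Borel sigma-algebra on `C⁰(T, ℝ^nOut)`
    (T : Set (EuclideanSpace ℝ (Fin n₀))) (hT : IsCompact T)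
    [MeasurableSpace C(T, EuclideanSpace ℝ (Fin nOut))]
    [BorelSpace C(T, EuclideanSpace ℝ (Fin nOut))]
    -- the non-linearity
    (σ : ℝ → ℝ) (hσ : LocallyAbsolutelyContinuous σ) (hσ' : PolynomiallyBoundedDeriv σ)
    -- the law of the unscaled weights: mean 0, variance 1, all moments finite
    (μ : Measure ℝ) [IsProbabilityMeasure μ] (hμ_moments : ∀ p : ℕ, Integrable (fun w => |w| ^ p) μ)
    (hμ_mean : ∫ w, w ∂μ = 0) (hμ_var : Var[id; μ] = 1)
    (CW : ℝ) (hCW : 0 < CW) (Cb : ℝ≥0)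
    -- for every choice of the hidden widths, a network with random weights and biases
    {Ω : (Fin L → ℕ+) → Type*} [∀ n, MeasurableSpace (Ω n)]
    (P : ∀ n, Measure (Ω n)) [∀ n, IsProbabilityMeasure (P n)]
    (What : ∀ n, Ω n → ∀ ℓ,
      Matrix (Fin (layerWidth n₀ nOut n (ℓ + 1))) (Fin (layerWidth n₀ nOut n ℓ)) ℝ)
    (b : ∀ n, Ω n → ∀ ℓ, Fin (layerWidth n₀ nOut n (ℓ + 1)) → ℝ)
    (hinit : ∀ n, IsRandomInit (P n) L (layerWidth n₀ nOut n) μ Cb (What n) (b n)) :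
    ∃ K : ℕ → EuclideanSpace ℝ (Fin n₀) → EuclideanSpace ℝ (Fin n₀) → ℝ,
      -- `K ℓ` is the infinite-width limit of the covariance at layer `ℓ`
      (∀ n (x : EuclideanSpace ℝ (Fin n₀)), ∀ ℓ ≤ L + 1, ∀ i,
        MemLp (randomPreactivation (N := layerWidth n₀ nOut n) σ CW (What n) (b n) x ℓ i) 2 (P n)) ∧
      (∀ ℓ, 2 ≤ ℓ → ℓ ≤ L + 1 → ∀ (x y) (i : ∀ n, Fin (layerWidth n₀ nOut n ℓ)),
        Tendsto (fun n => cov[randomPreactivation (N := layerWidth n₀ nOut n) σ CW (What n) (b n) x ℓ (i n),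
            randomPreactivation (N := layerWidth n₀ nOut n) σ CW (What n) (b n) y ℓ (i n); P n])
          atTop (𝓝 (K ℓ x y))) ∧
      -- initial condition
      (∀ x y n i,
        Integrable (fun ω => σ (randomPreactivation (N := layerWidth n₀ nOut n) σ CW (What n) (b n) x 1 i ω)
          * σ (randomPreactivation (N := layerWidth n₀ nOut n) σ CW (What n) (b n) y 1 i ω)) (P n) ∧
        K 2 x y = Cb + CW * ∫ ω, σ (randomPreactivation (N := layerWidth n₀ nOut n) σ CW (What n) (b n) x 1 i ω)
          * σ (randomPreactivation (N := layerWidth n₀ nOut n) σ CW (What n) (b n) y 1 i ω) ∂(P n)) ∧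
      -- layerwise recursion
      (∀ ℓ, 2 ≤ ℓ → ∀ x y,
        !![K ℓ x x, K ℓ x y; K ℓ x y, K ℓ y y].PosSemidef ∧
        Integrable (fun v => σ (v 0) * σ (v 1))
          (multivariateGaussian 0 !![K ℓ x x, K ℓ x y; K ℓ x y, K ℓ y y]) ∧
        K (ℓ + 1) x y = Cb + CW * ∫ v, σ (v 0) * σ (v 1)
          ∂(multivariateGaussian 0 !![K ℓ x x, K ℓ x y; K ℓ x y, K ℓ y y])) ∧
      -- weak convergence in `C⁰(T, ℝ^nOut)` to a centered Gaussian process with iid coordinates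
      -- and coordinate-wise covariance function `K (L + 1)`
      ∃ ν : ProbabilityMeasure C(T, EuclideanSpace ℝ (Fin nOut)),
        TendstoInDistribution
          (fun n ω => outputField hσ.continuous T (scaledWeights CW (What n ω)) (b n ω))
          atTop id P (ν : Measure C(T, EuclideanSpace ℝ (Fin nOut))) ∧
        IsGaussianProcess (fun (x : T) (f : C(T, EuclideanSpace ℝ (Fin nOut))) => f x)
          (ν : Measure C(T, EuclideanSpace ℝ (Fin nOut))) ∧
        (∀ x : T, ∫ f, f x ∂(ν : Measure C(T, EuclideanSpace ℝ (Fin nOut))) = 0) ∧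
        iIndepFun
          (fun (i : Fin nOut) (f : C(T, EuclideanSpace ℝ (Fin nOut))) (x : T) => f x i)
          (ν : Measure C(T, EuclideanSpace ℝ (Fin nOut))) ∧
        (∀ i j : Fin nOut,
          IdentDistrib (fun (f : C(T, EuclideanSpace ℝ (Fin nOut))) (x : T) => f x i)
            (fun (f : C(T, EuclideanSpace ℝ (Fin nOut))) (x : T) => f x j)
            (ν : Measure C(T, EuclideanSpace ℝ (Fin nOut)))
            (ν : Measure C(T, EuclideanSpace ℝ (Fin nOut)))) ∧
        (∀ (i : Fin nOut) (x y : T),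
          cov[fun f : C(T, EuclideanSpace ℝ (Fin nOut)) => f x i,
            fun f : C(T, EuclideanSpace ℝ (Fin nOut)) => f y i;
            (ν : Measure C(T, EuclideanSpace ℝ (Fin nOut)))] = K (L + 1) x y) := by
  have hσm := hσ.continuous.measurable
  obtain ⟨C, k, hlip⟩ := exists_polynomial_lipschitz hσ hσ'
  obtain ⟨Cg, kg, hg⟩ := exists_polynomial_growth hlip
  have hμL : ∀ q : ℕ, MemLp id q μ := memLp_id_of_integrable_abs_pow hμ_moments
  have hμ1 : ∫ w, w ^ 2 ∂μ = 1 := by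
    rw [variance_of_integral_eq_zero aemeasurable_id hμ_mean] at hμ_var
    exact hμ_var
  choose What' b' h hae using fun n => (hinit n).exists_isMeasurableInit
  have haeW : ∀ n, ∀ᵐ ω ∂(P n), ∀ x, ∀ ℓ ≤ L + 1,
      preactivation (N := layerWidth n₀ nOut n) σ (scaledWeights CW (What' n ω)) (b' n ω) x ℓ
        = preactivation σ (scaledWeights CW (What n ω)) (b n ω) x ℓ := by
    intro n
    filter_upwards [hae n] with ω hω x ℓ hℓ
    refine preactivation_congr (fun ℓ hℓ => ?_) x ℓ hℓ
    simp [scaledWeights, hω ℓ hℓ]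
  have hz : ∀ n x, ∀ ℓ ≤ L + 1, ∀ i,
      randomPreactivation (N := layerWidth n₀ nOut n) σ CW (What' n) (b' n) x ℓ i
        =ᵐ[P n] randomPreactivation σ CW (What n) (b n) x ℓ i := by
    intro n x ℓ hℓ i
    filter_upwards [haeW n] with ω hω
    exact congrFun (hω x ℓ hℓ) i
  have hmom := fun {ℓ : ℕ} (hℓ : ℓ ≤ L) =>
    hasMomentBounds_fields (ℓ := ℓ) h hσm hlip hn₀ hCW.le hμL hμ_mean hℓ
  have hm : ∀ n x, ∀ ℓ ≤ L + 1, ∀ i, Measurable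
      (randomPreactivation (N := layerWidth n₀ nOut n) σ CW (What' n) (b' n) x ℓ i) :=
    fun n x ℓ hℓ i => (h n).measurable_randomPreactivation hσm x hℓ i
  have hzL : ∀ n x, ∀ ℓ ≤ L, ∀ i, ∀ q : ℕ, MemLp (randomPreactivation
      (N := layerWidth n₀ nOut n) σ CW (What' n) (b' n) x (ℓ + 1) i) q (P n) :=
    fun n x ℓ hℓ i q => (hmom hℓ).2.memLp (i := ⟨n, i⟩)
      (fun p x => hm p.1 x (ℓ + 1) (by omega) p.2) x q
  obtain ⟨γ₁, hγ₁_prob, hγ₁_charFun, hγ₁⟩ := exists_firstLayerLaw (σ := σ) (CW := CW) h hσm hL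
  -- the kernels can be read off from any neuron of the first layer of any of the networks
  let n₁ : Fin L → ℕ+ := fun _ => 1
  let i₁ : Fin (layerWidth n₀ nOut n₁ 1) :=
    ⟨0, Nat.pos_of_ne_zero (layerWidth_ne_zero hn₀ _ hL)⟩
  have hker := kernelSeq_symm_and_posSemidef hσ.continuous hg
    (fun x => hm n₁ x 1 (by omega) i₁) (fun x => hzL n₁ x 0 (by omega) i₁)
    (fun x y => hγ₁ x y n₁ i₁) hCW.le Cb
  have hlim := hasLimitCharFun_kernelSeq h hσ.continuous hlip hn₀ hCW.le hμ_moments hμ_mean hμ1 hμL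
    hγ₁_charFun hγ₁ (fun k => (hker k).1) (fun k => (hker k).2)
  refine ⟨fun ℓ => kernelSeq σ CW Cb γ₁ (ℓ - 2), ?_, ?_, ?_, ?_, ?_⟩
  · rintro n x (_ | ℓ) hℓ i
    · exact memLp_const (x i)
    · exact (memLp_congr_ae (hz n x _ hℓ i)).1 (hzL n x ℓ (by omega) i 2)
  · intro ℓ h2 hℓ x y i
    obtain ⟨k, rfl⟩ := Nat.exists_eq_add_of_le' h2
    refine ((hlim k (by omega)).tendsto_covariance h hσm hℓ (hker k).1 (hker k).2
      (hmom (by omega)).2 x y i).congr fun n => ?_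
    exact covariance_congr_ae (hz n x _ hℓ _) (hz n y _ hℓ _)
  · intro x y n i
    have hae' : (fun ω => σ (randomPreactivation (N := layerWidth n₀ nOut n) σ CW (What' n) (b' n)
        x 1 i ω) * σ (randomPreactivation (N := layerWidth n₀ nOut n) σ CW (What' n) (b' n) y 1 i ω))
        =ᵐ[P n] fun ω => σ (randomPreactivation (N := layerWidth n₀ nOut n) σ CW (What n) (b n)
        x 1 i ω) * σ (randomPreactivation (N := layerWidth n₀ nOut n) σ CW (What n) (b n) y 1 i ω) := by
      filter_upwards [hz n x 1 (by omega) i, hz n y 1 (by omega) i] with ω h1 h2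
      rw [h1, h2]
    have hL2 : ∀ x, MemLp (fun ω => σ (randomPreactivation (N := layerWidth n₀ nOut n) σ CW
        (What' n) (b' n) x 1 i ω)) 2 (P n) := fun x =>
      memLp_comp_of_growth hσm hg (hm n x 1 (by omega) i) (hzL n x 0 (by omega) i) 2
    refine ⟨((hL2 x).integrable_mul (hL2 y)).congr hae', ?_⟩
    rw [← integral_congr_ae hae']
    exact kernelSeq_zero_eq hσ.continuous (fun x => hm n x 1 (by omega) i)
      (fun x y => hγ₁ x y n i) CW Cb x y
  · intro ℓ h2 x y
    obtain ⟨k, rfl⟩ := Nat.exists_eq_add_of_le' h2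
    exact ⟨(hker k).2 x y, (memLp_mul_eval_multivariateGaussian hσ.continuous hg
      ((hker k).2 x y)).integrable one_le_two, rfl⟩
  · obtain ⟨k, rfl⟩ := Nat.exists_eq_add_of_le' hL
    have := isCompact_iff_compactSpace.1 hT
    obtain ⟨ν, hν, hν'⟩ := exists_tendstoInDistribution_outputField h hσ.continuous hT
      (hlim k le_rfl) (hmom le_rfl).2
    have hsymm : ∀ x y : T, kernelSeq σ CW Cb γ₁ k x y = kernelSeq σ CW Cb γ₁ k y x :=
      fun x y => (hker k).1 x y
    refine ⟨ν, hν.congr (fun n => ?_) .rfl, hν'.isGaussian, hν'.integral_apply,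
      hν'.iIndepFun_apply hsymm, hν'.identDistrib_apply, fun i x y => ?_⟩
    · filter_upwards [haeW n] with ω hω
      refine ContinuousMap.ext fun x => ?_
      simp only [outputField, ContinuousMap.coe_mk, hω x _ le_rfl]
    · rw [hν'.covariance_apply hsymm x y i i, if_pos rfl]
      rfl
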